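/- **Setting.** Cover $\mathbb P^1$ over $\mathbb C$ by $U_0=\mathrm{Spec}\,\mathbb C[y_0]$ and $U_\infty=\mathrm{Spec}\,\mathbb C[y_\infty]$ with $y_\infty=1/y_0$ on the overlap. A *ring-set-homomorphism* $\varphi:\mathbb C[y]\to M_n(\mathbb C)$ is a map of $\mathbb C$-algebras that need not preserve $1$; it is the same as a pair $(e,m)=(\varphi(1),\varphi(y))$ with $e^2=e$, $em=me=m$; write $\langle e,m\rangle$ for its image. The space of ring-set-homomorphisms has the topology in which $\psi=(e',m')$ is near $(e,m)$ if there is an idempotent $e''\in\langle e',m'\rangle$ of the same rank as $e$ with $e''$ near $e$ and $e''m'$ near $m$, such that $0$ is a characteristic value of $(e'-e'')m'$ of multiplicity exactly $n-(\mathrm{rank}\,e'-\mathrm{rank}\,e)$ and all its other characteristic values are near $\infty$. A *morphism* $\mathrm{Space}\,M_n(\mathbb C)\to\mathbb P^1$ is a pair $\varphi=((e_0,m_0),(e_\infty,m_\infty))$ of ring-set-homomorphisms from $\mathbb C[y_0]$ and $\mathbb C[y_\infty]$ such that $e_0$ commutes with $m_\infty$ and $e_\infty$, $e_\infty$ commutes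 with $m_0$, $\mathbf 1=e_0+e_\infty-e_0e_\infty$, $e_\infty\langle e_0,m_0\rangle=e_0\langle e_\infty,m_\infty\rangle$, $e_0e_\infty\in\langle e_0,m_0\rangle\cap\langle e_\infty,m_\infty\rangle$, $e_\infty m_0$ and $e_0m_\infty$ are inverse to each other in $e_\infty\langle e_0,m_0\rangle$ (whose identity is $e_0e_\infty$), and $\langle e_0,m_0\rangle\to e_\infty\langle e_0,m_0\rangle$, $\langle e_\infty,m_\infty\rangle\to e_0\langle e_\infty,m_\infty\rangle$ are the localizations at $m_0$ and at $m_\infty$. $\mathrm{Map}:=\mathrm{Map}((\mathrm{Space}\,M_n(\mathbb C);\mathbb C^n),\mathbb P^1)$ is the space of morphisms (a subspace of the product) modulo conjugation by $GL_n(\mathbb C)$, with the quotient topology. The *image* $\mathrm{Im}\,\hat\varphi\subset\mathbb P^1$ is the closed subscheme with ideals $\mathrm{Ker}\,\varphi_0$ and $\mathrm{Ker}\,\varphi_\infty$ on the charts. For a point $p\in\mathbb P^1$, $V_p(\varphi)\subset\mathbb C^n$ is the part supported at $p$ of the Chan-Paton module ($e_0\mathbb C^n$ on $U_0$, $e_\infty\mathbb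 C^n$ on $U_\infty$). The *gauge algebra* $C(\varphi)\subset M_n(\mathbb C)$ is the centralizer of $\langle e_0,m_0\rangle+\langle e_\infty,m_\infty\rangle$. $(\mathbb P^1)^{[n]}$ is the Hilbert scheme of $0$-dimensional subschemes of length $n$, and $S^n(\mathbb P^1)$ is the $n$-th symmetric product, both with the analytic topology. **Proposition.** There are maps $\Phi_{Hilb}:(\mathbb P^1)^{[n]}\to\mathrm{Map}$, $\Phi_{Chow}:S^n(\mathbb P^1)\to\mathrm{Map}$ and $\pi:\mathrm{Map}\to S^n(\mathbb P^1)$ such that: 1. $\Phi_{Hilb}$ is a topological embedding, the image subscheme of $\Phi_{Hilb}(Z)$ is $Z$, and the image of $\Phi_{Hilb}$ consists of all $[\varphi]$ for which $\mathrm{Im}\,\hat\varphi$ has length $n$. 2. $\Phi_{Chow}$ is a topological embedding, $\Phi_{Chow}(p_1+\dots+p_n)$ is the class of the diagonal morphism with entries $p_1,\dots,p_n$, and the image of $\Phi_{Chow}$ consists of all $[\varphi]$ for which $\mathrm{Im}\,\hat\varphi$ is reduced (it then has length $\le n$). 3. $\pi$ is continuous, $\pi[\varphi]=\sum_p\dim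 V_p(\varphi)\cdot p$, and $\pi\circ\Phi_{Chow}=\mathrm{id}$. 4. (Higgsing/un-Higgsing in the Chow locus.) Let $[\varphi]\in\mathrm{Im}\,\Phi_{Chow}$. (a) The length of $\mathrm{Im}\,\hat\varphi$ is the number of points $p$ with $V_p(\varphi)\ne0$; functions act on $V_p(\varphi)$ through their value at $p$; $\mathbb C^n=\bigoplus_pV_p(\varphi)$; and $C(\varphi)\cong\prod_{p:\,V_p(\varphi)\neq 0}\mathrm{End}(V_p(\varphi))$ through the action on the $V_p(\varphi)$. (b) (Higgsing) If $\pi[\varphi]=\sum_{i=1}^k\nu_ib_i$ with $\nu_i>0$ and $b_i\in\mathbb P^1$ not necessarily distinct, there are continuous families $\varphi_t$ of morphisms and $P_i(t)$ of points, $t\in[0,1]$, with $\varphi_0=\varphi$, $P_i(0)=b_i$, $[\varphi_t]\in\mathrm{Im}\,\Phi_{Chow}$, $\pi[\varphi_t]=\sum_i\nu_iP_i(t)$, and, for $t\ne0$: the $P_i(t)$ are distinct, $V_p(\varphi)=\sum_{b_i=p}V_{P_i(t)}(\varphi_t)$ for all $p$, and $C(\varphi_t)\subset C(\varphi)$, properly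 if the $b_i$ are not distinct. (c) (un-Higgsing) If $\pi[\varphi]=\sum_{i=1}^k\nu_ib_i$ with $\nu_i>0$ and distinct $b_i$, and labels $s(1),\dots,s(k)$ are given, there are continuous families $\varphi_t$, $P_i(t)$, $t\in[0,1]$, with $\varphi_0=\varphi$, $P_i(0)=b_i$, $[\varphi_t]\in\mathrm{Im}\,\Phi_{Chow}$, $\pi[\varphi_t]=\sum_i\nu_iP_i(t)$, the $P_i(t)$ distinct for $t\ne1$, $P_i(1)=P_j(1)$ if and only if $s(i)=s(j)$, $V_p(\varphi_1)=\sum_{P_i(1)=p}V_{b_i}(\varphi)$ for all $p$, and $C(\varphi)\subset C(\varphi_1)$, properly if the labels are not distinct. -/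

import Mathlib

open Polynomial

open scoped LaurentPolynomial

namespace D0

noncomputable section

/-- The complex `n × n` matrices `M_n(ℂ)`. -/
abbrev Mat (n : ℕ) : Type := Matrix (Fin n) (Fin n) ℂ

/-- The `ℂ`-points of the projective line with the analytic topology, as the Riemann sphere:
`(a : P1)`, for `a : ℂ`, is the point `y₀ = a` of the chart `U₀ = Spec ℂ[y₀]`, and `∞` is the point
`y_∞ = 0` of the chart `U_∞ = Spec ℂ[y_∞]`; on the overlap `y_∞ = 1 / y₀`. -/
abbrev P1 : Type := OnePoint ℂ

/-! ### Ring-set-homomorphisms `ℂ[y] → M_n(ℂ)` and their topology -/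

/-- Ring-set-homomorphisms `ℂ[y] → M_n(ℂ)`: maps of `ℂ`-algebras that need not send `1` to `1`.
Such a map is the same as the pair `(e, m) = (φ 1, φ y)`, with `e² = e` and `em = me = m`. -/
def RingSetHom (n : ℕ) : Type := ℂ[X] →ₙₐ[ℂ] Mat n

instance (n : ℕ) : FunLike (RingSetHom n) ℂ[X] (Mat n) :=
  inferInstanceAs (FunLike (ℂ[X] →ₙₐ[ℂ] Mat n) ℂ[X] (Mat n))

instance (n : ℕ) : NonUnitalAlgHomClass (RingSetHom n) ℂ ℂ[X] (Mat n) :=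
  inferInstanceAs (NonUnitalAlgHomClass (ℂ[X] →ₙₐ[ℂ] Mat n) ℂ ℂ[X] (Mat n))

/-- The `ε`-neighbourhood of `φ = (e, m)`: all `ψ = (e', m')` for which there is an idempotent `e''`
in the (commutative) ring `⟨e', m'⟩ = ψ(ℂ[y])`, of the same rank as `e`, such that `e''` is close to
`e`, `e'' m'` is close to `m`, the characteristic value `0` of `(e' - e'') m'` has multiplicity
exactly `n - (rank e' - rank e)`, and its other characteristic values are close to `∞`. -/
def nhd {n : ℕ} (φ : RingSetHom n) (ε : ℝ) : Set (RingSetHom n) :=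
  {ψ | ∃ e ∈ Set.range ψ, e * e = e ∧ e.rank = (φ 1).rank ∧
    (∀ i j, ‖e i j - φ 1 i j‖ < ε) ∧
    (∀ i j, ‖(e * ψ X) i j - φ X i j‖ < ε) ∧
    (((ψ 1 - e) * ψ X).charpoly.rootMultiplicity 0 + (ψ 1).rank = n + (φ 1).rank) ∧
    ∀ c : ℂ, ((ψ 1 - e) * ψ X).charpoly.IsRoot c → c ≠ 0 → ε⁻¹ < ‖c‖}

lemma nhd_mono {n : ℕ} (φ : RingSetHom n) {δ ε : ℝ} (hδ : 0 < δ) (h : δ ≤ ε) :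
    nhd φ δ ⊆ nhd φ ε := by
  rintro ψ ⟨e, he, h1, h2, h3, h4, h5, h6⟩
  refine ⟨e, he, h1, h2, fun i j => (h3 i j).trans_le h, fun i j => (h4 i j).trans_le h, h5, ?_⟩
  exact fun c hc hc0 => (inv_anti₀ hδ h).trans_lt (h6 c hc hc0)

/-- The analytic topology on the space of ring-set-homomorphisms `ℂ[y] → M_n(ℂ)`, in which part of
the spectrum of `m` may run off to infinity. -/
instance (n : ℕ) : TopologicalSpace (RingSetHom n) where
  IsOpen U := ∀ φ ∈ U, ∃ ε > 0, nhd φ ε ⊆ U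
  isOpen_univ := fun _ _ => ⟨1, one_pos, Set.subset_univ _⟩
  isOpen_inter := by
    rintro U V hU hV φ ⟨h1, h2⟩
    obtain ⟨δ, hδ, h1⟩ := hU φ h1
    obtain ⟨ε, hε, h2⟩ := hV φ h2
    exact ⟨min δ ε, lt_min hδ hε, Set.subset_inter
      ((nhd_mono φ (lt_min hδ hε) (min_le_left _ _)).trans h1)
      ((nhd_mono φ (lt_min hδ hε) (min_le_right _ _)).trans h2)⟩
  isOpen_sUnion := by
    rintro S hS φ ⟨U, hU, h⟩
    obtain ⟨ε, hε, h⟩ := hS U hU φ h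
    exact ⟨ε, hε, h.trans (Set.subset_sUnion_of_mem hU)⟩

/-- The ideal `Ker φ` of `ℂ[y]`. -/
def kerIdeal {n : ℕ} (φ : RingSetHom n) : Ideal ℂ[X] where
  carrier := {f | φ f = 0}
  add_mem' {f g} hf hg := by
    change φ (f + g) = 0
    rw [map_add, show φ f = 0 from hf, show φ g = 0 from hg, add_zero]
  zero_mem' := map_zero φ
  smul_mem' f g hg := by
    change φ (f * g) = 0
    rw [map_mul, show φ g = 0 from hg, mul_zero]

/-! ### Morphisms `Space M_n(ℂ) → ℙ¹` -/

/-- Morphisms from the noncommutative point `Space M_n(ℂ)` to `ℙ¹`: pairs of ring-set-homomorphisms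
`φ₀ = (e₀, m₀) : ℂ[y₀] → M_n(ℂ)` and `φ_∞ = (e_∞, m_∞) : ℂ[y_∞] → M_n(ℂ)` that descend to the
localization `ℂ[y₀, 1/y₀] ≃ ℂ[1/y_∞, y_∞]` and glue there. -/
structure Mor (n : ℕ) where
  /-- The ring-set-homomorphism on the chart `U₀`. -/
  φ₀ : RingSetHom n
  /-- The ring-set-homomorphism on the chart `U_∞`. -/
  φInf : RingSetHom n
  /-- `e₀` commutes with `φ_∞(ℂ[y_∞])`. -/
  comm₀ : ∀ f, φ₀ 1 * φInf f = φInf f * φ₀ 1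
  /-- `e_∞` commutes with `φ₀(ℂ[y₀])`. -/
  commInf : ∀ f, φInf 1 * φ₀ f = φ₀ f * φInf 1
  /-- The two charts cover. -/
  cover : 1 = φ₀ 1 + φInf 1 - φ₀ 1 * φInf 1
  /-- `e_∞ ⟨e₀, m₀⟩ = e₀ ⟨e_∞, m_∞⟩`. -/
  overlap : Set.range (fun f => φInf 1 * φ₀ f) = Set.range (fun f => φ₀ 1 * φInf f)
  /-- `e₀ e_∞ ∈ ⟨e₀, m₀⟩`. -/
  overlap_mem₀ : φ₀ 1 * φInf 1 ∈ Set.range φ₀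
  /-- `e₀ e_∞ ∈ ⟨e_∞, m_∞⟩`. -/
  overlap_memInf : φ₀ 1 * φInf 1 ∈ Set.range φInf
  /-- `e_∞ m₀` and `e₀ m_∞` are inverse to each other in `e_∞ ⟨e₀, m₀⟩ = e₀ ⟨e_∞, m_∞⟩`, the
  identity of which is `e₀ e_∞`. -/
  glue : (φInf 1 * φ₀ X) * (φ₀ 1 * φInf X) = φ₀ 1 * φInf 1
  /-- The same, in the other order. -/
  glue' : (φ₀ 1 * φInf X) * (φInf 1 * φ₀ X) = φ₀ 1 * φInf 1
  /-- `⟨e₀, m₀⟩ → e_∞ ⟨e₀, m₀⟩` is the localization of `⟨e₀, m₀⟩` at `m₀`, that is, the push-out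
  of `ℂ[y₀] → ℂ[y₀, 1/y₀]` along `φ₀`. -/
  pushout₀ : ∀ f, φInf 1 * φ₀ f = 0 ↔ ∃ k : ℕ, φ₀ (X ^ k * f) = 0
  /-- `⟨e_∞, m_∞⟩ → e₀ ⟨e_∞, m_∞⟩` is the localization of `⟨e_∞, m_∞⟩` at `m_∞`. -/
  pushoutInf : ∀ f, φ₀ 1 * φInf f = 0 ↔ ∃ k : ℕ, φInf (X ^ k * f) = 0

/-- `Mor(Space M_n(ℂ), ℙ¹)` is a subspace of the product of the two spaces of
ring-set-homomorphisms. -/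
instance (n : ℕ) : TopologicalSpace (Mor n) :=
  TopologicalSpace.induced (fun φ : Mor n => (φ.φ₀, φ.φInf)) inferInstance

/-- Two morphisms are isomorphic if they are conjugate under `GL_n(ℂ)`. -/
def Mor.Conj {n : ℕ} (φ ψ : Mor n) : Prop :=
  ∃ g : (Mat n)ˣ, ∀ f,
    ψ.φ₀ f = g * φ.φ₀ f * (g⁻¹ : (Mat n)ˣ) ∧ ψ.φInf f = g * φ.φInf f * (g⁻¹ : (Mat n)ˣ)

instance Mor.setoid (n : ℕ) : Setoid (Mor n) where
  r := Mor.Conj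
  iseqv :=
    { refl := fun φ => ⟨1, fun f => by simp⟩
      symm := by
        rintro φ ψ ⟨g, h⟩
        exact ⟨g⁻¹, fun f => by rw [(h f).1, (h f).2]; simp [mul_assoc]⟩
      trans := by
        rintro φ ψ χ ⟨g, h⟩ ⟨k, h'⟩
        exact ⟨k * g, fun f => by
          rw [(h' f).1, (h' f).2, (h f).1, (h f).2]; simp [mul_assoc]⟩ }

/-- `Map((Space M_n(ℂ); ℂⁿ), ℙ¹)`: the orbit space of the `GL_n(ℂ)`-action on the space of
morphisms, with the quotient topology. -/
abbrev MapSpace (n : ℕ) : Type := Quotient (Mor.setoid n)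

/-! ### Closed subschemes of `ℙ¹` -/

/-- The restriction `ℂ[y₀] → ℂ[T, 1/T]`, `y₀ ↦ T`, to the overlap of the charts. -/
def res₀ : ℂ[X] →ₐ[ℂ] ℂ[T;T⁻¹] := Polynomial.toLaurentAlg

/-- The restriction `ℂ[y_∞] → ℂ[T, 1/T]`, `y_∞ ↦ 1/T`, to the overlap of the charts. -/
def resInf : ℂ[X] →ₐ[ℂ] ℂ[T;T⁻¹] :=
  (LaurentPolynomial.invert : ℂ[T;T⁻¹] ≃ₐ[ℂ] ℂ[T;T⁻¹]).toAlgHom.comp Polynomial.toLaurentAlg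

/-- A closed subscheme of `ℙ¹`: an ideal on each of the two charts, with the same extension to the
overlap. -/
@[ext] structure ClosedSubscheme where
  /-- The ideal on the chart `U₀`. -/
  I₀ : Ideal ℂ[X]
  /-- The ideal on the chart `U_∞`. -/
  IInf : Ideal ℂ[X]
  glue : I₀.map res₀ = IInf.map resInf

namespace ClosedSubscheme

variable (Z : ClosedSubscheme)

/-- The coordinate ring of the part of `Z` in the overlap of the charts. -/
abbrev OverlapRing : Type := ℂ[T;T⁻¹] ⧸ Z.I₀.map res₀

/-- Restriction of functions on `Z ∩ U₀` to the overlap. -/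
def restrict₀ : ℂ[X] ⧸ Z.I₀ →ₐ[ℂ] Z.OverlapRing :=
  Ideal.quotientMapₐ _ res₀ Ideal.le_comap_map

/-- Restriction of functions on `Z ∩ U_∞` to the overlap. -/
def restrictInf : ℂ[X] ⧸ Z.IInf →ₐ[ℂ] Z.OverlapRing :=
  Ideal.quotientMapₐ _ resInf (by rw [Z.glue]; exact Ideal.le_comap_map)

/-- The ring `H⁰(Z, 𝒪_Z)` of global functions on `Z`. -/
def globalSections : Subalgebra ℂ ((ℂ[X] ⧸ Z.I₀) × (ℂ[X] ⧸ Z.IInf)) :=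
  AlgHom.equalizer (Z.restrict₀.comp (AlgHom.fst ℂ _ _)) (Z.restrictInf.comp (AlgHom.snd ℂ _ _))

/-- `Z` is a `0`-dimensional subscheme of length `d`: it is finite over `ℂ`, with
`dim H⁰(Z, 𝒪_Z) = d`. -/
def HasLength (d : ℕ) : Prop :=
  Module.Finite ℂ (ℂ[X] ⧸ Z.I₀) ∧ Module.Finite ℂ (ℂ[X] ⧸ Z.IInf) ∧
    Module.finrank ℂ Z.globalSections = d

/-- `Z` is reduced. -/
def Reduced : Prop := IsReduced (ℂ[X] ⧸ Z.I₀) ∧ IsReduced (ℂ[X] ⧸ Z.IInf)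

end ClosedSubscheme

/-! ### The Hilbert scheme `(ℙ¹)^[n]` -/

lemma resInf_X_pow (k : ℕ) : resInf (X ^ k) = LaurentPolynomial.T (-(k : ℤ)) := by
  simp [resInf]

lemma res₀_X_pow (k : ℕ) : res₀ (X ^ k) = LaurentPolynomial.T (k : ℤ) := by
  simp [res₀]

/-- The restriction `F(y₀, 1)` to `U₀` of the binary form `F(u, v) = ∑ aᵢ uⁱ vⁿ⁻ⁱ`. -/
def form₀ {n : ℕ} (a : Fin (n + 1) → ℂ) : ℂ[X] := ∑ i, a i • X ^ (i : ℕ)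

/-- The restriction `F(1, y_∞)` to `U_∞` of the binary form `F(u, v) = ∑ aᵢ uⁱ vⁿ⁻ⁱ`. -/
def formInf {n : ℕ} (a : Fin (n + 1) → ℂ) : ℂ[X] := ∑ i, a i • X ^ (n - (i : ℕ))

lemma res_form {n : ℕ} (a : Fin (n + 1) → ℂ) :
    res₀ (form₀ a) = LaurentPolynomial.T n * resInf (formInf a) := by
  simp only [form₀, formInf, map_sum, map_smul, resInf_X_pow, res₀_X_pow, Finset.mul_sum,
    mul_smul_comm, ← LaurentPolynomial.T_add]
  refine Finset.sum_congr rfl fun i _ => ?_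
  have := i.2
  congr 2
  omega

/-- The closed subscheme of `ℙ¹` cut out by a binary form. -/
def zeroScheme (n : ℕ) (a : Fin (n + 1) → ℂ) : ClosedSubscheme where
  I₀ := Ideal.span {form₀ a}
  IInf := Ideal.span {formInf a}
  glue := by
    rw [Ideal.map_span, Ideal.map_span, Set.image_singleton, Set.image_singleton, res_form,
      mul_comm, Ideal.span_singleton_mul_right_unit (LaurentPolynomial.isUnit_T n)]

/-- The Hilbert scheme `(ℙ¹)^[n]` of `n` points on `ℙ¹` (its set of `ℂ`-points). -/
def Hilb (n : ℕ) : Type := {Z : ClosedSubscheme // Z.HasLength n}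

/-- The analytic topology on `(ℙ¹)^[n] ≃ ℙⁿ`: the quotient topology from the space of nonzero binary
forms of degree `n`, through `F ↦ {F = 0}`. -/
instance (n : ℕ) : TopologicalSpace (Hilb n) :=
  TopologicalSpace.induced Subtype.val
    (TopologicalSpace.coinduced
      (fun a : {a : Fin (n + 1) → ℂ // a ≠ 0} => zeroScheme n a.1) inferInstance)

/-! ### The Chow variety `Sⁿ(ℙ¹)` -/

/-- The symmetric product `Sⁿ(ℙ¹)`: effective `0`-cycles of degree `n` on `ℙ¹`. -/
def SymP1 (n : ℕ) : Type := Sym P1 n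

namespace SymP1

/-- The cycle `p₁ + ⋯ + pₙ`. -/
def ofPoints {n : ℕ} (p : Fin n → P1) : SymP1 n := Sym.mk (Finset.univ.val.map p) (by simp)

/-- The quotient topology from `(ℙ¹)ⁿ`. -/
instance (n : ℕ) : TopologicalSpace (SymP1 n) :=
  TopologicalSpace.coinduced (ofPoints (n := n)) inferInstance

open Classical in
/-- The multiplicity of a point in a cycle. -/
def mult {n : ℕ} (c : SymP1 n) (p : P1) : ℕ := Multiset.count p (c : Sym P1 n).1

end SymP1

/-! ### The image, the Chan-Paton module and the gauge symmetry of a D0-brane -/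

lemma gluing_aux {n : ℕ} (φ ψ : RingSetHom n)
    (hc : ∀ f, ψ 1 * φ f = φ f * ψ 1) (hc' : ∀ f, φ 1 * ψ f = ψ f * φ 1)
    (hg : (ψ 1 * φ X) * (φ 1 * ψ X) = φ 1 * ψ 1)
    {f : ℂ[X]} (hf : φ f = 0) : φ 1 * ψ f.reverse = 0 := by
  have h1 : ∀ g, φ g * φ 1 = φ g := fun g => by rw [← map_mul, mul_one]
  have h2 : ∀ g, ψ 1 * ψ g = ψ g := fun g => by rw [← map_mul, one_mul]
  have h3 : ∀ i : ℕ, φ (X ^ i) * ψ (X ^ i) = φ 1 * ψ 1 := by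
    intro i
    induction i with
    | zero => simp
    | succ i ih =>
      have hg' : φ X * ψ X = φ 1 * ψ 1 := by
        rw [← hg, hc, mul_assoc, ← mul_assoc (ψ 1), ← hc', mul_assoc (φ 1), h2, ← mul_assoc, h1]
      have e1 : φ (X ^ (i + 1)) = φ (X ^ i) * φ X := by rw [pow_succ, map_mul]
      have e2 : ψ (X ^ (i + 1)) = ψ X * ψ (X ^ i) := by rw [pow_succ', map_mul]
      rw [e1, e2, mul_assoc, ← mul_assoc (φ X), hg', mul_assoc, h2, ← mul_assoc, h1, ih]
  have h4 : ∀ i j : ℕ, i ≤ j → φ (X ^ i) * ψ (X ^ j) = φ 1 * ψ (X ^ (j - i)) := by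
    intro i j hij
    obtain ⟨k, rfl⟩ := Nat.exists_eq_add_of_le hij
    rw [pow_add, map_mul, ← mul_assoc, h3, mul_assoc, h2, Nat.add_sub_cancel_left]
  have h5 : φ f * ψ (X ^ f.natDegree) = φ 1 * ψ f.reverse := by
    have e1 : f = ∑ i ∈ Finset.range (f.natDegree + 1), f.coeff i • X ^ i := by
      conv_lhs => rw [f.as_sum_range_C_mul_X_pow]
      simp only [Polynomial.smul_eq_C_mul]
    have e2 : f.reverse =
        ∑ i ∈ Finset.range (f.natDegree + 1), f.coeff i • X ^ (f.natDegree - i) := by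
      ext k
      simp only [Polynomial.coeff_reverse, Polynomial.finsetSum_coeff, Polynomial.coeff_smul,
        Polynomial.coeff_X_pow, smul_eq_mul, mul_ite, mul_one, mul_zero]
      by_cases hk : k ≤ f.natDegree
      · rw [Polynomial.revAt_le hk, Finset.sum_eq_single (f.natDegree - k)]
        · rw [if_pos (by omega)]
        · intro b hb hb'
          rw [Finset.mem_range] at hb
          rw [if_neg (by omega)]
        · intro h
          rw [Finset.mem_range] at h
          omega
      · rw [Polynomial.revAt_eq_self_of_lt (by omega),
          Polynomial.coeff_eq_zero_of_natDegree_lt (by omega)]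
        refine (Finset.sum_eq_zero fun i _ => if_neg (by omega)).symm
    rw [e2]
    conv_lhs => rw [e1]
    simp only [map_sum, map_smul, Finset.sum_mul, Finset.mul_sum, smul_mul_assoc, mul_smul_comm]
    refine Finset.sum_congr rfl fun i hi => ?_
    rw [Finset.mem_range] at hi
    have hd : (∑ i ∈ Finset.range (f.natDegree + 1), f.coeff i • (X : ℂ[X]) ^ i).natDegree
        = f.natDegree := by rw [← e1]
    rw [hd, h4 _ _ (by omega)]
  rw [← h5, hf, zero_mul]

lemma res₀_eq_reverse (f : ℂ[X]) :
    res₀ f = LaurentPolynomial.T (f.natDegree : ℤ) * resInf f.reverse := by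
  have h : resInf f.reverse = LaurentPolynomial.invert (Polynomial.toLaurent f.reverse) := rfl
  have h' : res₀ f = Polynomial.toLaurent f := rfl
  rw [h, h', LaurentPolynomial.toLaurent_reverse, map_mul, LaurentPolynomial.invert_T,
    mul_left_comm, ← LaurentPolynomial.T_add, add_neg_cancel, LaurentPolynomial.T_zero, mul_one]
  ext
  simp

lemma resInf_eq_reverse (f : ℂ[X]) :
    resInf f = LaurentPolynomial.T (-(f.natDegree : ℤ)) * res₀ f.reverse := by
  have h : resInf f = LaurentPolynomial.invert (Polynomial.toLaurent f) := rfl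
  have h' : res₀ f.reverse = Polynomial.toLaurent f.reverse := rfl
  rw [h, h', LaurentPolynomial.toLaurent_reverse, mul_left_comm, ← LaurentPolynomial.T_add,
    neg_add_cancel, LaurentPolynomial.T_zero, mul_one]

/-- The image subscheme of a morphism `Space M_n(ℂ) → ℙ¹`, given on the two charts by the kernels
of `φ₀` and of `φ_∞`. -/
def Mor.image {n : ℕ} (φ : Mor n) : ClosedSubscheme where
  I₀ := kerIdeal φ.φ₀
  IInf := kerIdeal φ.φInf
  glue := by
    apply le_antisymm
    · rw [Ideal.map_le_iff_le_comap]
      intro f hf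
      obtain ⟨k, hk⟩ := (φ.pushoutInf _).1 (gluing_aux φ.φ₀ φ.φInf φ.commInf φ.comm₀ φ.glue hf)
      rw [Ideal.mem_comap, res₀_eq_reverse]
      refine Ideal.mul_mem_left _ _ ?_
      have h := Ideal.mem_map_of_mem resInf
        (show X ^ k * f.reverse ∈ kerIdeal φ.φInf from hk)
      rw [map_mul, resInf_X_pow] at h
      exact (Ideal.unit_mul_mem_iff_mem _ (LaurentPolynomial.isUnit_T _)).1 h
    · rw [Ideal.map_le_iff_le_comap]
      intro f hf
      have hg : (φ.φ₀ 1 * φ.φInf X) * (φ.φInf 1 * φ.φ₀ X) = φ.φInf 1 * φ.φ₀ 1 := by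
        rw [φ.glue', φ.comm₀]
      obtain ⟨k, hk⟩ := (φ.pushout₀ _).1 (gluing_aux φ.φInf φ.φ₀ φ.comm₀ φ.commInf hg hf)
      rw [Ideal.mem_comap, resInf_eq_reverse]
      refine Ideal.mul_mem_left _ _ ?_
      have h := Ideal.mem_map_of_mem res₀
        (show X ^ k * f.reverse ∈ kerIdeal φ.φ₀ from hk)
      rw [map_mul, res₀_X_pow] at h
      exact (Ideal.unit_mul_mem_iff_mem _ (LaurentPolynomial.isUnit_T _)).1 h

lemma kerIdeal_eq_of_conj {n : ℕ} {φ ψ : RingSetHom n} (g : (Mat n)ˣ)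
    (h : ∀ f, ψ f = g * φ f * (g⁻¹ : (Mat n)ˣ)) : kerIdeal φ = kerIdeal ψ := by
  ext f
  change φ f = 0 ↔ ψ f = 0
  rw [h, Units.mul_left_eq_zero, Units.mul_right_eq_zero]

/-- The image subscheme of a point of `Map((Space M_n(ℂ); ℂⁿ), ℙ¹)`. -/
def MapSpace.image {n : ℕ} : MapSpace n → ClosedSubscheme :=
  Quotient.lift Mor.image (by
    rintro φ ψ ⟨g, h⟩
    exact ClosedSubscheme.ext (kerIdeal_eq_of_conj g fun f => (h f).1)
      (kerIdeal_eq_of_conj g fun f => (h f).2))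

/-- The summand `V_p ⊆ ℂⁿ` of the Chan-Paton space at the point `p` of `ℙ¹`: the sections
supported at `p` of the Chan-Paton module, which is `e₀ ℂⁿ` as a `ℂ[y₀]`-module on `U₀` and
`e_∞ ℂⁿ` as a `ℂ[y_∞]`-module on `U_∞`. -/
def Mor.chanPaton {n : ℕ} (φ : Mor n) (p : P1) : Submodule ℂ (Fin n → ℂ) :=
  p.elim
    (LinearMap.range (Matrix.toLin' (φ.φInf 1)) ⊓
      Module.End.maxGenEigenspace (Matrix.toLin' (φ.φInf X)) 0)
    (fun a => LinearMap.range (Matrix.toLin' (φ.φ₀ 1)) ⊓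
      Module.End.maxGenEigenspace (Matrix.toLin' (φ.φ₀ X)) a)

/-- The set of points of `ℙ¹` on which the D0-branes of `φ` sit. -/
def Mor.supp {n : ℕ} (φ : Mor n) : Set P1 := {p | φ.chanPaton p ≠ ⊥}

/-- The gauge symmetry of a D0-brane: the centralizer in `M_n(ℂ)` of the image algebra
`⟨e₀, m₀⟩ + ⟨e_∞, m_∞⟩`. -/
def Mor.gauge {n : ℕ} (φ : Mor n) : Subalgebra ℂ (Mat n) :=
  Subalgebra.centralizer ℂ (Set.range φ.φ₀ ∪ Set.range φ.φInf)

/-- The D0-branes of `φ` are stacks of `ν i` branes at the points `P i`: for each point `p`, the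
Chan-Paton space at `p` has dimension `∑_{P i = p} ν i`. -/
def Mor.IsStacked {n k : ℕ} (φ : Mor n) (ν : Fin k → ℕ) (P : Fin k → P1) : Prop :=
  ∀ p, Module.finrank ℂ (φ.chanPaton p) = ∑ᶠ (i : Fin k) (_ : P i = p), ν i

/-- The value at a point of `ℙ¹` of a function on `U₀`, extended by `0` outside `U₀`. -/
def eval₀ (f : ℂ[X]) (p : P1) : ℂ := p.elim 0 (fun a => f.eval a)

open Classical in
/-- The value at a point of `ℙ¹` of a function on `U_∞`, extended by `0` outside `U_∞`. -/
def evalInf (f : ℂ[X]) (p : P1) : ℂ :=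
  p.elim (f.eval 0) (fun a => if a = 0 then 0 else f.eval a⁻¹)

end

end D0

open D0

/-!
A morphism to `ℙ¹` has finite support, so it misses all but finitely many points `c` of `U₀`. It
then factors through the affine line `ℙ¹ ∖ {c}`, with coordinate `1 / (y₀ - c)`, and is the same as one
matrix `R`, the action of this coordinate on `ℂⁿ` (`affineMor`, `exists_eq_affineMor`). The charts
are recovered from `R` as `y₀ = (1 + c R) / R` and `y_∞ = R / (1 + c R)`, on the parts of `ℂⁿ` where the
denominator is invertible; Drazin inverses make sense of the fractions. In these terms the statement
is linear algebra: the image is the zero scheme of the homogenized minimal polynomial of `R`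
(`image_affineMor`), the Chan-Paton spaces are the generalized eigenspaces (`chanPaton_affineMor`),
and the cycle of the morphism consists of the roots of the characteristic polynomial (`morCycle`).

Two facts control the topology. The morphism depends continuously on `R` (`continuous_affineMor`):
where the denominator of a chart degenerates, the small eigenvalues of the denominator become
characteristic values of the chart near `∞`, as the topology on ring-set-homomorphisms allows, and
the spectral idempotents deform with the matrix (`eventually_exists_idempotent`). The cycle depends
continuously on the morphism (`continuous_mapCycle`): `Sⁿ(ℙ¹)` is embedded in the projective space
of binary forms of degree `n` (`isEmbedding_lineProj_cycleForm`), and the form of a morphism is read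
off from the characteristic polynomial of the chart at `U₀`.

A morphism whose image has length `n` has a cyclic affine coordinate, so it is determined up to
conjugation by its image (`mk_eq_of_image_eq`), and companion matrices give a morphism with given
image, continuously. The subscheme with the cycle of the morphism is a continuous left inverse. The
Chow variety is embedded by diagonal morphisms, with the cycle as left inverse. Its image is the
reduced locus, as a reduced image means a squarefree minimal polynomial, hence a diagonalizable
matrix (`exists_isDiagIn_of_reduced`). For a diagonalizable morphism the gauge algebra consists of
block matrices, and families of morphisms are obtained by moving the diagonal entries, in generic
directions of an affine line so that stacks do not meet (`exists_ne_real_mul`).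
-/

/-! ### Drazin inverses -/

/-- `d` is the Drazin inverse of `a`: it commutes with `a`, inverts it on the part where `a` is
invertible, and vanishes on the part where `a` is nilpotent. The idempotent `a * d` is the
projection to the former part. -/
structure IsDrazin {M : Type*} [Ring M] (a d : M) : Prop where
  comm : Commute a d
  mul_mul : a * d * d = d
  pow : ∃ k : ℕ, a ^ (k + 1) * d = a ^ k

namespace IsDrazin

variable {M : Type*} [Ring M] {a d d' : M}

lemma pow_of_le (h : IsDrazin a d) : ∃ k : ℕ, ∀ l, k ≤ l → a ^ (l + 1) * d = a ^ l := by
  obtain ⟨k, hk⟩ := h.pow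
  refine ⟨k, fun l hl => ?_⟩
  obtain ⟨j, rfl⟩ := Nat.exists_eq_add_of_le' hl
  rw [add_assoc, pow_add, mul_assoc, hk, pow_add]

lemma idem (h : IsDrazin a d) : (a * d) * (a * d) = a * d := by
  rw [mul_assoc, ← mul_assoc d, ← h.comm.eq, h.mul_mul]

lemma mul_eq_pow (h : IsDrazin a d) (k : ℕ) : a * d = a ^ (k + 1) * d ^ (k + 1) := by
  induction k with
  | zero => simp
  | succ k ih =>
    rw [pow_succ' a, pow_succ d, mul_assoc, ← mul_assoc _ (d ^ (k + 1)), ← ih,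
      h.mul_mul]

lemma eq_of_commute (h : IsDrazin a d) (h' : IsDrazin a d') (hc : Commute d d') : d = d' := by
  have key : ∀ {x y : M}, IsDrazin a x → IsDrazin a y → Commute x y →
      (a * x) * (a * y) = a * x := by
    intro x y hx hy hxy
    obtain ⟨k, hk⟩ := hy.pow_of_le
    have hay : Commute x (a * y) := hx.comm.symm.mul_right hxy
    rw [hx.mul_eq_pow k, mul_assoc, (hay.pow_left (k + 1)).eq, ← mul_assoc, ← mul_assoc,
      ← pow_succ, hk _ (Nat.le_succ k)]
  have e : a * d = a * d' := by
    have : Commute (a * d) (a * d') :=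
      ((Commute.refl a).mul_right h'.comm).mul_left (h.comm.symm.mul_right hc)
    exact (key h h' hc).symm.trans (this.eq.trans (key h' h hc.symm))
  calc d = a * d * d := h.mul_mul.symm
    _ = a * d' * d := by rw [e]
    _ = a * d * d' := by rw [mul_assoc, ← hc.eq, ← mul_assoc]
    _ = a * d' * d' := by rw [e]
    _ = d' := h'.mul_mul

lemma map {N F : Type*} [Ring N] [FunLike F M N] [RingHomClass F M N] (φ : F)
    (h : IsDrazin a d) : IsDrazin (φ a) (φ d) where
  comm := h.comm.map φ
  mul_mul := by rw [← map_mul, ← map_mul, h.mul_mul]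
  pow := by
    obtain ⟨k, hk⟩ := h.pow
    exact ⟨k, by rw [← map_pow, ← map_mul, hk, map_pow]⟩

end IsDrazin

section FiniteDimensional

variable {M : Type*} [Ring M] [Algebra ℂ M] [FiniteDimensional ℂ M]

lemma exists_pow_mul_aeval (a : M) : ∃ (w : ℂ[X]) (k : ℕ), a ^ (k + 1) * aeval a w = a ^ k := by
  have h0 : minpoly ℂ a ≠ 0 := minpoly.ne_zero (Algebra.IsIntegral.isIntegral a)
  obtain ⟨q, hq, hr⟩ := Polynomial.exists_eq_pow_rootMultiplicity_mul_and_not_dvd _ h0 0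
  set k := (minpoly ℂ a).rootMultiplicity 0
  rw [C_0, sub_zero] at hq hr
  have hq0 : q.coeff 0 ≠ 0 := fun h => hr (X_dvd_iff.2 h)
  refine ⟨C (-(q.coeff 0)⁻¹) * q.divX, k, ?_⟩
  have h1 : aeval a (X ^ k * q) = 0 := by rw [← hq, minpoly.aeval]
  have h2 : X ^ k * q = X ^ (k + 1) * q.divX + C (q.coeff 0) * X ^ k := by
    conv_lhs => rw [← divX_mul_X_add q]
    ring
  rw [h2] at h1
  have h3 : X ^ (k + 1) * (C (-(q.coeff 0)⁻¹) * q.divX) =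
      C (-(q.coeff 0)⁻¹) * (X ^ (k + 1) * q.divX + C (q.coeff 0) * X ^ k) + X ^ k := by
    have : C (q.coeff 0)⁻¹ * C (q.coeff 0) = 1 := by rw [← C_mul, inv_mul_cancel₀ hq0, C_1]
    rw [C_neg]
    linear_combination (X ^ k) * this
  have h4 := congrArg (aeval a) h3
  rw [map_mul, map_add, map_mul _ (C _) (_ + _), h1, mul_zero, zero_add, map_pow, map_pow,
    aeval_X] at h4
  exact h4

/-- The Drazin inverse of an element of a finite-dimensional algebra is a polynomial in it. -/
lemma exists_isDrazin_aeval (a : M) : ∃ p : ℂ[X], IsDrazin a (aeval a p) := by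
  obtain ⟨w, k, h⟩ := exists_pow_mul_aeval a
  have hc : Commute a (aeval a w) := by
    have := Commute.all (X : ℂ[X]) w |>.map (aeval a)
    rwa [aeval_X] at this
  have hj : ∀ i j : ℕ, a ^ (k + i + j) * aeval a w ^ j = a ^ (k + i) := by
    intro i j
    induction j generalizing i with
    | zero => simp
    | succ j ih =>
      rw [pow_succ', ← mul_assoc, show k + i + (j + 1) = (i + j) + (k + 1) by ring, pow_add,
        mul_assoc (a ^ (i + j)), h, ← pow_add, show i + j + k = k + i + j by ring, ih]
  refine ⟨X ^ k * w ^ (k + 1), ?_⟩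
  have e : aeval a (X ^ k * w ^ (k + 1)) = a ^ k * aeval a w ^ (k + 1) := by simp
  rw [e]
  have hck : Commute (aeval a w ^ (k + 1)) (a ^ k) := (hc.pow_pow _ _).symm
  refine ⟨((Commute.refl a).pow_right k).mul_right (hc.pow_right _), ?_, k, ?_⟩
  · rw [← mul_assoc a, ← pow_succ', mul_assoc, ← mul_assoc (aeval a w ^ (k + 1)), hck.eq,
      mul_assoc, ← mul_assoc, ← pow_add, ← mul_assoc]
    have := hj 1 k
    rw [show k + 1 + k = k + 1 + k from rfl] at this
    have h2 := hj 0 (k + 1)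
    calc a ^ (k + 1 + k) * aeval a w ^ (k + 1) * aeval a w ^ (k + 1)
        = a ^ (k + 0 + (k + 1)) * aeval a w ^ (k + 1) * aeval a w ^ (k + 1) := by
          rw [show k + 0 + (k + 1) = k + 1 + k by ring]
      _ = _ := by rw [h2, add_zero]
  · rw [← mul_assoc, ← pow_add, show k + 1 + k = k + 0 + (k + 1) by ring, hj, add_zero]

lemma IsDrazin.eq {a d d' : M} (h : IsDrazin a d) (h' : IsDrazin a d') : d = d' := by
  obtain ⟨p, hp⟩ := exists_isDrazin_aeval a
  have key : ∀ {x : M}, IsDrazin a x → aeval a p = x := fun hx =>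
    hp.eq_of_commute hx ((Algebra.commute_of_mem_adjoin_singleton_of_commute
      (aeval_mem_adjoin_singleton ℂ a) hx.comm.symm).symm)
  rw [← key h, ← key h']

/-- The Drazin inverse in a finite-dimensional algebra. -/
noncomputable def drazin (a : M) : M := aeval a (exists_isDrazin_aeval a).choose

lemma isDrazin_drazin (a : M) : IsDrazin a (drazin a) := (exists_isDrazin_aeval a).choose_spec

lemma IsDrazin.exists_aeval {a d : M} (h : IsDrazin a d) : ∃ p : ℂ[X], d = aeval a p :=
  ⟨_, h.eq (isDrazin_drazin a)⟩

end FiniteDimensional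

/-! ### Morphisms from fractions in a commutative algebra -/

section CommAlgebra

lemma mul_aeval_mul {A : Type*} [Ring A] [Algebra ℂ A] {e : A} (he : e * e = e) {x : A}
    (hc : Commute e x) (f : ℂ[X]) : e * aeval (e * x) f = e * aeval x f := by
  induction f using Polynomial.induction_on' with
  | add p q hp hq => rw [map_add, map_add, mul_add, mul_add, hp, hq]
  | monomial k c =>
    have : e * (e * x) ^ k = e * x ^ k := by
      rw [hc.mul_pow, ← mul_assoc, ← pow_succ', IsIdempotentElem.pow_succ_eq _ he]
    simp only [aeval_monomial, ← Algebra.smul_def, mul_smul_comm, this]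

/-- The chart `f ↦ e * f(x)` of a morphism, for an idempotent `e` of a commutative algebra that is
embedded in `M_n(ℂ)`. -/
noncomputable def chartHom {n : ℕ} {A : Type*} [CommRing A] [Algebra ℂ A] (ι : A →ₐ[ℂ] Mat n)
    (e x : A) (he : e * e = e) : RingSetHom n :=
  show ℂ[X] →ₙₐ[ℂ] Mat n from
  { toFun := fun f => ι (e * aeval x f)
    map_smul' := fun c f => by simp
    map_zero' := by simp
    map_add' := fun f g => by rw [map_add, mul_add, map_add]
    map_mul' := fun f g => by
      rw [← map_mul, map_mul (aeval x)]
      congr 1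
      linear_combination (-(aeval x f * aeval x g)) * he }

lemma chartHom_apply {n : ℕ} {A : Type*} [CommRing A] [Algebra ℂ A] (ι : A →ₐ[ℂ] Mat n)
    (e x : A) (he : e * e = e) (f : ℂ[X]) : chartHom ι e x he f = ι (e * aeval x f) := rfl

/-- Data for a morphism to `ℙ¹` in a commutative algebra: the coordinates `m₀ = y₀`, `m₁ = y_∞`, on
the parts `e₀`, `e₁` where they are defined. -/
structure ChartData (A : Type*) [CommRing A] (e₀ m₀ e₁ m₁ : A) : Prop where
  idem₀ : e₀ * e₀ = e₀
  idem₁ : e₁ * e₁ = e₁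
  mul₀ : e₀ * m₀ = m₀
  mul₁ : e₁ * m₁ = m₁
  cover : (1 - e₀) * (1 - e₁) = 0
  inv : m₀ * m₁ = e₀ * e₁
  nil₀ : ∃ k, m₀ ^ k * (1 - e₁) = 0
  nil₁ : ∃ k, m₁ ^ k * (1 - e₀) = 0

namespace ChartData

variable {A : Type*} [CommRing A] {e₀ m₀ e₁ m₁ : A}

lemma symm (h : ChartData A e₀ m₀ e₁ m₁) : ChartData A e₁ m₁ e₀ m₀ where
  idem₀ := h.idem₁
  idem₁ := h.idem₀
  mul₀ := h.mul₁
  mul₁ := h.mul₀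
  cover := by rw [mul_comm, h.cover]
  inv := by rw [mul_comm, h.inv, mul_comm]
  nil₀ := h.nil₁
  nil₁ := h.nil₀

lemma isDrazin (h : ChartData A e₀ m₀ e₁ m₁) : IsDrazin m₀ (e₀ * m₁) where
  comm := Commute.all _ _
  mul_mul := by
    linear_combination (m₁ * e₀ * e₀) * h.inv + (e₀ * e₀ * e₀) * h.mul₁
      + (m₁ * (e₀ + 1)) * h.idem₀
  pow := by
    obtain ⟨k, hk⟩ := h.nil₀
    refine ⟨k + 1, ?_⟩
    linear_combination (m₀ ^ (k + 1) * e₀) * h.inv + (m₀ ^ k * m₀ * e₁) * h.idem₀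
      + (m₀ ^ k * e₁) * h.mul₀ - m₀ * hk

lemma range_le [Algebra ℂ A] [FiniteDimensional ℂ A] (h : ChartData A e₀ m₀ e₁ m₁) (f : ℂ[X]) :
    ∃ g : ℂ[X], e₁ * (e₀ * aeval m₀ f) = e₀ * (e₁ * aeval m₁ g) := by
  obtain ⟨p, hp⟩ := h.symm.isDrazin.exists_aeval
  refine ⟨f.comp p, ?_⟩
  rw [aeval_comp, ← hp, mul_aeval_mul h.idem₁ (Commute.all _ _)]
  ring

lemma mem_range [Algebra ℂ A] [FiniteDimensional ℂ A] (h : ChartData A e₀ m₀ e₁ m₁) :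
    ∃ g : ℂ[X], e₀ * aeval m₀ g = e₀ * e₁ := by
  obtain ⟨p, hp⟩ := h.isDrazin.exists_aeval
  refine ⟨X * p, ?_⟩
  rw [map_mul, aeval_X, ← hp]
  linear_combination (e₀ * e₀) * h.inv + (e₁ * (e₀ + 1)) * h.idem₀

lemma pushout [Algebra ℂ A] (h : ChartData A e₀ m₀ e₁ m₁) (f : ℂ[X]) :
    e₁ * (e₀ * aeval m₀ f) = 0 ↔ ∃ k : ℕ, e₀ * aeval m₀ (X ^ k * f) = 0 := by
  constructor
  · intro hf
    obtain ⟨k, hk⟩ := h.nil₀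
    refine ⟨k, ?_⟩
    rw [map_mul, map_pow, aeval_X]
    linear_combination (e₀ * aeval m₀ f) * hk + m₀ ^ k * hf
  · rintro ⟨k, hk⟩
    rw [map_mul, map_pow, aeval_X] at hk
    have h1 : (e₀ * e₁) * (e₀ * e₁) = e₀ * e₁ := by
      linear_combination (e₁ * e₁) * h.idem₀ + e₀ * h.idem₁
    have h2 : (e₀ * e₁) * (m₀ * m₁) ^ k = e₀ * e₁ := by
      rw [h.inv, ← pow_succ', IsIdempotentElem.pow_succ_eq _ h1]
    rw [mul_pow] at h2
    linear_combination (-aeval m₀ f) * h2 + (m₁ ^ k * e₁) * hk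

end ChartData

/-- The morphism given by chart data in a commutative algebra embedded in `M_n(ℂ)`. -/
noncomputable def ChartData.toMor {n : ℕ} {A : Type*} [CommRing A] [Algebra ℂ A]
    [FiniteDimensional ℂ A] (ι : A →ₐ[ℂ] Mat n) (hι : Function.Injective ι) {e₀ m₀ e₁ m₁ : A}
    (h : ChartData A e₀ m₀ e₁ m₁) : Mor n where
  φ₀ := chartHom ι e₀ m₀ h.idem₀
  φInf := chartHom ι e₁ m₁ h.idem₁
  comm₀ f := by simp only [chartHom_apply, ← map_mul, mul_comm]
  commInf f := by simp only [chartHom_apply, ← map_mul, mul_comm]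
  cover := by
    simp only [chartHom_apply, ← map_mul, ← map_add, ← map_sub, map_one, mul_one]
    rw [← map_one ι]
    congr 1
    linear_combination h.cover
  overlap := by
    apply Set.Subset.antisymm
    · rintro _ ⟨f, rfl⟩
      obtain ⟨g, hg⟩ := h.range_le f
      exact ⟨g, by simp only [chartHom_apply, ← map_mul, map_one, mul_one, hg]⟩
    · rintro _ ⟨f, rfl⟩
      obtain ⟨g, hg⟩ := h.symm.range_le f
      exact ⟨g, by simp only [chartHom_apply, ← map_mul, map_one, mul_one, hg]⟩
  overlap_mem₀ := by
    obtain ⟨g, hg⟩ := h.mem_range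
    exact ⟨g, by simp only [chartHom_apply, ← map_mul, map_one, mul_one, hg]⟩
  overlap_memInf := by
    obtain ⟨g, hg⟩ := h.symm.mem_range
    exact ⟨g, by simp only [chartHom_apply, ← map_mul, map_one, mul_one, hg, mul_comm]⟩
  glue := by
    simp only [chartHom_apply, ← map_mul, map_one, mul_one, aeval_X]
    congr 1
    linear_combination (e₁ * e₁ * e₀ * e₀) * h.inv + (e₁ ^ 3 * (e₀ + 1)) * h.idem₀ +
      (e₀ * (e₁ + 1)) * h.idem₁
  glue' := by
    simp only [chartHom_apply, ← map_mul, map_one, mul_one, aeval_X]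
    congr 1
    linear_combination (e₁ * e₁ * e₀ * e₀) * h.inv + (e₁ ^ 3 * (e₀ + 1)) * h.idem₀ +
      (e₀ * (e₁ + 1)) * h.idem₁
  pushout₀ f := by
    simp only [chartHom_apply, ← map_mul, map_one, mul_one, map_eq_zero_iff ι hι, h.pushout f]
  pushoutInf f := by
    simp only [chartHom_apply, ← map_mul, map_one, mul_one, map_eq_zero_iff ι hι, h.symm.pushout f]

lemma chartData_of_isDrazin {A : Type*} [CommRing A] {a b d d' : A} (hab : IsCoprime a b)
    (hd : IsDrazin b d) (hd' : IsDrazin a d') :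
    ChartData A (b * d) (a * d) (a * d') (b * d') := by
  have nil : ∀ {x y z : A}, IsDrazin y z → ∃ k, (y * x) ^ k * (1 - y * z) = 0 := by
    intro x y z h
    obtain ⟨k, hk⟩ := h.pow
    refine ⟨k, ?_⟩
    rw [mul_pow]
    linear_combination (-x ^ k) * hk
  refine ⟨hd.idem, hd'.idem, ?_, ?_, ?_, by ring, nil hd', nil hd⟩
  · linear_combination a * hd.mul_mul
  · linear_combination b * hd'.mul_mul
  · obtain ⟨k, hk⟩ := hd.pow
    obtain ⟨l, hl⟩ := hd'.pow
    obtain ⟨u, v, huv⟩ := hab.pow (m := l) (n := k)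
    linear_combination (-(1 - b * d) * (1 - a * d')) * huv
      - (v * (1 - a * d')) * hk - (u * (1 - b * d)) * hl

end CommAlgebra

/-! ### The morphism with a given affine coordinate -/

section AffineMor

open scoped IsMulCommutative

variable {n : ℕ}

lemma isCoprime_affine {A : Type*} [CommRing A] [Algebra ℂ A] (c : ℂ) (r : A) :
    IsCoprime (1 + c • r) r :=
  ⟨1, -algebraMap ℂ A c, by rw [Algebra.smul_def]; ring⟩

/-- The morphism `Space M_n(ℂ) → ℙ¹` with support away from the point `c` of `U₀`, on which the
coordinate `1 / (y₀ - c)` of `ℙ¹ ∖ {c}` acts as the matrix `R`. So `y₀` acts as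
`(1 + c R) / R`, and `y_∞` as `R / (1 + c R)`, on the parts of `ℂⁿ` where these make sense. -/
noncomputable def affineMor (c : ℂ) (R : Mat n) : Mor n :=
  let r : Algebra.adjoin ℂ {R} := ⟨R, Algebra.self_mem_adjoin_singleton ℂ R⟩
  (chartData_of_isDrazin (isCoprime_affine c r) (isDrazin_drazin r)
    (isDrazin_drazin (1 + c • r))).toMor (Subalgebra.val _) Subtype.val_injective

lemma affineMor_apply₀ {c : ℂ} {R D : Mat n} (hD : IsDrazin R D) (f : ℂ[X]) :
    (affineMor c R).φ₀ f = R * D * aeval ((1 + c • R) * D) f := by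
  set r : Algebra.adjoin ℂ {R} := ⟨R, Algebra.self_mem_adjoin_singleton ℂ R⟩
  have h : (Subalgebra.val _ (drazin r) : Mat n) = D :=
    ((isDrazin_drazin r).map (Subalgebra.val (Algebra.adjoin ℂ {R}))).eq hD
  change Subalgebra.val _ (r * drazin r * aeval ((1 + c • r) * drazin r) f) = _
  rw [map_mul, map_mul, ← Polynomial.aeval_algHom_apply, map_mul, h]
  rfl

lemma affineMor_applyInf {c : ℂ} {R D : Mat n} (hD : IsDrazin (1 + c • R) D) (f : ℂ[X]) :
    (affineMor c R).φInf f = (1 + c • R) * D * aeval (R * D) f := by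
  set r : Algebra.adjoin ℂ {R} := ⟨R, Algebra.self_mem_adjoin_singleton ℂ R⟩
  have h : (Subalgebra.val _ (drazin (1 + c • r)) : Mat n) = D :=
    ((isDrazin_drazin (1 + c • r)).map (Subalgebra.val (Algebra.adjoin ℂ {R}))).eq hD
  change Subalgebra.val _ ((1 + c • r) * drazin (1 + c • r) *
    aeval (r * drazin (1 + c • r)) f) = _
  rw [map_mul, map_mul, ← Polynomial.aeval_algHom_apply, map_mul, h]
  rfl

lemma mor_ext {φ ψ : Mor n} (h₀ : ∀ f, φ.φ₀ f = ψ.φ₀ f) (h₁ : ∀ f, φ.φInf f = ψ.φInf f) :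
    φ = ψ := by
  have e₀ : φ.φ₀ = ψ.φ₀ := DFunLike.ext _ _ h₀
  have e₁ : φ.φInf = ψ.φInf := DFunLike.ext _ _ h₁
  cases φ
  cases ψ
  cases e₀
  cases e₁
  rfl

end AffineMor

/-! ### Every morphism has an affine coordinate -/

section ExistsAffine

lemma isUnit_sub_of_not_isRoot {A : Type*} [CommRing A] [Algebra ℂ A] {x : A} {p : ℂ[X]}
    (hp : aeval x p = 0) {c : ℂ} (hc : ¬ p.IsRoot c) : IsUnit (x - algebraMap ℂ A c) := by
  obtain ⟨g, hg⟩ : X - C c ∣ p - C (p.eval c) := dvd_iff_isRoot.2 (by simp)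
  have h1 : (X - C c) * g = p - C (p.eval c) := hg.symm
  have h2 := congrArg (aeval x) h1
  rw [map_mul, map_sub, map_sub, hp, aeval_X, aeval_C, aeval_C, zero_sub] at h2
  have h3 : IsUnit ((x - algebraMap ℂ A c) * aeval x g) := by
    rw [h2]
    exact ((IsUnit.mk0 _ hc).map (algebraMap ℂ A)).neg
  exact isUnit_of_mul_isUnit_left h3

variable {A : Type*} [CommRing A] {e₀ m₀ e₁ m₁ : A}

/-- The affine coordinate `r = 1 / (y₀ - c)` of chart data whose support misses `c`: it is the
inverse of `m₀ - c e₀` on the part `e₀`, and `m₁ / (1 - c m₁)` on its complement. -/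
lemma ChartData.exists_affine (h : ChartData A e₀ m₀ e₁ m₁) (c : A) (hc : IsUnit (m₀ - c)) :
    ∃ r : A, IsDrazin r (m₀ - c * e₀) ∧ IsDrazin (1 + c * r) (e₁ - c * m₁) ∧
      r * (m₀ - c * e₀) = e₀ ∧ (1 + c * r) * (m₀ - c * e₀) = m₀ ∧
      (1 + c * r) * (e₁ - c * m₁) = e₁ ∧ r * (e₁ - c * m₁) = m₁ := by
  obtain ⟨w, hw⟩ := hc.exists_right_inv
  obtain ⟨k, hk⟩ := h.nil₁
  obtain ⟨l, hl⟩ := h.nil₀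
  have i₀ := h.idem₀
  have hnil : IsNilpotent (c * ((1 - e₀) * m₁)) := by
    refine ⟨k + 1, ?_⟩
    rw [pow_succ, mul_pow, mul_pow]
    linear_combination (c ^ k * (1 - e₀) ^ k * (c * (m₁ * (1 - e₀)))) * hk -
      (c ^ k * (1 - e₀) ^ k * m₁ ^ k * c * m₁) * i₀
  obtain ⟨q, hq⟩ := hnil.isUnit_one_sub.exists_right_inv
  have i₁ := h.idem₁
  have u₀ := h.mul₀
  have u₁ := h.mul₁
  have hv := h.inv
  have hcov := h.cover
  have hq' : (1 - e₀) * (q * (1 - c * m₁)) = 1 - e₀ := by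
    linear_combination (1 - e₀) * hq + q * c * m₁ * i₀
  set r : A := e₀ * w + (1 - e₀) * m₁ * q with hr
  have r₀ : e₀ * r = e₀ * w := by rw [hr]; linear_combination (w - m₁ * q) * i₀
  have r₁ : (1 - e₀) * r = (1 - e₀) * m₁ * q := by
    rw [hr]; linear_combination (-w + m₁ * q) * i₀
  have hru : r * (m₀ - c * e₀) = e₀ := by
    linear_combination e₀ * hw - r * u₀ + (m₀ - c) * r₀
  have htu : (1 + c * r) * (m₀ - c * e₀) = m₀ := by linear_combination c * hru
  have z₀ : e₀ * (e₁ - c * m₁) = (m₀ - c) * (e₀ * m₁) := by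
    linear_combination (-e₁) * i₀ - e₀ * hv
  have rz₀ : e₀ * r * (e₁ - c * m₁) = e₀ * m₁ := by
    rw [r₀]
    linear_combination w * z₀ + e₀ * m₁ * hw
  have rz₁ : (1 - e₀) * r * (e₁ - c * m₁) = (1 - e₀) * m₁ := by
    rw [r₁]
    linear_combination ((1 - e₀) * q) * u₁ + m₁ * hq'
  have hrz : r * (e₁ - c * m₁) = m₁ := by linear_combination rz₀ + rz₁
  have htz : (1 + c * r) * (e₁ - c * m₁) = e₁ := by linear_combination c * hrz
  refine ⟨r, ⟨Commute.all _ _, ?_, k, ?_⟩, ⟨Commute.all _ _, ?_, l, ?_⟩, hru, htu, htz, hrz⟩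
  · linear_combination (m₀ - c * e₀) * hru + u₀ - c * i₀
  · have hj : ∀ j : ℕ, r ^ j * (1 - e₀) = m₁ ^ j * q ^ j * (1 - e₀) := by
      intro j
      induction j with
      | zero => simp
      | succ j ih => linear_combination r * ih + m₁ ^ j * q ^ j * r₁
    linear_combination r ^ k * hru - hj k - q ^ k * hk
  · linear_combination (e₁ - c * m₁) * htz + i₁ - c * u₁
  · have ht : (1 + c * r) * (1 - e₁) = m₀ * w * (1 - e₁) := by
      linear_combination (1 + c * r - m₀ * w) * hcov + (c * (1 - e₁)) * r₀ - (e₀ * (1 - e₁)) * hw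
    have hj : ∀ j : ℕ, (1 + c * r) ^ j * (1 - e₁) = m₀ ^ j * w ^ j * (1 - e₁) := by
      intro j
      induction j with
      | zero => simp
      | succ j ih => linear_combination (1 + c * r) * ih + m₀ ^ j * w ^ j * ht
    linear_combination (1 + c * r) ^ l * htz - hj l - w ^ l * hl

end ExistsAffine

section

variable {n : ℕ}

lemma ringSetHom_apply (φ : RingSetHom n) (f : ℂ[X]) : φ f = φ 1 * aeval (φ X) f := by
  induction f using Polynomial.induction_on' with
  | add p q hp hq => rw [map_add, map_add, mul_add, hp, hq]
  | monomial k c =>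
    rw [← mul_one (monomial k c), ← C_mul_X_pow_eq_monomial, mul_one, ← smul_eq_C_mul, map_smul,
      map_smul, mul_smul_comm]
    congr 1
    rw [map_pow (aeval (φ X)), aeval_X]
    induction k with
    | zero => simp
    | succ k ih => rw [pow_succ, map_mul, ih, mul_assoc, pow_succ]

lemma one_mul_ringSetHom (φ : RingSetHom n) (f : ℂ[X]) : φ 1 * φ f = φ f := by
  rw [← map_mul, one_mul]

lemma ringSetHom_mul_one (φ : RingSetHom n) (f : ℂ[X]) : φ f * φ 1 = φ f := by
  rw [← map_mul, mul_one]

/-- The two charts of a morphism take values in a common commutative subalgebra. -/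
lemma mor_commute (φ : Mor n) (f g : ℂ[X]) : φ.φ₀ f * φ.φInf g = φ.φInf g * φ.φ₀ f := by
  obtain ⟨f', hf'⟩ : ∃ f', φ.φ₀ 1 * φ.φInf f' = φ.φInf 1 * φ.φ₀ f :=
    φ.overlap.le ⟨f, rfl⟩
  have h1 : φ.φ₀ f * φ.φInf g = (φ.φInf 1 * φ.φ₀ f) * φ.φInf g := by
    rw [φ.commInf, mul_assoc, one_mul_ringSetHom]
  have h2 : φ.φInf g * φ.φ₀ f = φ.φInf g * (φ.φInf 1 * φ.φ₀ f) := by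
    rw [← mul_assoc, ringSetHom_mul_one]
  rw [h1, h2, ← hf', mul_assoc, ← map_mul, ← mul_assoc, ← φ.comm₀, mul_assoc, ← map_mul,
    mul_comm f']

lemma exists_pow_mul_one_sub {φ ψ : RingSetHom n} (hc : ∀ f, ψ 1 * φ f = φ f * ψ 1)
    (hm : φ 1 * ψ 1 ∈ Set.range φ)
    (hp : ∀ f, ψ 1 * φ f = 0 ↔ ∃ k : ℕ, φ (X ^ k * f) = 0) :
    ∃ k, φ X ^ k * (1 - ψ 1) = 0 := by
  obtain ⟨g, hg⟩ := hm
  have i₁ : ψ 1 * ψ 1 = ψ 1 := one_mul_ringSetHom ψ 1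
  obtain ⟨k, hk⟩ := (hp (1 - g)).1 (by
    rw [map_sub, hg, mul_sub, hc, ← mul_assoc, hc, mul_assoc, i₁, sub_self])
  refine ⟨k + 1, ?_⟩
  have h1 : φ (X ^ (k + 1) * (1 - g)) = 0 := by rw [pow_succ', mul_assoc, map_mul, hk, mul_zero]
  have h2 : φ (X ^ (k + 1)) = φ X ^ (k + 1) := by
    rw [pow_succ', map_mul, ringSetHom_apply φ (X ^ k), ← mul_assoc, ringSetHom_mul_one, map_pow,
      aeval_X, ← pow_succ']
  have h3 : φ X ^ (k + 1) * φ 1 = φ X ^ (k + 1) := by rw [pow_succ, mul_assoc, ringSetHom_mul_one]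
  rw [map_mul, h2, map_sub, hg, mul_sub, ← mul_assoc, h3] at h1
  rw [mul_sub, mul_one, h1]

open scoped IsMulCommutative in
/-- A morphism is given by an affine coordinate on `ℙ¹ ∖ {c}`, for all `c` outside a finite set:
the characteristic values of `φ.φ₀ X`, which include the points of `U₀` in the support. -/
theorem exists_eq_affineMor (φ : Mor n) :
    ∃ S : Finset ℂ, ∀ c ∉ S, ∃ R : Mat n, φ = affineMor c R := by
  set s : Set (Mat n) := Set.range φ.φ₀ ∪ Set.range φ.φInf with hs
  have comm : ∀ x ∈ s, ∀ y ∈ s, x * y = y * x := by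
    have h0 : ∀ f g, φ.φ₀ f * φ.φ₀ g = φ.φ₀ g * φ.φ₀ f := fun f g => by
      rw [← map_mul, ← map_mul, mul_comm]
    have h1 : ∀ f g, φ.φInf f * φ.φInf g = φ.φInf g * φ.φInf f := fun f g => by
      rw [← map_mul, ← map_mul, mul_comm]
    have h2 := mor_commute φ
    have h3 : ∀ f g, φ.φInf f * φ.φ₀ g = φ.φ₀ g * φ.φInf f := fun f g => (h2 g f).symm
    rintro _ (⟨f, rfl⟩ | ⟨f, rfl⟩) _ (⟨g, rfl⟩ | ⟨g, rfl⟩)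
    exacts [h0 f g, h2 f g, h3 f g, h1 f g]
  have := Algebra.isMulCommutative_adjoin ℂ comm
  let A := Algebra.adjoin ℂ s
  let e₀ : A := ⟨φ.φ₀ 1, Algebra.subset_adjoin (Or.inl ⟨_, rfl⟩)⟩
  let m₀ : A := ⟨φ.φ₀ X, Algebra.subset_adjoin (Or.inl ⟨_, rfl⟩)⟩
  let e₁ : A := ⟨φ.φInf 1, Algebra.subset_adjoin (Or.inr ⟨_, rfl⟩)⟩
  let m₁ : A := ⟨φ.φInf X, Algebra.subset_adjoin (Or.inr ⟨_, rfl⟩)⟩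
  have hA : ChartData A e₀ m₀ e₁ m₁ := by
    refine ⟨?_, ?_, ?_, ?_, ?_, ?_, ?_, ?_⟩
    · exact Subtype.ext (one_mul_ringSetHom φ.φ₀ 1)
    · exact Subtype.ext (one_mul_ringSetHom φ.φInf 1)
    · exact Subtype.ext (one_mul_ringSetHom φ.φ₀ X)
    · exact Subtype.ext (one_mul_ringSetHom φ.φInf X)
    · have : (1 : A) = e₀ + e₁ - e₀ * e₁ := Subtype.ext φ.cover
      linear_combination this
    · refine Subtype.ext ?_
      change φ.φ₀ X * φ.φInf X = φ.φ₀ 1 * φ.φInf 1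
      rw [← φ.glue, φ.commInf, mul_assoc, ← mul_assoc (φ.φInf 1), ← φ.comm₀,
        mul_assoc (φ.φ₀ 1), one_mul_ringSetHom, ← mul_assoc, ringSetHom_mul_one]
    · obtain ⟨k, hk⟩ := exists_pow_mul_one_sub φ.commInf φ.overlap_mem₀ φ.pushout₀
      exact ⟨k, Subtype.ext (by simpa using hk)⟩
    · obtain ⟨k, hk⟩ := exists_pow_mul_one_sub φ.comm₀
        (by rw [← φ.comm₀]; exact φ.overlap_memInf) φ.pushoutInf
      exact ⟨k, Subtype.ext (by simpa using hk)⟩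
  have hp : minpoly ℂ m₀ ≠ 0 := minpoly.ne_zero (Algebra.IsIntegral.isIntegral m₀)
  refine ⟨(minpoly ℂ m₀).roots.toFinset, fun c hc => ?_⟩
  obtain ⟨r, h1, h2, h3, h4, h5, h6⟩ := hA.exists_affine (algebraMap ℂ A c)
    (isUnit_sub_of_not_isRoot (minpoly.aeval ℂ m₀) (by simpa [hp] using hc))
  rw [← Algebra.smul_def] at h2 h4 h5
  refine ⟨A.val r, mor_ext (fun f => ?_) fun f => ?_⟩
  · have hD := h1.map A.val
    have h3' := congrArg A.val h3
    have h4' := congrArg A.val h4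
    rw [map_mul] at h3' h4'
    rw [map_add, map_one, map_smul] at h4'
    rw [affineMor_apply₀ hD, ringSetHom_apply]
    rw [h3', h4']
    rfl
  · have hD := h2.map A.val
    rw [map_add, map_one, map_smul] at hD
    have h5' := congrArg A.val h5
    have h6' := congrArg A.val h6
    rw [map_mul] at h5' h6'
    rw [map_add, map_one, map_smul] at h5'
    rw [affineMor_applyInf hD, ringSetHom_apply]
    rw [h5', h6']
    rfl

end

/-! ### Conjugation -/

section Conj

variable {n : ℕ}

/-- Conjugation by an invertible matrix. -/
noncomputable def conjHom (g : (Mat n)ˣ) : Mat n →ₐ[ℂ] Mat n where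
  toFun x := g * x * (g⁻¹ : (Mat n)ˣ)
  map_one' := by simp
  map_mul' x y := by simp [mul_assoc]
  map_zero' := by simp
  map_add' x y := by rw [mul_add, add_mul]
  commutes' r := by
    rw [← Algebra.commutes, mul_assoc, Units.mul_inv, mul_one]

lemma conjHom_apply (g : (Mat n)ˣ) (x : Mat n) :
    conjHom g x = g * x * (g⁻¹ : (Mat n)ˣ) := rfl

lemma affineMor_conjHom₀ (g : (Mat n)ˣ) (c : ℂ) (R : Mat n) (f : ℂ[X]) :
    (affineMor c (conjHom g R)).φ₀ f = conjHom g ((affineMor c R).φ₀ f) := by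
  have h := isDrazin_drazin R
  rw [affineMor_apply₀ h, affineMor_apply₀ (h.map (conjHom g)), map_mul, map_mul,
    ← aeval_algHom_apply, map_mul, map_add, map_one, map_smul]

lemma affineMor_conjHomInf (g : (Mat n)ˣ) (c : ℂ) (R : Mat n) (f : ℂ[X]) :
    (affineMor c (conjHom g R)).φInf f = conjHom g ((affineMor c R).φInf f) := by
  have h := isDrazin_drazin (1 + c • R)
  have h' := h.map (conjHom g)
  rw [map_add, map_one, map_smul] at h'
  rw [affineMor_applyInf h, affineMor_applyInf h', map_mul, map_mul,
    ← aeval_algHom_apply, map_mul, map_add, map_one, map_smul]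

lemma mk_affineMor_conjHom (g : (Mat n)ˣ) (c : ℂ) (R : Mat n) :
    (⟦affineMor c (conjHom g R)⟧ : MapSpace n) = ⟦affineMor c R⟧ :=
  (Quotient.sound ⟨g, fun f => ⟨affineMor_conjHom₀ g c R f, affineMor_conjHomInf g c R f⟩⟩ :
    (⟦affineMor c R⟧ : MapSpace n) = ⟦affineMor c (conjHom g R)⟧).symm

lemma isDrazin_diagonal (x : Fin n → ℂ) :
    IsDrazin (Matrix.diagonal x : Mat n) (Matrix.diagonal fun i => (x i)⁻¹) where
  comm := by
    change _ * _ = _ * _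
    rw [Matrix.diagonal_mul_diagonal, Matrix.diagonal_mul_diagonal]
    simp only [mul_comm]
  mul_mul := by
    rw [Matrix.diagonal_mul_diagonal, Matrix.diagonal_mul_diagonal]
    congr 1
    funext i
    by_cases h : x i = 0 <;> simp [h]
  pow := ⟨1, by
    rw [Matrix.diagonal_pow, Matrix.diagonal_mul_diagonal, pow_one]
    congr 1
    funext i
    by_cases h : x i = 0
    · simp [h]
    · simp [pow_succ, h]⟩

lemma aeval_diagonal (x : Fin n → ℂ) (f : ℂ[X]) :
    aeval (Matrix.diagonal x : Mat n) f = Matrix.diagonal fun i => f.eval (x i) := by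
  have h := aeval_algHom_apply (Matrix.diagonalAlgHom (n := Fin n) (α := ℂ) ℂ) x f
  rw [Matrix.diagonalAlgHom_apply, Matrix.diagonalAlgHom_apply] at h
  rw [h]
  congr 1
  funext i
  have h2 := aeval_algHom_apply (Pi.evalAlgHom ℂ (fun _ : Fin n => ℂ) i) x f
  rw [Pi.evalAlgHom_apply, Pi.evalAlgHom_apply] at h2
  rw [← h2, coe_aeval_eq_eval]

end Conj

/-! ### The affine coordinate of a point -/

/-- The point of `ℙ¹ ∖ {c}` at which the coordinate `1 / (y₀ - c)` has the value `z`. -/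
noncomputable def affPoint (c z : ℂ) : P1 :=
  open Classical in if z = 0 then OnePoint.infty else ((c + z⁻¹ : ℂ) : P1)

/-- The value at a point of the coordinate `1 / (y₀ - c)` of `ℙ¹ ∖ {c}` (and `0` at `c`). -/
noncomputable def affCoord (c : ℂ) (p : P1) : ℂ := p.elim 0 fun a => (a - c)⁻¹

lemma affCoord_affPoint (c z : ℂ) : affCoord c (affPoint c z) = z := by
  unfold affPoint affCoord
  split_ifs with h
  · rw [h]; rfl
  · change (c + z⁻¹ - c)⁻¹ = z
    simp

lemma affPoint_affCoord {c : ℂ} {p : P1} (hp : p ≠ (c : P1)) :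
    affPoint c (affCoord c p) = p := by
  induction p using OnePoint.rec with
  | infty => exact if_pos rfl
  | coe a =>
    have ha : a - c ≠ 0 := sub_ne_zero.2 fun h => hp (by rw [h])
    change (if (a - c)⁻¹ = 0 then _ else _) = _
    rw [if_neg (inv_ne_zero ha)]
    change ((c + (a - c)⁻¹⁻¹ : ℂ) : P1) = _
    rw [inv_inv, add_sub_cancel]

lemma affPoint_injective (c : ℂ) : Function.Injective (affPoint c) :=
  Function.LeftInverse.injective (affCoord_affPoint c)

lemma affPoint_ne (c z : ℂ) : affPoint c z ≠ (c : P1) := by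
  unfold affPoint
  split_ifs with h
  · exact OnePoint.infty_ne_coe c
  · intro h'
    have := OnePoint.coe_injective h'
    exact inv_ne_zero h (by simpa using this)

lemma eval₀_affPoint (c z : ℂ) (f : ℂ[X]) :
    eval₀ f (affPoint c z) = z * z⁻¹ * f.eval ((1 + c * z) * z⁻¹) := by
  unfold affPoint
  split_ifs with h
  · rw [h]; simp; rfl
  · change f.eval (c + z⁻¹) = _
    rw [mul_inv_cancel₀ h, one_mul]
    congr 1
    field_simp
    ring

lemma evalInf_affPoint (c z : ℂ) (f : ℂ[X]) :
    evalInf f (affPoint c z) =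
      (1 + c * z) * (1 + c * z)⁻¹ * f.eval (z * (1 + c * z)⁻¹) := by
  unfold affPoint
  split_ifs with h
  · rw [h]; simp; rfl
  · change (if c + z⁻¹ = 0 then 0 else f.eval (c + z⁻¹)⁻¹) = _
    have h1 : c + z⁻¹ = (1 + c * z) * z⁻¹ := by field_simp; ring
    split_ifs with h2
    · have : 1 + c * z = 0 := by simpa [h1, h] using h2
      simp [this]
    · have : 1 + c * z ≠ 0 := fun h3 => h2 (by rw [h1, h3, zero_mul])
      rw [mul_inv_cancel₀ this, one_mul, h1, mul_inv, inv_inv, mul_comm]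

lemma affineMor_diagonal₀ {n : ℕ} (c : ℂ) (x : Fin n → ℂ) (f : ℂ[X]) :
    (affineMor c (Matrix.diagonal x)).φ₀ f =
      Matrix.diagonal fun i => eval₀ f (affPoint c (x i)) := by
  have h1 : (1 : Mat n) + c • Matrix.diagonal x = Matrix.diagonal fun i => 1 + c * x i := by
    rw [← Matrix.diagonal_one, ← Matrix.diagonal_smul, Matrix.diagonal_add]
    rfl
  rw [affineMor_apply₀ (isDrazin_diagonal x), h1, Matrix.diagonal_mul_diagonal,
    Matrix.diagonal_mul_diagonal, aeval_diagonal, Matrix.diagonal_mul_diagonal]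
  simp only [eval₀_affPoint]

lemma affineMor_diagonalInf {n : ℕ} (c : ℂ) (x : Fin n → ℂ) (f : ℂ[X]) :
    (affineMor c (Matrix.diagonal x)).φInf f =
      Matrix.diagonal fun i => evalInf f (affPoint c (x i)) := by
  have h1 : (1 : Mat n) + c • Matrix.diagonal x = Matrix.diagonal fun i => 1 + c * x i := by
    rw [← Matrix.diagonal_one, ← Matrix.diagonal_smul, Matrix.diagonal_add]
    rfl
  rw [affineMor_applyInf (by rw [h1]; exact isDrazin_diagonal _), h1,
    Matrix.diagonal_mul_diagonal, Matrix.diagonal_mul_diagonal, aeval_diagonal,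
    Matrix.diagonal_mul_diagonal]
  simp only [evalInf_affPoint]

/-! ### Chan-Paton spaces as generalized eigenspaces -/

section ChanPaton

variable {n : ℕ}

lemma mem_maxGenEigenspace_toLin' (a : Mat n) (s : ℂ) (v : Fin n → ℂ) :
    v ∈ Module.End.maxGenEigenspace (Matrix.toLin' a) s ↔
      ∃ k : ℕ, ((a - algebraMap ℂ (Mat n) s) ^ k).mulVec v = 0 := by
  rw [Module.End.mem_maxGenEigenspace]
  refine exists_congr fun k => ?_
  have : Matrix.toLin' a - s • (1 : Module.End ℂ (Fin n → ℂ)) =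
      Matrix.toLin' (a - algebraMap ℂ (Mat n) s) := by
    rw [map_sub, Algebra.algebraMap_eq_smul_one, map_smul, Matrix.toLin'_one]
    rfl
  rw [this, ← Matrix.toLin'_pow, Matrix.toLin'_apply]

lemma mem_range_toLin'_of_idem {e : Mat n} (he : e * e = e) (v : Fin n → ℂ) :
    v ∈ LinearMap.range (Matrix.toLin' e) ↔ e.mulVec v = v := by
  constructor
  · rintro ⟨w, rfl⟩
    rw [Matrix.toLin'_apply, Matrix.mulVec_mulVec, he]
  · exact fun h => ⟨v, h⟩

/-- On a chart with coordinate `a / b`, the sections supported at the point `a / b = s` are the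
generalized kernel of `a - s b`. -/
lemma range_inf_maxGenEigenspace {A : Type*} [CommRing A] [Algebra ℂ A] (ι : A →ₐ[ℂ] Mat n)
    {a b d : A} (hab : IsCoprime a b) (hd : IsDrazin b d) (s : ℂ) :
    LinearMap.range (Matrix.toLin' (ι (b * d))) ⊓
      Module.End.maxGenEigenspace (Matrix.toLin' (ι (a * d))) s =
    Module.End.maxGenEigenspace (Matrix.toLin' (ι (a - algebraMap ℂ A s * b))) 0 := by
  have he : ι (b * d) * ι (b * d) = ι (b * d) := by rw [← map_mul, hd.idem]
  have hpow : ∀ k : ℕ, (a * d - algebraMap ℂ A s) ^ k * (b * d) =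
      d ^ k * (a - algebraMap ℂ A s * b) ^ k * (b * d) := by
    intro k
    induction k with
    | zero => simp
    | succ k ih =>
      linear_combination (a * d - algebraMap ℂ A s) * ih +
        (d ^ k * (a - algebraMap ℂ A s * b) ^ k * algebraMap ℂ A s * b) * hd.mul_mul
  have hbd : ∀ k : ℕ, b ^ k * d ^ k * (b * d) = b * d := fun k => by
    rw [← mul_pow, ← pow_succ, IsIdempotentElem.pow_succ_eq _ hd.idem]
  ext v
  rw [Submodule.mem_inf, mem_range_toLin'_of_idem he, mem_maxGenEigenspace_toLin',
    mem_maxGenEigenspace_toLin']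
  simp only [← AlgHom.commutes ι, ← map_sub, ← map_pow, map_zero, sub_zero]
  constructor
  · rintro ⟨hv, k, hk⟩
    refine ⟨k, ?_⟩
    have h1 : (a - algebraMap ℂ A s * b) ^ k * (b * d) =
        b ^ k * (b * d) * (a * d - algebraMap ℂ A s) ^ k := by
      linear_combination (-b ^ k) * hpow k - (a - algebraMap ℂ A s * b) ^ k * hbd k
    rw [← hv, Matrix.mulVec_mulVec, ← map_mul, h1, map_mul, ← Matrix.mulVec_mulVec, hk,
      Matrix.mulVec_zero]
  · rintro ⟨k, hk⟩
    obtain ⟨j, hj⟩ := hd.pow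
    have hv : (ι (b * d)).mulVec v = v := by
      have hc : IsCoprime (a - algebraMap ℂ A s * b) b := by
        obtain ⟨u, w, h⟩ := hab
        exact ⟨u, w + u * algebraMap ℂ A s, by linear_combination h⟩
      obtain ⟨u, w, h⟩ := hc.pow (m := k) (n := j)
      have h1 : (1 : A) = b * d + (1 - b * d) * u * (a - algebraMap ℂ A s * b) ^ k := by
        linear_combination (-(1 - b * d)) * h - w * hj
      conv_rhs => rw [← Matrix.one_mulVec v, ← map_one ι, h1, map_add, map_mul ι (_ * _),
        Matrix.add_mulVec, ← Matrix.mulVec_mulVec, hk, Matrix.mulVec_zero, add_zero]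
    refine ⟨hv, k, ?_⟩
    rw [← hv, Matrix.mulVec_mulVec, ← map_mul, hpow, mul_right_comm, map_mul,
      ← Matrix.mulVec_mulVec, hk, Matrix.mulVec_zero]

open scoped IsMulCommutative in
lemma chanPaton_affineMor_coe (c : ℂ) (R : Mat n) (a : ℂ) :
    (affineMor c R).chanPaton (a : P1) =
      Module.End.maxGenEigenspace (Matrix.toLin' (1 + (c - a) • R)) 0 := by
  set r : Algebra.adjoin ℂ {R} := ⟨R, Algebra.self_mem_adjoin_singleton ℂ R⟩
  have h := range_inf_maxGenEigenspace (Algebra.adjoin ℂ {R}).val (isCoprime_affine c r)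
    (isDrazin_drazin r) a
  have h1 : 1 + c • r - algebraMap ℂ _ a * r = 1 + (c - a) • r := by
    rw [← Algebra.smul_def, sub_smul]; ring
  have h2 : (affineMor c R).φ₀ 1 = (Algebra.adjoin ℂ {R}).val (r * drazin r) := by
    change Subalgebra.val _ (_ * aeval _ 1) = _
    rw [map_one, mul_one]
  have h3 : (affineMor c R).φ₀ X = (Algebra.adjoin ℂ {R}).val ((1 + c • r) * drazin r) := by
    change Subalgebra.val _ (_ * aeval _ X) = _
    rw [aeval_X]
    congr 1
    linear_combination (1 + c • r) * (isDrazin_drazin r).mul_mul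
  rw [h1, ← h2, ← h3] at h
  exact h

open scoped IsMulCommutative in
lemma chanPaton_affineMor_infty (c : ℂ) (R : Mat n) :
    (affineMor c R).chanPaton OnePoint.infty =
      Module.End.maxGenEigenspace (Matrix.toLin' R) 0 := by
  set r : Algebra.adjoin ℂ {R} := ⟨R, Algebra.self_mem_adjoin_singleton ℂ R⟩
  have h := range_inf_maxGenEigenspace (Algebra.adjoin ℂ {R}).val (isCoprime_affine c r).symm
    (isDrazin_drazin (1 + c • r)) 0
  have h2 : (affineMor c R).φInf 1 =
      (Algebra.adjoin ℂ {R}).val ((1 + c • r) * drazin (1 + c • r)) := by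
    change Subalgebra.val _ (_ * aeval _ 1) = _
    rw [map_one, mul_one]
  have h3 : (affineMor c R).φInf X = (Algebra.adjoin ℂ {R}).val (r * drazin (1 + c • r)) := by
    change Subalgebra.val _ (_ * aeval _ X) = _
    rw [aeval_X]
    congr 1
    linear_combination r * (isDrazin_drazin (1 + c • r)).mul_mul
  rw [map_zero, zero_mul, sub_zero, ← h2, ← h3] at h
  exact h

lemma chanPaton_affineMor_self (c : ℂ) (R : Mat n) : (affineMor c R).chanPaton (c : P1) = ⊥ := by
  rw [chanPaton_affineMor_coe, sub_self, zero_smul, add_zero, eq_bot_iff]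
  intro v hv
  obtain ⟨k, hk⟩ := (mem_maxGenEigenspace_toLin' _ _ _).1 hv
  simpa using hk

lemma chanPaton_affineMor (c : ℂ) (R : Mat n) (z : ℂ) :
    (affineMor c R).chanPaton (affPoint c z) =
      Module.End.maxGenEigenspace (Matrix.toLin' R) z := by
  unfold affPoint
  split_ifs with h
  · rw [h, chanPaton_affineMor_infty]
  · rw [chanPaton_affineMor_coe]
    have h1 : 1 + (c - (c + z⁻¹)) • R = (-z⁻¹) • (R - algebraMap ℂ (Mat n) z) := by
      rw [smul_sub, Algebra.algebraMap_eq_smul_one, smul_smul, sub_add_cancel_left, neg_mul,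
        inv_mul_cancel₀ h, neg_one_smul]
      abel
    have h2 : ∀ k : ℕ, (-z⁻¹) ^ k ≠ 0 := fun k => pow_ne_zero _ (neg_ne_zero.2 (inv_ne_zero h))
    ext v
    simp only [mem_maxGenEigenspace_toLin', h1, map_zero, sub_zero, _root_.smul_pow,
      Matrix.smul_mulVec,
      smul_eq_zero, h2, false_or]

end ChanPaton

section ChanPatonConj

variable {n : ℕ}

lemma chanPaton_eq_of_conj {φ ψ : Mor n} (g : (Mat n)ˣ)
    (h : ∀ f, ψ.φ₀ f = conjHom g (φ.φ₀ f) ∧ ψ.φInf f = conjHom g (φ.φInf f)) (p : P1) :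
    ψ.chanPaton p = (φ.chanPaton p).map (Matrix.toLin' (g : Mat n)) := by
  have inv1 : ∀ v, ((g⁻¹ : (Mat n)ˣ) : Mat n).mulVec ((g : Mat n).mulVec v) = v := fun v => by
    rw [Matrix.mulVec_mulVec, Units.inv_mul, Matrix.one_mulVec]
  have inv2 : ∀ v, (g : Mat n).mulVec (((g⁻¹ : (Mat n)ˣ) : Mat n).mulVec v) = v := fun v => by
    rw [Matrix.mulVec_mulVec, Units.mul_inv, Matrix.one_mulVec]
  have key : ∀ (α β : RingSetHom n), (∀ f, β f = conjHom g (α f)) → ∀ s : ℂ,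
      LinearMap.range (Matrix.toLin' (β 1)) ⊓
        Module.End.maxGenEigenspace (Matrix.toLin' (β X)) s =
      (LinearMap.range (Matrix.toLin' (α 1)) ⊓
        Module.End.maxGenEigenspace (Matrix.toLin' (α X)) s).map (Matrix.toLin' (g : Mat n)) := by
    intro α β hαβ s
    have hβ : ∀ (f : ℂ[X]) (v : Fin n → ℂ),
        (β f).mulVec ((g : Mat n).mulVec v) = (g : Mat n).mulVec ((α f).mulVec v) := by
      intro f v
      rw [hαβ, conjHom_apply, Matrix.mulVec_mulVec, Matrix.mulVec_mulVec, mul_assoc,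
        Units.inv_mul, mul_one]
    have hpow : ∀ k : ℕ, (β X - algebraMap ℂ (Mat n) s) ^ k =
        conjHom g ((α X - algebraMap ℂ (Mat n) s) ^ k) := by
      intro k
      rw [map_pow, map_sub, AlgHom.commutes, hαβ]
    have hmem : ∀ v, (g : Mat n).mulVec v ∈ LinearMap.range (Matrix.toLin' (β 1)) ⊓
        Module.End.maxGenEigenspace (Matrix.toLin' (β X)) s ↔
        v ∈ LinearMap.range (Matrix.toLin' (α 1)) ⊓
        Module.End.maxGenEigenspace (Matrix.toLin' (α X)) s := by
      intro v
      rw [Submodule.mem_inf, Submodule.mem_inf,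
        mem_range_toLin'_of_idem (one_mul_ringSetHom β 1),
        mem_range_toLin'_of_idem (one_mul_ringSetHom α 1), mem_maxGenEigenspace_toLin',
        mem_maxGenEigenspace_toLin', hβ]
      refine and_congr ⟨fun h => ?_, fun h => by rw [h]⟩ (exists_congr fun k => ?_)
      · rw [← inv1 ((α 1).mulVec v), h, inv1]
      · rw [hpow, conjHom_apply, Matrix.mulVec_mulVec, mul_assoc, Units.inv_mul, mul_one,
          ← Matrix.mulVec_mulVec]
        exact ⟨fun h => by rw [← inv1 (Matrix.mulVec _ v), h, Matrix.mulVec_zero],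
          fun h => by rw [h, Matrix.mulVec_zero]⟩
    ext v
    constructor
    · intro hv
      exact ⟨((g⁻¹ : (Mat n)ˣ) : Mat n).mulVec v, (hmem _).1 (by rwa [inv2]), inv2 v⟩
    · rintro ⟨w, hw, rfl⟩
      exact (hmem w).2 hw
  induction p using OnePoint.rec with
  | infty => exact key _ _ (fun f => (h f).2) 0
  | coe a => exact key _ _ (fun f => (h f).1) a

lemma finrank_chanPaton_eq_of_conj {φ ψ : Mor n} (h : φ ≈ ψ) (p : P1) :
    Module.finrank ℂ (ψ.chanPaton p) = Module.finrank ℂ (φ.chanPaton p) := by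
  obtain ⟨g, h⟩ := h
  rw [chanPaton_eq_of_conj g h p]
  refine (Submodule.equivMapOfInjective _ ?_ _).finrank_eq.symm
  intro v w hvw
  have := congrArg (Matrix.mulVec ((g⁻¹ : (Mat n)ˣ) : Mat n)) hvw
  simpa [Matrix.toLin'_apply, Matrix.mulVec_mulVec] using this

lemma finrank_maxGenEigenspace_toLin' (R : Mat n) (z : ℂ) :
    Module.finrank ℂ (Module.End.maxGenEigenspace (Matrix.toLin' R) z) =
      R.charpoly.rootMultiplicity z := by
  rw [LinearMap.finrank_maxGenEigenspace_eq, Matrix.charpoly_toLin']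

end ChanPatonConj

/-! ### Binary forms in the affine coordinate -/

section AffineForm

/-- A polynomial `p(y₀)` of degree `≤ N`, regarded as a binary form of degree `N`, in terms of the
affine coordinate `z = 1 / (y₀ - c)`: the polynomial `z ^ N * p(c + 1 / z)`. -/
noncomputable def affForm (c : ℂ) (N : ℕ) (p : ℂ[X]) : ℂ[X] := reflect N (p.comp (X + C c))

variable (c : ℂ)

lemma natDegree_comp_X_add_C (p : ℂ[X]) : (p.comp (X + C c)).natDegree = p.natDegree := by
  rw [natDegree_comp, natDegree_X_add_C, mul_one]

lemma affForm_mul {M N : ℕ} {p q : ℂ[X]} (hp : p.natDegree ≤ M) (hq : q.natDegree ≤ N) :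
    affForm c (M + N) (p * q) = affForm c M p * affForm c N q := by
  unfold affForm
  rw [mul_comp, reflect_mul _ _ (by rwa [natDegree_comp_X_add_C])
    (by rwa [natDegree_comp_X_add_C])]

lemma affForm_add (N : ℕ) (p q : ℂ[X]) :
    affForm c N (p + q) = affForm c N p + affForm c N q := by
  unfold affForm
  rw [add_comp, reflect_add]

lemma affForm_C_mul (N : ℕ) (a : ℂ) (p : ℂ[X]) :
    affForm c N (C a * p) = C a * affForm c N p := by
  unfold affForm
  rw [mul_comp, C_comp, reflect_C_mul]

lemma affForm_zero (N : ℕ) : affForm c N 0 = 0 := by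
  unfold affForm
  rw [zero_comp, reflect_zero]

lemma affForm_one (N : ℕ) : affForm c N 1 = X ^ N := by
  unfold affForm
  rw [one_comp, reflect_one]

lemma affForm_X : affForm c 1 X = 1 + C c * X := by
  unfold affForm
  rw [X_comp, reflect_add, reflect_one_X, reflect_C, pow_one]

lemma affForm_X_pow (i : ℕ) : affForm c i (X ^ i) = (1 + C c * X) ^ i := by
  induction i with
  | zero => rw [pow_zero, pow_zero, affForm_one, pow_zero]
  | succ i ih => rw [pow_succ, affForm_mul c (natDegree_X_pow_le i) natDegree_X_le, ih, affForm_X,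
      pow_succ]

lemma affForm_X_pow_of_le {i N : ℕ} (h : i ≤ N) :
    affForm c N (X ^ i) = (1 + C c * X) ^ i * X ^ (N - i) := by
  obtain ⟨j, rfl⟩ := Nat.exists_eq_add_of_le h
  have := affForm_mul c (natDegree_X_pow_le (R := ℂ) i) (natDegree_one.le.trans (Nat.zero_le j))
  rw [mul_one, affForm_X_pow, affForm_one] at this
  rw [this, Nat.add_sub_cancel_left]

lemma X_pow_mul_affForm {N : ℕ} {p : ℂ[X]} (hp : p.natDegree ≤ N) (k : ℕ) :
    X ^ k * affForm c N p = affForm c (N + k) p := by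
  have := affForm_mul c hp (natDegree_one.le.trans (Nat.zero_le k))
  rw [mul_one, affForm_one] at this
  rw [this, mul_comm]

lemma natDegree_reflect_le_of_le {N : ℕ} {p : ℂ[X]} (hp : p.natDegree ≤ N) :
    (reflect N p).natDegree ≤ N :=
  natDegree_reflect_le.trans (max_le le_rfl hp)

lemma natDegree_affForm_le {N : ℕ} {p : ℂ[X]} (hp : p.natDegree ≤ N) :
    (affForm c N p).natDegree ≤ N :=
  natDegree_reflect_le_of_le (by rwa [natDegree_comp_X_add_C])

lemma affForm_injective (N : ℕ) : Function.Injective (affForm c N) := by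
  intro p q h
  have h1 := congrArg (fun f => (reflect N f).comp (X - C c)) h
  simpa [affForm, comp_assoc] using h1

lemma affForm_comp {N : ℕ} (q : ℂ[X]) : affForm c N ((reflect N q).comp (X - C c)) = q := by
  simp [affForm, comp_assoc]

lemma one_add_pow_mul_affForm {N : ℕ} {p : ℂ[X]} (hp : p.natDegree ≤ N) (k : ℕ) :
    (1 + C c * X) ^ k * affForm c N (reflect N p) = affForm c (N + k) (reflect (N + k) p) := by
  have h := reflect_mul p 1 hp (natDegree_one.le.trans (Nat.zero_le k))
  rw [mul_one, reflect_one] at h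
  rw [h, affForm_mul c (natDegree_reflect_le_of_le hp) (natDegree_X_pow_le k), affForm_X_pow,
    mul_comm]

/-- A multiple of the binary form `F` of degree `d` in the affine coordinate is a multiple of `F`
as a binary form, if `F` does not vanish at the point `c` at infinity. -/
lemma affForm_dvd {d N : ℕ} {F g : ℂ[X]} (hF : F.natDegree ≤ d)
    (hd : (affForm c d F).natDegree = d) (hg : g.natDegree ≤ N) (hg0 : g ≠ 0) :
    affForm c d F ∣ affForm c N g ↔ ∃ p, d + p.natDegree ≤ N ∧ g = F * p := by
  constructor
  · rintro ⟨q, hq⟩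
    have h0 : affForm c N g ≠ 0 := fun h =>
      hg0 (affForm_injective c N (h.trans (affForm_zero c N).symm))
    have hF0 : affForm c d F ≠ 0 := fun h => h0 (by rw [hq, h, zero_mul])
    have hq0 : q ≠ 0 := fun h => h0 (by rw [hq, h, mul_zero])
    have hN : d + q.natDegree ≤ N := by
      rw [← hd, ← natDegree_mul hF0 hq0, ← hq]
      exact natDegree_affForm_le c hg
    have hp : ((reflect (N - d) q).comp (X - C c)).natDegree ≤ N - d := by
      rw [natDegree_comp, natDegree_X_sub_C, mul_one]
      exact natDegree_reflect_le_of_le (by omega)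
    refine ⟨(reflect (N - d) q).comp (X - C c), by omega, affForm_injective c N ?_⟩
    have h1 := affForm_mul c hF hp
    rw [show d + (N - d) = N by omega] at h1
    rw [h1, affForm_comp, hq]
  · rintro ⟨p, hp, rfl⟩
    obtain ⟨k, rfl⟩ := Nat.exists_eq_add_of_le hp
    rw [add_assoc, affForm_mul c hF (Nat.le_add_right _ _)]
    exact dvd_mul_right _ _

lemma IsDrazin.mul_pow_mul_pow {A : Type*} [CommRing A] {r d : A} (hd : IsDrazin r d) {i N : ℕ}
    (hi : i ≤ N) : r * d * d ^ N * r ^ (N - i) = r * d * d ^ i := by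
  obtain ⟨j, rfl⟩ := Nat.exists_eq_add_of_le hi
  rw [Nat.add_sub_cancel_left]
  have := IsIdempotentElem.pow_succ_eq j hd.idem
  linear_combination d ^ i * this

lemma aeval_chart {A : Type*} [CommRing A] [Algebra ℂ A] {r d : A} (hd : IsDrazin r d) {N : ℕ}
    {p : ℂ[X]} (hp : p.natDegree ≤ N) :
    r * d * aeval ((1 + c • r) * d) p = r * d * (d ^ N * aeval r (affForm c N p)) := by
  refine induction_with_natDegree_le (fun p => r * d * aeval ((1 + c • r) * d) p =
    r * d * (d ^ N * aeval r (affForm c N p))) N ?_ ?_ ?_ p hp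
  · simp [affForm_zero]
  · intro i a _ hi
    have h1 := hd.mul_pow_mul_pow hi
    rw [affForm_C_mul, affForm_X_pow_of_le c hi]
    simp only [map_mul, map_pow, aeval_C, aeval_X, map_add, map_one, ← Algebra.smul_def]
    rw [mul_pow]
    simp only [Algebra.smul_def]
    linear_combination (-algebraMap ℂ A a * (1 + algebraMap ℂ A c * r) ^ i) * h1
  · intro f g _ _ hf hg
    rw [map_add, affForm_add, map_add, mul_add, mul_add, mul_add, hf, hg]

lemma aeval_chartInf {A : Type*} [CommRing A] [Algebra ℂ A] {r d : A}
    (hd : IsDrazin (1 + c • r) d) {N : ℕ} {p : ℂ[X]} (hp : p.natDegree ≤ N) :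
    (1 + c • r) * d * aeval (r * d) p =
      (1 + c • r) * d * (d ^ N * aeval r (affForm c N (reflect N p))) := by
  refine induction_with_natDegree_le (fun p => (1 + c • r) * d * aeval (r * d) p =
      (1 + c • r) * d * (d ^ N * aeval r (affForm c N (reflect N p)))) N ?_ ?_ ?_ p hp
  · simp [affForm_zero]
  · intro i a _ hi
    have h1 := hd.mul_pow_mul_pow hi
    rw [reflect_C_mul, reflect_monomial, revAt_le hi, affForm_C_mul,
      affForm_X_pow_of_le c (Nat.sub_le N i), Nat.sub_sub_self hi]
    simp only [map_mul, map_pow, aeval_C, aeval_X, map_add, map_one, ← Algebra.smul_def]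
    rw [mul_pow]
    simp only [Algebra.smul_def] at h1 ⊢
    linear_combination (-algebraMap ℂ A a * r ^ i) * h1
  · intro f g _ _ hf hg
    rw [map_add, reflect_add, affForm_add, map_add, mul_add, mul_add, mul_add, hf, hg]

lemma IsDrazin.mul_eq_zero_iff {A : Type*} [CommRing A] {r d x : A} (hd : IsDrazin r d) (N : ℕ) :
    r * d * (d ^ N * x) = 0 ↔ ∃ k : ℕ, r ^ k * x = 0 := by
  constructor
  · intro h
    obtain ⟨k, hk⟩ := hd.pow
    have h1 := IsIdempotentElem.pow_succ_eq N hd.idem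
    refine ⟨k, ?_⟩
    linear_combination (r ^ k * r ^ N) * h - x * hk - (r ^ k * x) * h1
  · rintro ⟨k, hk⟩
    have h1 := IsIdempotentElem.pow_succ_eq k hd.idem
    linear_combination (r * d * d ^ N * d ^ k) * hk - (d ^ N * x) * h1

open scoped IsMulCommutative

variable {n : ℕ}

lemma kerIdeal_affineMor₀ (R : Mat n) (f : ℂ[X]) :
    f ∈ kerIdeal (affineMor c R).φ₀ ↔
      ∃ N, f.natDegree ≤ N ∧ minpoly ℂ R ∣ affForm c N f := by
  set r : Algebra.adjoin ℂ {R} := ⟨R, Algebra.self_mem_adjoin_singleton ℂ R⟩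
  have hr : ∀ p : ℂ[X], minpoly ℂ R ∣ p ↔ aeval r p = 0 := fun p => by
    have h1 : (Algebra.adjoin ℂ {R}).val r = R := rfl
    have h2 := aeval_algHom_apply (Algebra.adjoin ℂ {R}).val r p
    rw [h1] at h2
    rw [minpoly.dvd_iff, h2, map_eq_zero_iff _ Subtype.val_injective]
  have h0 : ∀ N, f.natDegree ≤ N → (f ∈ kerIdeal (affineMor c R).φ₀ ↔
      ∃ k : ℕ, minpoly ℂ R ∣ affForm c (N + k) f) := by
    intro N hN
    change (Algebra.adjoin ℂ {R}).val (r * drazin r * aeval ((1 + c • r) * drazin r) f) = 0 ↔ _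
    rw [map_eq_zero_iff _ Subtype.val_injective, aeval_chart c (isDrazin_drazin r) hN,
      (isDrazin_drazin r).mul_eq_zero_iff]
    refine exists_congr fun k => ?_
    rw [hr, ← X_pow_mul_affForm c hN k, map_mul, map_pow, aeval_X]
  constructor
  · intro hf
    obtain ⟨k, hk⟩ := (h0 _ le_rfl).1 hf
    exact ⟨_, Nat.le_add_right _ k, hk⟩
  · rintro ⟨N, hN, h⟩
    exact (h0 N hN).2 ⟨0, h⟩

lemma kerIdeal_affineMorInf (R : Mat n) (f : ℂ[X]) :
    f ∈ kerIdeal (affineMor c R).φInf ↔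
      ∃ N, f.natDegree ≤ N ∧ minpoly ℂ R ∣ affForm c N (reflect N f) := by
  set r : Algebra.adjoin ℂ {R} := ⟨R, Algebra.self_mem_adjoin_singleton ℂ R⟩
  have hr : ∀ p : ℂ[X], minpoly ℂ R ∣ p ↔ aeval r p = 0 := fun p => by
    have h1 : (Algebra.adjoin ℂ {R}).val r = R := rfl
    have h2 := aeval_algHom_apply (Algebra.adjoin ℂ {R}).val r p
    rw [h1] at h2
    rw [minpoly.dvd_iff, h2, map_eq_zero_iff _ Subtype.val_injective]
  have h0 : ∀ N, f.natDegree ≤ N → (f ∈ kerIdeal (affineMor c R).φInf ↔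
      ∃ k : ℕ, minpoly ℂ R ∣ affForm c (N + k) (reflect (N + k) f)) := by
    intro N hN
    change (Algebra.adjoin ℂ {R}).val ((1 + c • r) * drazin (1 + c • r) *
      aeval (r * drazin (1 + c • r)) f) = 0 ↔ _
    rw [map_eq_zero_iff _ Subtype.val_injective,
      aeval_chartInf c (isDrazin_drazin (1 + c • r)) hN,
      (isDrazin_drazin (1 + c • r)).mul_eq_zero_iff]
    refine exists_congr fun k => ?_
    rw [hr, ← one_add_pow_mul_affForm c hN k]
    simp only [map_mul, map_pow, aeval_C, aeval_X, map_add, map_one, ← Algebra.smul_def]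
  constructor
  · intro hf
    obtain ⟨k, hk⟩ := (h0 _ le_rfl).1 hf
    exact ⟨_, Nat.le_add_right _ k, hk⟩
  · rintro ⟨N, hN, h⟩
    exact (h0 N hN).2 ⟨0, h⟩

lemma form₀_coeff {d : ℕ} {F : ℂ[X]} (hF : F.natDegree ≤ d) :
    form₀ (fun i : Fin (d + 1) => F.coeff i) = F := by
  rw [form₀, Fin.sum_univ_eq_sum_range (fun i => F.coeff i • (X : ℂ[X]) ^ i)]
  conv_rhs => rw [F.as_sum_range_C_mul_X_pow' (Nat.lt_succ_of_le hF)]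
  simp only [smul_eq_C_mul]

lemma formInf_eq_reflect {d : ℕ} (a : Fin (d + 1) → ℂ) : formInf a = reflect d (form₀ a) := by
  ext k
  simp only [formInf, form₀, coeff_reflect, finsetSum_coeff, coeff_smul, coeff_X_pow, smul_eq_mul]
  refine Finset.sum_congr rfl fun i _ => ?_
  congr 2
  have hi := i.2
  rw [eq_iff_iff]
  by_cases hk : k ≤ d
  · rw [revAt_le hk]; omega
  · rw [revAt_eq_self_of_lt (by omega)]; omega

lemma natDegree_form₀_le {d : ℕ} (a : Fin (d + 1) → ℂ) : (form₀ a).natDegree ≤ d := by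
  refine natDegree_sum_le_of_forall_le _ _ fun i _ => ?_
  exact (natDegree_smul_le _ _).trans ((natDegree_X_pow_le _).trans (Nat.lt_succ_iff.1 i.2))

lemma coeff_form₀ {d : ℕ} (a : Fin (d + 1) → ℂ) (i : Fin (d + 1)) : (form₀ a).coeff i = a i := by
  simp only [form₀, finsetSum_coeff, coeff_smul, coeff_X_pow, smul_eq_mul, mul_ite, mul_one,
    mul_zero]
  rw [Finset.sum_eq_single i] <;> simp +contextual [Fin.ext_iff, eq_comm]

lemma form₀_ne_zero {d : ℕ} {a : Fin (d + 1) → ℂ} (ha : a ≠ 0) : form₀ a ≠ 0 := fun h =>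
  ha (funext fun i => by rw [← coeff_form₀ a i, h, coeff_zero, Pi.zero_apply])

/-- The image of the morphism with affine coordinate `R` is cut out by the minimal polynomial of
`R`, homogenized. -/
theorem image_affineMor {R : Mat n} {d : ℕ} {a : Fin (d + 1) → ℂ} {s : ℂ} (hs : s ≠ 0)
    (ha : affForm c d (form₀ a) = C s * minpoly ℂ R) (hd : (minpoly ℂ R).natDegree = d) :
    (affineMor c R).image = zeroScheme d a := by
  have hF := natDegree_form₀_le a
  have hd' : (affForm c d (form₀ a)).natDegree = d := by rw [ha, natDegree_C_mul hs, hd]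
  have hdvd : ∀ p, minpoly ℂ R ∣ p ↔ affForm c d (form₀ a) ∣ p := fun p => by
    rw [ha, IsUnit.mul_left_dvd (isUnit_C.2 (IsUnit.mk0 _ hs))]
  refine ClosedSubscheme.ext (Ideal.ext fun f => ?_) (Ideal.ext fun f => ?_)
  · change f ∈ kerIdeal _ ↔ f ∈ Ideal.span _
    rw [kerIdeal_affineMor₀, Ideal.mem_span_singleton]
    by_cases hf : f = 0
    · simp only [hf, dvd_zero, iff_true]
      exact ⟨0, natDegree_zero.le, by rw [affForm_zero]; exact dvd_zero _⟩
    constructor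
    · rintro ⟨N, hN, h⟩
      obtain ⟨p, -, rfl⟩ := (affForm_dvd c hF hd' hN hf).1 ((hdvd _).1 h)
      exact dvd_mul_right _ _
    · rintro ⟨p, rfl⟩
      have hN : (form₀ a * p).natDegree ≤ d + p.natDegree :=
        natDegree_mul_le.trans (Nat.add_le_add_right hF _)
      exact ⟨_, hN, (hdvd _).2 ((affForm_dvd c hF hd' hN hf).2 ⟨p, le_rfl, rfl⟩)⟩
  · change f ∈ kerIdeal _ ↔ f ∈ Ideal.span _
    rw [kerIdeal_affineMorInf, Ideal.mem_span_singleton, formInf_eq_reflect]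
    by_cases hf : f = 0
    · simp only [hf, dvd_zero, iff_true]
      exact ⟨0, natDegree_zero.le, by rw [reflect_zero, affForm_zero]; exact dvd_zero _⟩
    constructor
    · rintro ⟨N, hN, h⟩
      obtain ⟨p, hp, h⟩ := (affForm_dvd c hF hd' (natDegree_reflect_le_of_le hN)
        (fun h => hf (reflect_eq_zero_iff.1 h))).1 ((hdvd _).1 h)
      have h1 := reflect_mul (form₀ a) p hF (show p.natDegree ≤ N - d by omega)
      rw [show d + (N - d) = N by omega, ← h, reflect_reflect] at h1
      rw [h1]
      exact dvd_mul_right _ _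
    · rintro ⟨p, rfl⟩
      have hN : (reflect d (form₀ a) * p).natDegree ≤ d + p.natDegree :=
        natDegree_mul_le.trans (Nat.add_le_add_right (natDegree_reflect_le_of_le hF) _)
      refine ⟨_, hN, (hdvd _).2 ((affForm_dvd c hF hd' (natDegree_reflect_le_of_le hN)
        (fun h => hf (reflect_eq_zero_iff.1 h))).2 ⟨reflect p.natDegree p, ?_, ?_⟩)⟩
      · exact Nat.add_le_add_left (natDegree_reflect_le_of_le le_rfl) _
      · rw [reflect_mul _ _ (natDegree_reflect_le_of_le hF) le_rfl, reflect_reflect]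

lemma exists_form_minpoly (R : Mat n) :
    ∃ a : Fin ((minpoly ℂ R).natDegree + 1) → ℂ, a ≠ 0 ∧
      affForm c (minpoly ℂ R).natDegree (form₀ a) = minpoly ℂ R := by
  set F := (reflect (minpoly ℂ R).natDegree (minpoly ℂ R)).comp (X - C c) with hF
  have hdeg : F.natDegree ≤ (minpoly ℂ R).natDegree := by
    rw [hF, natDegree_comp, natDegree_X_sub_C, mul_one]
    exact natDegree_reflect_le_of_le le_rfl
  have h : affForm c (minpoly ℂ R).natDegree F = minpoly ℂ R := affForm_comp c _
  refine ⟨fun i => F.coeff i, fun h0 => ?_, by rw [form₀_coeff hdeg, h]⟩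
  have h1 := form₀_coeff hdeg
  rw [h0] at h1
  have h2 : F = 0 := by rw [← h1]; simp [form₀]
  rw [h2, affForm_zero] at h
  exact minpoly.ne_zero (Algebra.IsIntegral.isIntegral R) h.symm

end AffineForm

/-! ### Lengths of closed subschemes -/

section Length

lemma res₀_eq_mul_T (ℓ : ℂ[T;T⁻¹]) :
    ∃ (k : ℕ) (p : ℂ[X]), ℓ = LaurentPolynomial.T (-(k : ℤ)) * res₀ p := by
  obtain ⟨k, p, h⟩ := LaurentPolynomial.exists_T_pow ℓ
  refine ⟨k, p, ?_⟩
  change ℓ = _ * toLaurent p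
  rw [h, mul_left_comm, ← LaurentPolynomial.T_add, neg_add_cancel, LaurentPolynomial.T_zero,
    mul_one]

lemma res₀_injective : Function.Injective res₀ := Polynomial.toLaurent_injective

lemma isCoprime_X_pow {p : ℂ[X]} (hp : p.coeff 0 ≠ 0) (k : ℕ) : IsCoprime p (X ^ k) := by
  refine IsCoprime.pow_right ?_
  rw [isCoprime_comm, irreducible_X.coprime_iff_not_dvd, X_dvd_iff]
  exact hp

lemma dvd_of_res₀_dvd {p q : ℂ[X]} (hp : p.coeff 0 ≠ 0) (h : res₀ p ∣ res₀ q) : p ∣ q := by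
  obtain ⟨ℓ, hℓ⟩ := h
  obtain ⟨k, g, rfl⟩ := res₀_eq_mul_T ℓ
  have h1 : res₀ (X ^ k * q) = res₀ (p * g) := by
    have hT : (LaurentPolynomial.T (k : ℤ) : ℂ[T;T⁻¹]) * LaurentPolynomial.T (-(k : ℤ)) = 1 := by
      rw [← LaurentPolynomial.T_add, add_neg_cancel, LaurentPolynomial.T_zero]
    rw [map_mul, map_mul, hℓ, res₀_X_pow]
    linear_combination (res₀ p * res₀ g) * hT
  have h2 : p ∣ X ^ k * q := ⟨g, res₀_injective h1⟩
  exact (isCoprime_X_pow hp k).dvd_of_dvd_mul_left h2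

lemma dvd_of_resInf_dvd {p q : ℂ[X]} (hp : p.coeff 0 ≠ 0) (h : resInf p ∣ resInf q) : p ∣ q := by
  refine dvd_of_res₀_dvd hp ?_
  have h1 : ∀ f, LaurentPolynomial.invert (resInf f) = res₀ f := fun f => by
    change LaurentPolynomial.invert (LaurentPolynomial.invert (toLaurent f)) = toLaurent f
    ext
    simp
  rw [← h1 p, ← h1 q]
  exact map_dvd LaurentPolynomial.invert h

lemma finrank_overlap {p : ℂ[X]} (hp : p.coeff 0 ≠ 0) :
    Module.finrank ℂ (ℂ[T;T⁻¹] ⧸ Ideal.span {res₀ p}) = p.natDegree := by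
  have hp0 : p ≠ 0 := fun h => hp (by rw [h, coeff_zero])
  let ψ : ℂ[X] →ₐ[ℂ] ℂ[T;T⁻¹] ⧸ Ideal.span {res₀ p} := (Ideal.Quotient.mkₐ ℂ _).comp res₀
  have hψ : Function.Surjective ψ := by
    intro x
    obtain ⟨ℓ, rfl⟩ := Ideal.Quotient.mk_surjective x
    obtain ⟨k, g, rfl⟩ := res₀_eq_mul_T ℓ
    obtain ⟨u, v, huv⟩ := isCoprime_X_pow hp k
    refine ⟨v * g, ?_⟩
    refine Ideal.Quotient.eq.2 (Ideal.mem_span_singleton.2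
      ⟨-(LaurentPolynomial.T (-(k : ℤ)) * res₀ (u * g)), ?_⟩)
    have h1 := congrArg res₀ huv
    rw [map_add, map_mul, map_mul, map_one, res₀_X_pow] at h1
    have h2 : (LaurentPolynomial.T (-(k : ℤ)) : ℂ[T;T⁻¹]) * LaurentPolynomial.T (k : ℤ) = 1 := by
      rw [← LaurentPolynomial.T_add, neg_add_cancel, LaurentPolynomial.T_zero]
    change res₀ (v * g) - LaurentPolynomial.T (-(k : ℤ)) * res₀ g = res₀ p * _
    rw [map_mul, map_mul]
    linear_combination (LaurentPolynomial.T (-(k : ℤ)) * res₀ g) * h1 - (res₀ v * res₀ g) * h2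
  have hker : RingHom.ker ψ = Ideal.span {p} := by
    ext q
    rw [RingHom.mem_ker, Ideal.mem_span_singleton]
    change Ideal.Quotient.mk _ (res₀ q) = 0 ↔ _
    rw [Ideal.Quotient.eq_zero_iff_mem, Ideal.mem_span_singleton]
    exact ⟨dvd_of_res₀_dvd hp, map_dvd res₀⟩
  rw [← finrank_quotient_span_eq_natDegree (f := p), ← hker]
  exact (Ideal.quotientKerAlgEquivOfSurjective hψ).toLinearEquiv.finrank_eq.symm

lemma finite_quotient_span {p : ℂ[X]} (hp : p ≠ 0) : Module.Finite ℂ (ℂ[X] ⧸ Ideal.span {p}) :=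
  (AdjoinRoot.powerBasis hp).finite

namespace D0.ClosedSubscheme

/-- The Mayer-Vietoris sequence: every function on the overlap is a difference of functions on the
two charts, so that the length can be computed from the charts. -/
lemma finrank_globalSections (Z : ClosedSubscheme) (h₀ : Module.Finite ℂ (ℂ[X] ⧸ Z.I₀))
    (h₁ : Module.Finite ℂ (ℂ[X] ⧸ Z.IInf)) :
    Module.finrank ℂ Z.globalSections + Module.finrank ℂ Z.OverlapRing =
      Module.finrank ℂ (ℂ[X] ⧸ Z.I₀) + Module.finrank ℂ (ℂ[X] ⧸ Z.IInf) := by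
  let δ : ((ℂ[X] ⧸ Z.I₀) × (ℂ[X] ⧸ Z.IInf)) →ₗ[ℂ] Z.OverlapRing :=
    (Z.restrict₀.comp (AlgHom.fst ℂ _ _)).toLinearMap -
      (Z.restrictInf.comp (AlgHom.snd ℂ _ _)).toLinearMap
  have hker : LinearMap.ker δ = Subalgebra.toSubmodule Z.globalSections := by
    ext x
    rw [LinearMap.mem_ker, Subalgebra.mem_toSubmodule]
    exact sub_eq_zero
  have hrange : LinearMap.range δ = ⊤ := by
    rw [LinearMap.range_eq_top]
    intro x
    obtain ⟨ℓ, rfl⟩ := Ideal.Quotient.mk_surjective x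
    suffices ∃ p q : ℂ[X], ℓ = res₀ p - resInf q by
      obtain ⟨p, q, rfl⟩ := this
      exact ⟨(Ideal.Quotient.mk _ p, Ideal.Quotient.mk _ q), rfl⟩
    induction ℓ using LaurentPolynomial.induction_on' with
    | add f g hf hg =>
      obtain ⟨p, q, rfl⟩ := hf
      obtain ⟨p', q', rfl⟩ := hg
      exact ⟨p + p', q + q', by rw [map_add, map_add]; ring⟩
    | C_mul_T k a =>
      rw [← LaurentPolynomial.smul_eq_C_mul]
      obtain ⟨i, rfl | rfl⟩ := k.eq_nat_or_neg
      · exact ⟨a • X ^ i, 0, by rw [map_smul, res₀_X_pow, map_zero, sub_zero]⟩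
      · exact ⟨0, -(a • X ^ i), by rw [map_neg, map_smul, resInf_X_pow, map_zero, zero_sub,
          neg_neg]⟩
  have h := LinearMap.finrank_range_add_finrank_ker δ
  rw [hker, hrange, finrank_top, Module.finrank_prod] at h
  rw [← h, add_comm]
  rfl

end D0.ClosedSubscheme

lemma exists_eq_X_pow_mul {f : ℂ[X]} (hf : f ≠ 0) :
    ∃ (i : ℕ) (g : ℂ[X]), f = X ^ i * g ∧ g.coeff 0 ≠ 0 := by
  obtain ⟨g, hg, h⟩ := exists_eq_pow_rootMultiplicity_mul_and_not_dvd f hf 0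
  rw [C_0, sub_zero] at hg h
  exact ⟨_, g, hg, fun h0 => h (X_dvd_iff.2 h0)⟩

lemma reflect_X_pow_mul (i j : ℕ) (g : ℂ[X]) :
    reflect (i + g.natDegree + j) (X ^ i * g) = X ^ j * g.reverse := by
  have h1 := reflect_mul (X ^ i * g) 1 (F := i + g.natDegree) (G := j)
    (natDegree_mul_le.trans (Nat.add_le_add_right (natDegree_X_pow_le i) _)) (by simp)
  have h2 := reflect_mul (X ^ i) g (natDegree_X_pow_le (R := ℂ) i) le_rfl
  rw [mul_one, reflect_one, h2, reflect_monomial, revAt_le le_rfl, Nat.sub_self, pow_zero,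
    one_mul] at h1
  rw [h1, mul_comm]
  rfl

lemma natDegree_reverse_of_coeff_zero {g : ℂ[X]} (hg : g.coeff 0 ≠ 0) :
    g.reverse.natDegree = g.natDegree := by
  rw [reverse_natDegree, natTrailingDegree_eq_zero.2 (Or.inr hg), Nat.sub_zero]

/-- The zero scheme of a nonzero binary form of degree `n` has length `n`. -/
theorem hasLength_zeroScheme {n : ℕ} {a : Fin (n + 1) → ℂ} (ha : a ≠ 0) :
    (zeroScheme n a).HasLength n := by
  have hf := form₀_ne_zero ha
  obtain ⟨i, g, hfg, hg⟩ := exists_eq_X_pow_mul hf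
  have hg0 : g ≠ 0 := fun h => hg (by rw [h, coeff_zero])
  have hdeg : (form₀ a).natDegree = i + g.natDegree := by
    rw [hfg, natDegree_mul (pow_ne_zero _ X_ne_zero) hg0, natDegree_X_pow]
  obtain ⟨j, hj⟩ := Nat.exists_eq_add_of_le (hdeg ▸ natDegree_form₀_le a)
  have hInf : formInf a = X ^ j * g.reverse := by
    have h := reflect_X_pow_mul i j g
    rw [← hfg, ← hj, ← formInf_eq_reflect] at h
    exact h
  have hr0 : g.reverse ≠ 0 := by rwa [Ne, reverse_eq_zero]
  have hdegInf : (formInf a).natDegree = j + g.natDegree := by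
    rw [hInf, natDegree_mul (pow_ne_zero _ X_ne_zero) hr0, natDegree_X_pow,
      natDegree_reverse_of_coeff_zero hg]
  have hInf0 : formInf a ≠ 0 := by
    rw [hInf]
    exact mul_ne_zero (pow_ne_zero _ X_ne_zero) hr0
  have h₀ : Module.Finite ℂ (ℂ[X] ⧸ (zeroScheme n a).I₀) := finite_quotient_span hf
  have h₁ : Module.Finite ℂ (ℂ[X] ⧸ (zeroScheme n a).IInf) := finite_quotient_span hInf0
  refine ⟨h₀, h₁, ?_⟩
  have h := (zeroScheme n a).finrank_globalSections h₀ h₁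
  have hov : (zeroScheme n a).I₀.map res₀ = Ideal.span {res₀ g} := by
    change (Ideal.span {form₀ a}).map res₀ = _
    rw [Ideal.map_span, Set.image_singleton, hfg, map_mul, res₀_X_pow,
      Ideal.span_singleton_mul_left_unit (LaurentPolynomial.isUnit_T _)]
  have e : Module.finrank ℂ (zeroScheme n a).OverlapRing = g.natDegree := by
    rw [← finrank_overlap hg, ← hov]
  have e₀ : Module.finrank ℂ (ℂ[X] ⧸ (zeroScheme n a).I₀) = (form₀ a).natDegree :=
    finrank_quotient_span_eq_natDegree
  have e₁ : Module.finrank ℂ (ℂ[X] ⧸ (zeroScheme n a).IInf) = (formInf a).natDegree :=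
    finrank_quotient_span_eq_natDegree
  rw [e, e₀, e₁, hdeg, hdegInf] at h
  omega

lemma ne_bot_of_finite_quotient {I : Ideal ℂ[X]} (h : Module.Finite ℂ (ℂ[X] ⧸ I)) : I ≠ ⊥ := by
  rintro rfl
  have := Module.Finite.equiv (AlgEquiv.quotientBot ℂ ℂ[X]).toLinearEquiv
  exact Polynomial.not_finite (R := ℂ) this

/-- A finite closed subscheme of `ℙ¹` is the zero scheme of a binary form. -/
theorem exists_eq_zeroScheme (Z : ClosedSubscheme) (h₀ : Module.Finite ℂ (ℂ[X] ⧸ Z.I₀))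
    (h₁ : Module.Finite ℂ (ℂ[X] ⧸ Z.IInf)) :
    ∃ (d : ℕ) (a : Fin (d + 1) → ℂ), a ≠ 0 ∧ Z = zeroScheme d a := by
  obtain ⟨f, hf⟩ : ∃ f, Z.I₀ = Ideal.span {f} := (IsPrincipalIdealRing.principal Z.I₀).principal
  obtain ⟨g, hg⟩ : ∃ f, Z.IInf = Ideal.span {f} :=
    (IsPrincipalIdealRing.principal Z.IInf).principal
  have hf0 : f ≠ 0 := fun h => ne_bot_of_finite_quotient h₀ (by rw [hf, h]; simp)
  have hg0 : g ≠ 0 := fun h => ne_bot_of_finite_quotient h₁ (by rw [hg, h]; simp)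
  obtain ⟨i, f₁, rfl, hf₁⟩ := exists_eq_X_pow_mul hf0
  obtain ⟨j, g₁, rfl, hg₁⟩ := exists_eq_X_pow_mul hg0
  have hf₁0 : f₁ ≠ 0 := fun h => hf₁ (by rw [h, coeff_zero])
  have hglue := Z.glue
  rw [hf, hg, Ideal.map_span, Ideal.map_span, Set.image_singleton, Set.image_singleton, map_mul,
    map_mul, res₀_X_pow, resInf_X_pow,
    Ideal.span_singleton_mul_left_unit (LaurentPolynomial.isUnit_T _),
    Ideal.span_singleton_mul_left_unit (LaurentPolynomial.isUnit_T _), res₀_eq_reverse,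
    Ideal.span_singleton_mul_left_unit (LaurentPolynomial.isUnit_T _)] at hglue
  have hrev : f₁.reverse.coeff 0 ≠ 0 := by
    rw [coeff_zero_reverse]
    exact leadingCoeff_ne_zero.2 hf₁0
  have hass : Associated g₁ f₁.reverse :=
    associated_of_dvd_dvd
      (dvd_of_resInf_dvd hg₁ (Ideal.span_singleton_le_span_singleton.1 hglue.le))
      (dvd_of_resInf_dvd hrev (Ideal.span_singleton_le_span_singleton.1 hglue.ge))
  have hdeg : (X ^ i * f₁).natDegree ≤ i + f₁.natDegree + j := by
    refine natDegree_mul_le.trans ?_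
    have := natDegree_X_pow_le (R := ℂ) i
    omega
  have hform := form₀_coeff hdeg
  refine ⟨i + f₁.natDegree + j, fun k => (X ^ i * f₁).coeff k, fun h => hf0 ?_, ?_⟩
  · rw [← hform, h]
    simp [form₀]
  · refine ClosedSubscheme.ext ?_ ?_
    · change _ = Ideal.span {form₀ _}
      rw [hform, hf]
    · change _ = Ideal.span {formInf _}
      rw [formInf_eq_reflect, hform, hg, reflect_X_pow_mul]
      exact Ideal.span_singleton_eq_span_singleton.2 (hass.mul_left _)

lemma exists_eq_zeroScheme_of_hasLength {n : ℕ} {Z : ClosedSubscheme} (h : Z.HasLength n) :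
    ∃ a : Fin (n + 1) → ℂ, a ≠ 0 ∧ Z = zeroScheme n a := by
  obtain ⟨d, a, ha, rfl⟩ := exists_eq_zeroScheme Z h.1 h.2.1
  obtain rfl : d = n := (hasLength_zeroScheme ha).2.2.symm.trans h.2.2
  exact ⟨a, ha, rfl⟩

lemma zeroScheme_eq_iff {n : ℕ} {a b : Fin (n + 1) → ℂ} :
    zeroScheme n a = zeroScheme n b → ∃ s : ℂ, s ≠ 0 ∧ form₀ a = C s * form₀ b := by
  intro h
  have h0 : Ideal.span {form₀ a} = Ideal.span {form₀ b} := congrArg ClosedSubscheme.I₀ h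
  obtain ⟨u, hu⟩ := (Ideal.span_singleton_eq_span_singleton.1 h0).symm
  obtain ⟨s, hs, hsu⟩ := Polynomial.isUnit_iff.1 u.isUnit
  exact ⟨s, hs.ne_zero, by rw [← hu, ← hsu, mul_comm]⟩

variable {n : ℕ}

theorem hasLength_image_affineMor (c : ℂ) (R : Mat n) {d : ℕ} :
    (affineMor c R).image.HasLength d ↔ (minpoly ℂ R).natDegree = d := by
  obtain ⟨a, ha, h⟩ := exists_form_minpoly c R
  rw [image_affineMor c one_ne_zero (by rw [h, C_1, one_mul]) rfl]
  exact ⟨fun h => (hasLength_zeroScheme ha).2.2.symm.trans h.2.2,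
    fun h => h ▸ hasLength_zeroScheme ha⟩

lemma minpoly_eq_of_image_eq {c : ℂ} {R R' : Mat n}
    (h : (affineMor c R).image = (affineMor c R').image) : minpoly ℂ R = minpoly ℂ R' := by
  obtain ⟨a, ha, hR⟩ := exists_form_minpoly c R
  obtain ⟨b, hb, hR'⟩ := exists_form_minpoly c R'
  have hd : (minpoly ℂ R).natDegree = (minpoly ℂ R').natDegree := by
    rw [← hasLength_image_affineMor c, h, hasLength_image_affineMor c]
  rw [image_affineMor c one_ne_zero (by rw [hR, C_1, one_mul]) rfl,
    image_affineMor c one_ne_zero (by rw [hR', C_1, one_mul]) rfl] at h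
  generalize hk : (minpoly ℂ R).natDegree = k at *
  subst hd
  obtain ⟨s, -, hs⟩ := zeroScheme_eq_iff h
  rw [hs, affForm_C_mul, hR'] at hR
  have h1 := minpoly.monic (Algebra.IsIntegral.isIntegral (R := ℂ) R)
  have h2 := minpoly.monic (Algebra.IsIntegral.isIntegral (R := ℂ) R')
  rw [← hR, Monic, leadingCoeff_mul, h2.leadingCoeff, leadingCoeff_C, mul_one] at h1
  rw [← hR, h1, C_1, one_mul]

end Length

/-! ### Companion matrices -/

section Companion

variable {n : ℕ}

/-- The companion matrix of the monic polynomial `X ^ n + ∑ i, b i * X ^ i`. -/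
def companion (b : Fin n → ℂ) : Mat n :=
  Matrix.of fun i j => if (j : ℕ) + 1 = n then -b i else if (i : ℕ) = j + 1 then 1 else 0

/-- The monic polynomial `X ^ n + ∑ i, b i * X ^ i`. -/
noncomputable def monicPoly (b : Fin n → ℂ) : ℂ[X] := X ^ n + ∑ i, C (b i) * X ^ (i : ℕ)

lemma degree_sum_lt (b : Fin n → ℂ) : (∑ i, C (b i) * X ^ (i : ℕ)).degree < (n : WithBot ℕ) := by
  refine (degree_sum_le _ _).trans_lt ?_
  exact (Finset.sup_lt_iff (WithBot.bot_lt_coe n)).2 fun i _ =>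
    (degree_C_mul_X_pow_le _ _).trans_lt (WithBot.coe_lt_coe.2 i.2)

lemma monic_monicPoly (b : Fin n → ℂ) : (monicPoly b).Monic :=
  monic_X_pow_add (degree_sum_lt b)

lemma natDegree_monicPoly (b : Fin n → ℂ) : (monicPoly b).natDegree = n := by
  unfold monicPoly
  rw [natDegree_add_eq_left_of_degree_lt (by rw [degree_X_pow]; exact degree_sum_lt b),
    natDegree_X_pow]

lemma monicPoly_coeff {p : ℂ[X]} (hp : p.Monic) (hn : p.natDegree = n) :
    monicPoly (fun i : Fin n => p.coeff i) = p := by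
  conv_rhs => rw [hp.as_sum, hn]
  rw [monicPoly, Fin.sum_univ_eq_sum_range (fun i => C (p.coeff i) * X ^ i)]

lemma sum_lt_eq {p : ℂ[X]} (hp : p.degree < (n : WithBot ℕ)) :
    p = ∑ i : Fin n, C (p.coeff i) * X ^ (i : ℕ) := by
  rw [Fin.sum_univ_eq_sum_range (fun i => C (p.coeff i) * X ^ i)]
  by_cases h0 : p = 0
  · simp [h0]
  · exact p.as_sum_range_C_mul_X_pow' ((natDegree_lt_iff_degree_lt h0).2 hp)

lemma aeval_sum_mulVec (R : Mat n) (v : Fin n → ℂ) (b : Fin n → ℂ) :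
    (aeval R (∑ i, C (b i) * X ^ (i : ℕ))).mulVec v =
      ∑ i : Fin n, b i • (R ^ (i : ℕ)).mulVec v := by
  simp only [map_sum, map_mul, aeval_C, map_pow, aeval_X, Matrix.sum_mulVec, ← Algebra.smul_def,
    Matrix.smul_mulVec]

lemma companion_pow_mulVec (b : Fin n → ℂ) (h0 : 0 < n) {i : ℕ} (hi : i < n) :
    (companion b ^ i).mulVec (Pi.single (⟨0, h0⟩ : Fin n) 1) = Pi.single ⟨i, hi⟩ 1 := by
  induction i with
  | zero => rw [pow_zero, Matrix.one_mulVec]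
  | succ i ih =>
    rw [pow_succ', ← Matrix.mulVec_mulVec, ih (by omega), Matrix.mulVec_single_one]
    funext j
    have : ¬ (i + 1 = n) := by omega
    simp [companion, Matrix.col, this, Pi.single_apply, Fin.ext_iff]

/-- The companion matrix has minimal polynomial of full degree. -/
theorem minpoly_companion (b : Fin n → ℂ) : minpoly ℂ (companion b) = monicPoly b := by
  have hint : IsIntegral ℂ (companion b) := Algebra.IsIntegral.isIntegral _
  rcases Nat.eq_zero_or_pos n with rfl | h0
  · have h1 : monicPoly b = 1 := by simp [monicPoly]
    rw [h1]
    exact minpoly.subsingleton ℂ _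
  set e : Fin n → ℂ := Pi.single (⟨0, h0⟩ : Fin n) 1
  have hpow : ∀ i : Fin n, (companion b ^ (i : ℕ)).mulVec e = Pi.single i 1 := fun i =>
    companion_pow_mulVec b h0 i.2
  have hz : aeval (companion b) (monicPoly b) = 0 := by
    have hv : (aeval (companion b) (monicPoly b)).mulVec e = 0 := by
      rw [monicPoly, map_add, Matrix.add_mulVec, aeval_sum_mulVec]
      simp only [hpow]
      obtain ⟨m, rfl⟩ := Nat.exists_eq_succ_of_ne_zero h0.ne'
      rw [map_pow, aeval_X, pow_succ', ← Matrix.mulVec_mulVec,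
        companion_pow_mulVec b h0 (Nat.lt_succ_self m), Matrix.mulVec_single_one]
      funext j
      simp [companion, Matrix.col, Finset.sum_apply, Pi.single_apply]
    refine Matrix.ext_of_mulVec_single fun i => ?_
    rw [← hpow i, Matrix.mulVec_mulVec, Matrix.zero_mulVec]
    have hc : Commute (aeval (companion b) (monicPoly b)) (companion b ^ (i : ℕ)) := by
      have := (Commute.all (monicPoly b) ((X : ℂ[X]) ^ (i : ℕ))).map (aeval (companion b))
      rwa [map_pow, aeval_X] at this
    rw [hc.eq, ← Matrix.mulVec_mulVec, hv, Matrix.mulVec_zero]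
  refine (eq_of_monic_of_dvd_of_natDegree_le (minpoly.monic hint) (monic_monicPoly b)
    (minpoly.dvd _ _ hz) ?_).symm
  rw [natDegree_monicPoly]
  by_contra! hlt
  have hp0 := minpoly.ne_zero hint
  have h1 := sum_lt_eq ((natDegree_lt_iff_degree_lt hp0).1 hlt)
  have h2 := congrArg (fun M : Mat n => M.mulVec e) (minpoly.aeval ℂ (companion b))
  rw [h1, aeval_sum_mulVec, Matrix.zero_mulVec] at h2
  simp only [hpow] at h2
  refine hp0 ?_
  rw [h1]
  refine Finset.sum_eq_zero fun i _ => ?_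
  have h3 := congrFun h2 i
  simp only [Finset.sum_apply, Pi.smul_apply, Pi.single_apply, smul_eq_mul, mul_ite, mul_one,
    mul_zero, Finset.sum_ite_eq, Finset.mem_univ, if_true, Pi.zero_apply] at h3
  rw [h3, C_0, zero_mul]

/-- Some vector is annihilated only by the multiples of the minimal polynomial: the vectors
annihilated by a proper divisor lie in a finite union of proper subspaces. -/
lemma exists_forall_minpoly_dvd (R : Mat n) :
    ∃ v : Fin n → ℂ, ∀ p : ℂ[X], (aeval R p).mulVec v = 0 → minpoly ℂ R ∣ p := by
  classical
  have hint : IsIntegral ℂ R := Algebra.IsIntegral.isIntegral _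
  have hμ0 := minpoly.ne_zero hint
  let K : ℂ → Submodule ℂ (Fin n → ℂ) := fun r =>
    LinearMap.ker (Matrix.toLin' (aeval R (minpoly ℂ R /ₘ (X - C r))))
  obtain ⟨v, hv⟩ : ∃ v, ∀ r ∈ (minpoly ℂ R).roots.toFinset, v ∉ K r := by
    by_contra! h
    refine Subspace.biUnion_ne_univ_of_top_notMem (s := (minpoly ℂ R).roots.toFinset.image K) ?_ ?_
    · intro htop
      obtain ⟨r, hr, hK⟩ := Finset.mem_image.1 htop
      have h1 : aeval R (minpoly ℂ R /ₘ (X - C r)) = 0 := by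
        apply Matrix.toLin'.injective
        rw [map_zero]
        exact LinearMap.ker_eq_top.1 hK
      have hr' : (minpoly ℂ R).IsRoot r := by simpa [hμ0] using hr
      have h2 := mul_divByMonic_eq_iff_isRoot.2 hr'
      have hq0 : minpoly ℂ R /ₘ (X - C r) ≠ 0 := fun h => hμ0 (by rw [← h2, h, mul_zero])
      have h3 := natDegree_le_natDegree (minpoly.degree_le_of_ne_zero ℂ R hq0 h1)
      have h4 := congrArg natDegree h2
      rw [natDegree_mul (X_sub_C_ne_zero r) hq0, natDegree_X_sub_C] at h4
      omega
    · refine Set.eq_univ_of_forall fun v => ?_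
      obtain ⟨r, hr, hv⟩ := h v
      exact Set.mem_biUnion (Finset.mem_image_of_mem K hr) hv
  refine ⟨v, fun p hp => ?_⟩
  by_contra hnd
  set g := EuclideanDomain.gcd p (minpoly ℂ R) with hg
  have hgv : (aeval R g).mulVec v = 0 := by
    rw [hg, EuclideanDomain.gcd_eq_gcd_ab, map_add, map_mul, map_mul, minpoly.aeval, zero_mul,
      add_zero, ← map_mul, mul_comm, map_mul, ← Matrix.mulVec_mulVec, hp, Matrix.mulVec_zero]
  obtain ⟨h, hh⟩ := EuclideanDomain.gcd_dvd_right p (minpoly ℂ R)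
  have hh0 : h ≠ 0 := fun h0 => hμ0 (by rw [hh, h0, mul_zero])
  have hdeg : h.degree ≠ 0 := fun h0 => hnd (by
    have hu : IsUnit h := Polynomial.isUnit_iff_degree_eq_zero.2 h0
    have hd : minpoly ℂ R ∣ g := by
      conv_lhs => rw [hh]
      rw [IsUnit.mul_right_dvd hu]
    exact hd.trans (EuclideanDomain.gcd_dvd_left p _))
  obtain ⟨r, hr⟩ := IsAlgClosed.exists_root h hdeg
  obtain ⟨h', rfl⟩ := dvd_iff_isRoot.2 hr
  have hroot : (minpoly ℂ R).IsRoot r :=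
    dvd_iff_isRoot.1 ⟨g * h', by rw [hh, ← hg]; ring⟩
  refine hv r (by simpa [hμ0] using hroot) ?_
  have hq : minpoly ℂ R /ₘ (X - C r) = h' * g := by
    have h1 := mul_divByMonic_eq_iff_isRoot.2 hroot
    refine mul_left_cancel₀ (X_sub_C_ne_zero r) ?_
    rw [h1]
    conv_lhs => rw [hh, ← hg]
    ring
  rw [LinearMap.mem_ker, Matrix.toLin'_apply, hq, map_mul, ← Matrix.mulVec_mulVec, hgv,
    Matrix.mulVec_zero]

/-- A matrix with minimal polynomial of full degree is conjugate to its companion matrix. -/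
theorem exists_eq_conjHom_companion {R : Mat n} (hR : (minpoly ℂ R).natDegree = n) :
    ∃ g : (Mat n)ˣ, R = conjHom g (companion fun i => (minpoly ℂ R).coeff i) := by
  have hint : IsIntegral ℂ R := Algebra.IsIntegral.isIntegral _
  obtain ⟨v, hv⟩ := exists_forall_minpoly_dvd R
  set P : Mat n := Matrix.of fun i j => (R ^ (j : ℕ)).mulVec v i with hP
  have hcol : ∀ j, P.col j = (R ^ (j : ℕ)).mulVec v := fun j => rfl
  have hli : LinearIndependent ℂ P.col := by
    rw [Fintype.linearIndependent_iff]
    intro b hb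
    simp only [hcol] at hb
    rw [← aeval_sum_mulVec] at hb
    have h1 := hv _ hb
    have h2 : (∑ i, C (b i) * X ^ (i : ℕ)) = 0 := by
      by_contra hne
      have h3 := natDegree_le_of_dvd h1 hne
      have h4 := (natDegree_lt_iff_degree_lt hne).2 (degree_sum_lt b)
      omega
    intro i
    have h3 := congrArg (fun p => coeff p (i : ℕ)) h2
    simp only [finsetSum_coeff, coeff_C_mul, coeff_X_pow, coeff_zero] at h3
    rw [Finset.sum_eq_single i] at h3
    · simpa using h3
    · intro j _ hj
      rw [if_neg (fun h => hj (Fin.ext h.symm)), mul_zero]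
    · exact fun h => absurd (Finset.mem_univ i) h
  obtain ⟨g, hg⟩ := Matrix.linearIndependent_cols_iff_isUnit.1 hli
  have hRP : R * P = P * companion fun i => (minpoly ℂ R).coeff i := by
    refine Matrix.ext_of_mulVec_single fun j => ?_
    rw [← Matrix.mulVec_mulVec, ← Matrix.mulVec_mulVec, Matrix.mulVec_single_one, hcol,
      Matrix.mulVec_single_one, Matrix.mulVec_mulVec, ← pow_succ']
    by_cases hj : (j : ℕ) + 1 = n
    · have h1 : (companion fun i : Fin n => (minpoly ℂ R).coeff i).col j =
          fun i : Fin n => -(minpoly ℂ R).coeff i := by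
        funext i
        simp [companion, Matrix.col, hj]
      rw [h1, hj]
      have h2 := minpoly.aeval ℂ R
      rw [← monicPoly_coeff (minpoly.monic hint) hR, monicPoly, map_add, map_pow, aeval_X] at h2
      have h3 := congrArg (fun M : Mat n => M.mulVec v) h2
      simp only [Matrix.add_mulVec, Matrix.zero_mulVec] at h3
      rw [aeval_sum_mulVec] at h3
      rw [eq_neg_of_add_eq_zero_left h3, Matrix.mulVec_eq_sum, ← Finset.sum_neg_distrib]
      refine Finset.sum_congr rfl fun i _ => ?_
      funext k
      simp [hP, mul_comm]
    · have hj' : (j : ℕ) + 1 < n := by omega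
      have h1 : (companion fun i : Fin n => (minpoly ℂ R).coeff i).col j =
          Pi.single ⟨j + 1, hj'⟩ 1 := by
        funext i
        simp [companion, Matrix.col, hj, Pi.single_apply, Fin.ext_iff]
      rw [h1, Matrix.mulVec_single_one, hcol]
  refine ⟨g, ?_⟩
  rw [conjHom_apply, hg, ← hRP, ← hg, mul_assoc, Units.mul_inv, mul_one]

/-- Morphisms with the same image of length `n` are conjugate. -/
theorem mk_eq_of_image_eq {φ ψ : Mor n} (h : φ.image = ψ.image) (hn : φ.image.HasLength n) :
    (⟦φ⟧ : MapSpace n) = ⟦ψ⟧ := by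
  obtain ⟨S, hS⟩ := exists_eq_affineMor φ
  obtain ⟨S', hS'⟩ := exists_eq_affineMor ψ
  obtain ⟨c, hc⟩ := Infinite.exists_notMem_finset (S ∪ S')
  rw [Finset.mem_union, not_or] at hc
  obtain ⟨R, rfl⟩ := hS c hc.1
  obtain ⟨R', rfl⟩ := hS' c hc.2
  have hmin := minpoly_eq_of_image_eq h
  rw [hasLength_image_affineMor] at hn
  obtain ⟨g, hg⟩ := exists_eq_conjHom_companion hn
  obtain ⟨g', hg'⟩ := exists_eq_conjHom_companion (hmin ▸ hn)
  rw [hg, hg', mk_affineMor_conjHom, mk_affineMor_conjHom, hmin]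

/-- The affine coordinate at `c` of the cyclic module over the zero scheme of a binary form. -/
noncomputable def formMatrix (c : ℂ) (a : Fin (n + 1) → ℂ) : Mat n :=
  companion fun i => ((form₀ a).eval c)⁻¹ * (affForm c n (form₀ a)).coeff i

lemma minpoly_formMatrix {c : ℂ} {a : Fin (n + 1) → ℂ} (hc : (form₀ a).eval c ≠ 0) :
    minpoly ℂ (formMatrix c a) = C ((form₀ a).eval c)⁻¹ * affForm c n (form₀ a) := by
  have hdeg := natDegree_affForm_le c (natDegree_form₀_le a)
  have hlead : (affForm c n (form₀ a)).coeff n = (form₀ a).eval c := by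
    rw [affForm, coeff_reflect, revAt_le le_rfl, Nat.sub_self, coeff_zero_eq_eval_zero, eval_comp]
    simp
  have hdeg' : (C ((form₀ a).eval c)⁻¹ * affForm c n (form₀ a)).natDegree = n := by
    rw [natDegree_C_mul (inv_ne_zero hc)]
    exact natDegree_eq_of_le_of_coeff_ne_zero hdeg (by rwa [hlead])
  have hmonic : (C ((form₀ a).eval c)⁻¹ * affForm c n (form₀ a)).Monic := by
    rw [Monic, leadingCoeff, hdeg', coeff_C_mul, hlead, inv_mul_cancel₀ hc]
  rw [formMatrix, minpoly_companion, ← monicPoly_coeff hmonic hdeg']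
  simp only [coeff_C_mul]

lemma image_formMatrix {c : ℂ} {a : Fin (n + 1) → ℂ} (hc : (form₀ a).eval c ≠ 0) :
    (affineMor c (formMatrix c a)).image = zeroScheme n a := by
  have h := minpoly_formMatrix hc
  have h1 : affForm c n (form₀ a) = C ((form₀ a).eval c) * minpoly ℂ (formMatrix c a) := by
    rw [h, ← mul_assoc, ← C_mul, mul_inv_cancel₀ hc, C_1, one_mul]
  refine image_affineMor c hc h1 ?_
  rw [formMatrix, minpoly_companion, natDegree_monicPoly]

lemma exists_eval_form₀_ne_zero {a : Fin (n + 1) → ℂ} (ha : a ≠ 0) :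
    ∃ c, (form₀ a).eval c ≠ 0 := by
  by_contra! h
  exact form₀_ne_zero ha (Polynomial.funext fun x => by rw [h x, eval_zero])

lemma exists_image_eq {Z : ClosedSubscheme} (hZ : Z.HasLength n) : ∃ φ : Mor n, φ.image = Z := by
  obtain ⟨a, ha, rfl⟩ := exists_eq_zeroScheme_of_hasLength hZ
  obtain ⟨c, hc⟩ := exists_eval_form₀_ne_zero ha
  exact ⟨_, image_formMatrix hc⟩

end Companion

/-! ### The cycle of a morphism -/

section Cycle

variable {n : ℕ}

lemma exists_fin_map_eq {α : Type*} {s : Multiset α} {n : ℕ} (hs : s.card = n) :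
    ∃ x : Fin n → α, (Finset.univ.val.map x : Multiset α) = s := by
  subst hs
  induction s using Quotient.inductionOn with
  | h l => exact ⟨l.get, by
      change ((Finset.univ : Finset (Fin l.length)).val.map l.get) = (l : Multiset α)
      rw [Fin.univ_val_map, List.ofFn_get]⟩

lemma ofPoints_surjective : Function.Surjective (SymP1.ofPoints (n := n)) := by
  intro s
  obtain ⟨x, hx⟩ := exists_fin_map_eq (s := Subtype.val (show Sym P1 n from s))
    (Subtype.property (show Sym P1 n from s))
  exact ⟨x, Subtype.ext hx⟩

lemma symP1_ext {s t : SymP1 n} (h : ∀ p, s.mult p = t.mult p) : s = t := by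
  classical
  refine Subtype.ext (Multiset.ext.2 fun p => ?_)
  have := h p
  unfold SymP1.mult at this
  convert this

/-- The polynomial on `U₀` with a simple zero at a given point, and no other zeros. -/
noncomputable def pointPoly (p : P1) : ℂ[X] := p.elim 1 fun a => X - C a

/-- The polynomial on `U₀` with a given cycle of zeros. -/
noncomputable def cyclePoly (s : SymP1 n) : ℂ[X] := ((show Sym P1 n from s).1.map pointPoly).prod

lemma cyclePoly_ofPoints (p : Fin n → P1) :
    cyclePoly (SymP1.ofPoints p) = ∏ i, pointPoly (p i) := by
  change (Multiset.map pointPoly (Finset.univ.val.map p)).prod = _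
  rw [Multiset.map_map]
  rfl

lemma mult_ofPoints (p : Fin n → P1) (q : P1) [DecidablePred fun i => p i = q] :
    (SymP1.ofPoints p).mult q = (Finset.univ.filter fun i => p i = q).card := by
  classical
  change Multiset.count q (Finset.univ.val.map p) = _
  rw [Multiset.count_map, Finset.card_def, Finset.filter_val]
  congr 1
  exact Multiset.filter_congr fun i _ => eq_comm

lemma monic_pointPoly (p : P1) : (pointPoly p).Monic := by
  induction p using OnePoint.rec with
  | infty => exact monic_one
  | coe a => exact monic_X_sub_C a

lemma pointPoly_infty : pointPoly OnePoint.infty = 1 := rfl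

lemma pointPoly_coe (a : ℂ) : pointPoly (a : P1) = X - C a := rfl

lemma natDegree_pointPoly_le (p : P1) : (pointPoly p).natDegree ≤ 1 := by
  induction p using OnePoint.rec with
  | infty => rw [pointPoly_infty, natDegree_one]; exact zero_le_one
  | coe a => rw [pointPoly_coe, natDegree_X_sub_C]

lemma monic_cyclePoly (s : SymP1 n) : (cyclePoly s).Monic := by
  obtain ⟨p, rfl⟩ := ofPoints_surjective s
  rw [cyclePoly_ofPoints]
  exact monic_prod_of_monic _ _ fun i _ => monic_pointPoly _

lemma natDegree_cyclePoly_add (s : SymP1 n) :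
    (cyclePoly s).natDegree + s.mult OnePoint.infty = n := by
  classical
  obtain ⟨p, rfl⟩ := ofPoints_surjective s
  rw [cyclePoly_ofPoints, natDegree_prod_of_monic _ _ fun i _ => monic_pointPoly _, mult_ofPoints,
    Finset.card_filter, ← Finset.sum_add_distrib]
  have : ∀ i, (pointPoly (p i)).natDegree + (if p i = OnePoint.infty then 1 else 0) = 1 := by
    intro i
    induction p i using OnePoint.rec with
    | infty => simp [pointPoly_infty]
    | coe a => simp [pointPoly_coe]
  simp [this]

lemma natDegree_cyclePoly_le (s : SymP1 n) : (cyclePoly s).natDegree ≤ n :=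
  Nat.le.intro (natDegree_cyclePoly_add s)

lemma rootMultiplicity_cyclePoly (s : SymP1 n) (a : ℂ) :
    (cyclePoly s).rootMultiplicity a = s.mult (a : P1) := by
  classical
  obtain ⟨p, rfl⟩ := ofPoints_surjective s
  have h0 : ∏ i, pointPoly (p i) ≠ 0 :=
    (monic_prod_of_monic _ _ fun i _ => monic_pointPoly (p i)).ne_zero
  rw [cyclePoly_ofPoints, mult_ofPoints, ← count_roots, roots_prod _ _ h0, Multiset.count_bind,
    Finset.card_filter]
  change ∑ i, _ = _
  refine Finset.sum_congr rfl fun i _ => ?_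
  induction p i using OnePoint.rec with
  | infty => simp [pointPoly_infty]
  | coe b =>
    rw [pointPoly_coe, roots_X_sub_C, Multiset.count_singleton]
    simp [eq_comm]

lemma cyclePoly_injective : Function.Injective (cyclePoly (n := n)) := by
  intro s t h
  refine symP1_ext fun p => ?_
  induction p using OnePoint.rec with
  | infty =>
    have h1 := natDegree_cyclePoly_add s
    have h2 := natDegree_cyclePoly_add t
    rw [h] at h1
    omega
  | coe a => rw [← rootMultiplicity_cyclePoly, ← rootMultiplicity_cyclePoly, h]

/-- The coefficients of the binary form of degree `n` that vanishes on a cycle. -/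
noncomputable def cycleForm (s : SymP1 n) : Fin (n + 1) → ℂ := fun i => (cyclePoly s).coeff i

lemma form₀_cycleForm (s : SymP1 n) : form₀ (cycleForm s) = cyclePoly s :=
  form₀_coeff (natDegree_cyclePoly_le s)

lemma cycleForm_ne_zero (s : SymP1 n) : cycleForm s ≠ 0 := fun h => by
  have h1 := form₀_cycleForm s
  rw [h] at h1
  refine (monic_cyclePoly s).ne_zero ?_
  rw [← h1]
  simp [form₀]

/-- The cycle of the eigenvalues of a matrix, as values of the coordinate `1 / (y₀ - c)`. -/
noncomputable def affCycle (c : ℂ) (R : Mat n) : SymP1 n :=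
  Sym.mk (R.charpoly.roots.map (affPoint c)) (by
    rw [Multiset.card_map, ← (IsAlgClosed.splits R.charpoly).natDegree_eq_card_roots,
      Matrix.charpoly_natDegree_eq_dim, Fintype.card_fin])

lemma mult_affCycle (c : ℂ) (R : Mat n) (p : P1) :
    (affCycle c R).mult p = Module.finrank ℂ ((affineMor c R).chanPaton p) := by
  classical
  have e : (affCycle c R).mult p = Multiset.count p (R.charpoly.roots.map (affPoint c)) := by
    unfold SymP1.mult affCycle
    congr
  rw [e]
  by_cases hp : p = (c : P1)
  · rw [hp, chanPaton_affineMor_self, finrank_bot, Multiset.count_eq_zero]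
    intro h
    obtain ⟨z, -, hz⟩ := Multiset.mem_map.1 h
    exact affPoint_ne c z hz
  · rw [← affPoint_affCoord hp, chanPaton_affineMor, finrank_maxGenEigenspace_toLin',
      Multiset.count_map_eq_count' _ _ (affPoint_injective c), count_roots]

lemma exists_mult_eq (φ : Mor n) :
    ∃ s : SymP1 n, ∀ p, s.mult p = Module.finrank ℂ (φ.chanPaton p) := by
  obtain ⟨S, hS⟩ := exists_eq_affineMor φ
  obtain ⟨c, hc⟩ := Infinite.exists_notMem_finset S
  obtain ⟨R, rfl⟩ := hS c hc
  exact ⟨_, mult_affCycle c R⟩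

/-- The cycle `∑ p, dim V_p · p` of a morphism. -/
noncomputable def morCycle (φ : Mor n) : SymP1 n := (exists_mult_eq φ).choose

lemma mult_morCycle (φ : Mor n) (p : P1) :
    (morCycle φ).mult p = Module.finrank ℂ (φ.chanPaton p) := (exists_mult_eq φ).choose_spec p

lemma morCycle_affineMor (c : ℂ) (R : Mat n) : morCycle (affineMor c R) = affCycle c R :=
  symP1_ext fun p => by rw [mult_morCycle, mult_affCycle]

/-- The map to the Chow variety. -/
noncomputable def mapCycle : MapSpace n → SymP1 n :=
  Quotient.lift morCycle fun _ _ h => symP1_ext fun p => by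
    rw [mult_morCycle, mult_morCycle, finrank_chanPaton_eq_of_conj h]

lemma mapCycle_mk (φ : Mor n) : mapCycle ⟦φ⟧ = morCycle φ := rfl

lemma affForm_pointPoly (c z : ℂ) :
    ∃ t : ℂ, t ≠ 0 ∧ affForm c 1 (pointPoly (affPoint c z)) = C t * (X - C z) := by
  unfold affPoint
  split_ifs with h
  · refine ⟨1, one_ne_zero, ?_⟩
    rw [pointPoly_infty, affForm_one, h]
    simp
  · refine ⟨-z⁻¹, neg_ne_zero.2 (inv_ne_zero h), ?_⟩
    have h1 : (X - C (c + z⁻¹) : ℂ[X]) = X + C (-(c + z⁻¹)) * 1 := by rw [C_neg]; ring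
    have h2 : C z⁻¹ * C z = (1 : ℂ[X]) := by rw [← C_mul, inv_mul_cancel₀ h, C_1]
    rw [pointPoly_coe, h1, affForm_add, affForm_X, affForm_C_mul, affForm_one, C_neg, C_neg, C_add]
    linear_combination -h2

lemma affForm_cycleForm (c : ℂ) (R : Mat n) :
    ∃ t : ℂ, t ≠ 0 ∧ affForm c n (form₀ (cycleForm (affCycle c R))) = C t * R.charpoly := by
  rw [form₀_cycleForm]
  have hsplit := (IsAlgClosed.splits R.charpoly).eq_prod_roots_of_monic R.charpoly_monic
  have hcard : R.charpoly.roots.card = n := by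
    rw [← (IsAlgClosed.splits R.charpoly).natDegree_eq_card_roots,
      Matrix.charpoly_natDegree_eq_dim, Fintype.card_fin]
  have e : cyclePoly (affCycle c R) =
      ((R.charpoly.roots.map (affPoint c)).map pointPoly).prod := rfl
  rw [e, Multiset.map_map]
  suffices ∀ s : Multiset ℂ, ∃ t : ℂ, t ≠ 0 ∧
      affForm c s.card (s.map (pointPoly ∘ affPoint c)).prod =
        C t * (s.map fun z => X - C z).prod by
    obtain ⟨t, ht, h⟩ := this R.charpoly.roots
    rw [hcard] at h
    refine ⟨t, ht, ?_⟩
    conv_rhs => rw [hsplit]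
    exact h
  intro s
  induction s using Multiset.induction_on with
  | empty => exact ⟨1, one_ne_zero, by simp [affForm_one]⟩
  | cons z s ih =>
    obtain ⟨t, ht, h⟩ := ih
    obtain ⟨u, hu, h'⟩ := affForm_pointPoly c z
    refine ⟨u * t, mul_ne_zero hu ht, ?_⟩
    have hdeg : (s.map (pointPoly ∘ affPoint c)).prod.natDegree ≤ s.card := by
      refine (natDegree_multiset_prod_le _).trans ?_
      rw [Multiset.map_map]
      refine (Multiset.sum_le_card_nsmul _ 1 ?_).trans (by simp)
      intro x hx
      obtain ⟨w, -, rfl⟩ := Multiset.mem_map.1 hx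
      exact natDegree_pointPoly_le _
    rw [Multiset.card_cons, Multiset.map_cons, Multiset.prod_cons, Multiset.map_cons,
      Multiset.prod_cons, add_comm s.card 1, Function.comp_apply,
      affForm_mul c (natDegree_pointPoly_le _) hdeg, h, h', C_mul]
    ring

/-- An image of length `n` is recovered from the cycle of the morphism. -/
lemma image_eq_zeroScheme_cycleForm {φ : Mor n} (h : φ.image.HasLength n) :
    zeroScheme n (cycleForm (morCycle φ)) = φ.image := by
  obtain ⟨S, hS⟩ := exists_eq_affineMor φ
  obtain ⟨c, hc⟩ := Infinite.exists_notMem_finset S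
  obtain ⟨R, rfl⟩ := hS c hc
  rw [hasLength_image_affineMor] at h
  obtain ⟨t, ht, htR⟩ := affForm_cycleForm c R
  have hmin : minpoly ℂ R = R.charpoly := by
    refine (eq_of_monic_of_dvd_of_natDegree_le
      (minpoly.monic (Algebra.IsIntegral.isIntegral (R := ℂ) R)) R.charpoly_monic
      (Matrix.minpoly_dvd_charpoly R) ?_).symm
    rw [h, Matrix.charpoly_natDegree_eq_dim, Fintype.card_fin]
  rw [morCycle_affineMor, image_affineMor c ht (by rw [htR, hmin]) h]

/-! ### The characteristic polynomial of a chart -/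

lemma maxGenEigenspace_le_range (φ : RingSetHom n) {a : ℂ} (ha : a ≠ 0) :
    Module.End.maxGenEigenspace (Matrix.toLin' (φ X)) a ≤
      LinearMap.range (Matrix.toLin' (φ 1)) := by
  intro v hv
  rw [mem_maxGenEigenspace_toLin'] at hv
  rw [mem_range_toLin'_of_idem (one_mul_ringSetHom φ 1)]
  obtain ⟨k, hk⟩ := hv
  have h1 : ∀ k : ℕ, (1 - φ 1) * (φ X - algebraMap ℂ (Mat n) a) ^ k = (-a) ^ k • (1 - φ 1) := by
    intro k
    induction k with
    | zero => simp
    | succ k ih =>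
      have h2 : (1 - φ 1) * (φ X - algebraMap ℂ (Mat n) a) = (-a) • (1 - φ 1) := by
        rw [mul_sub, sub_mul, one_mul, one_mul_ringSetHom, sub_self, zero_sub,
          Algebra.algebraMap_eq_smul_one, mul_smul_comm, mul_one, neg_smul]
      rw [pow_succ, ← mul_assoc, ih, smul_mul_assoc, h2, smul_smul, ← pow_succ]
  have h3 := congrArg (fun M : Mat n => M.mulVec v) (h1 k)
  simp only [← Matrix.mulVec_mulVec, hk, Matrix.mulVec_zero, Matrix.smul_mulVec] at h3
  have h4 := (smul_eq_zero.1 h3.symm).resolve_left (pow_ne_zero _ (neg_ne_zero.2 ha))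
  rw [Matrix.sub_mulVec, Matrix.one_mulVec, sub_eq_zero] at h4
  exact h4.symm

lemma finrank_chanPaton_coe (φ : Mor n) {a : ℂ} (ha : a ≠ 0) :
    Module.finrank ℂ (φ.chanPaton (a : P1)) = (φ.φ₀ X).charpoly.rootMultiplicity a := by
  rw [← finrank_maxGenEigenspace_toLin']
  change Module.finrank ℂ (LinearMap.range (Matrix.toLin' (φ.φ₀ 1)) ⊓
    Module.End.maxGenEigenspace (Matrix.toLin' (φ.φ₀ X)) a : Submodule ℂ (Fin n → ℂ)) = _
  rw [inf_eq_right.2 (maxGenEigenspace_le_range φ.φ₀ ha)]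

lemma rank_add_finrank_chanPaton_infty (φ : Mor n) :
    (φ.φ₀ 1).rank + Module.finrank ℂ (φ.chanPaton OnePoint.infty) = n := by
  obtain ⟨S, hS⟩ := exists_eq_affineMor φ
  obtain ⟨c, hc⟩ := Infinite.exists_notMem_finset S
  obtain ⟨R, rfl⟩ := hS c hc
  have hD := isDrazin_drazin R
  have h1 : (affineMor c R).φ₀ 1 = R * drazin R := by
    rw [affineMor_apply₀ hD, map_one, mul_one]
  have hker : LinearMap.ker (Matrix.toLin' (R * drazin R)) =
      Module.End.maxGenEigenspace (Matrix.toLin' R) 0 := by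
    ext v
    rw [LinearMap.mem_ker, Matrix.toLin'_apply, mem_maxGenEigenspace_toLin', map_zero, sub_zero]
    constructor
    · intro hv
      obtain ⟨k, hk⟩ := hD.pow
      exact ⟨k, by rw [← hk, pow_succ, mul_assoc, ← Matrix.mulVec_mulVec, hv, Matrix.mulVec_zero]⟩
    · rintro ⟨k, hk⟩
      rw [hD.mul_eq_pow k, (hD.comm.pow_pow _ _).eq, pow_succ' R, ← mul_assoc,
        ← Matrix.mulVec_mulVec, hk, Matrix.mulVec_zero]
  have h2 := LinearMap.finrank_range_add_finrank_ker (Matrix.toLin' (R * drazin R))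
  rw [hker, Module.finrank_fin_fun] at h2
  rw [chanPaton_affineMor_infty, h1, Matrix.rank, ← Matrix.toLin'_apply']
  exact h2

lemma charpoly_eq_X_pow_mul_cyclePoly (φ : Mor n) :
    (φ.φ₀ X).charpoly = X ^ (n - (φ.φ₀ 1).rank) * cyclePoly (morCycle φ) := by
  have h1 := rank_add_finrank_chanPaton_infty φ
  have h2 := natDegree_cyclePoly_add (morCycle φ)
  rw [mult_morCycle] at h2
  set p := (φ.φ₀ X).charpoly with hp
  set q := X ^ (n - (φ.φ₀ 1).rank) * cyclePoly (morCycle φ) with hq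
  have hpm : p.Monic := Matrix.charpoly_monic _
  have hqm : q.Monic := (monic_X_pow _).mul (monic_cyclePoly _)
  have hpd : p.natDegree = n := by rw [hp, Matrix.charpoly_natDegree_eq_dim, Fintype.card_fin]
  have hqd : q.natDegree = n := by
    rw [hq, (monic_X_pow _).natDegree_mul (monic_cyclePoly _), natDegree_X_pow]
    omega
  have hne : ∀ a, a ≠ 0 → p.roots.count a = q.roots.count a := by
    intro a ha
    rw [count_roots, count_roots, hq, rootMultiplicity_mul hqm.ne_zero, rootMultiplicity_cyclePoly,
      mult_morCycle, finrank_chanPaton_coe φ ha, ← hp]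
    have : ((X : ℂ[X]) ^ (n - (φ.φ₀ 1).rank)).rootMultiplicity a = 0 := by
      refine rootMultiplicity_eq_zero ?_
      simp [IsRoot, ha]
    rw [this, zero_add]
  have hcard : p.roots.card = q.roots.card := by
    rw [← (IsAlgClosed.splits p).natDegree_eq_card_roots,
      ← (IsAlgClosed.splits q).natDegree_eq_card_roots, hpd, hqd]
  have hroots : p.roots = q.roots := by
    refine Multiset.ext.2 fun a => ?_
    by_cases ha : a = 0
    · have hf : p.roots.filter (fun x : ℂ => x ≠ 0) = q.roots.filter (fun x : ℂ => x ≠ 0) := by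
        refine Multiset.ext.2 fun b => ?_
        by_cases hb : b = 0
        · rw [Multiset.count_filter_of_neg (by simp [hb]),
            Multiset.count_filter_of_neg (by simp [hb])]
        · rw [Multiset.count_filter_of_pos (p := fun x : ℂ => x ≠ 0) hb,
            Multiset.count_filter_of_pos (p := fun x : ℂ => x ≠ 0) hb, hne b hb]
      have e : ∀ s : Multiset ℂ, s.count 0 + (s.filter fun x : ℂ => x ≠ 0).card = s.card := by
        intro s
        induction s using Multiset.induction_on with
        | empty => simp
        | cons b s ih =>
          by_cases hb : b = 0
          · simp only [hb, Multiset.count_cons_self, ne_eq, not_true_eq_false, not_false_eq_true,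
              Multiset.filter_cons_of_neg, Multiset.card_cons] at ih ⊢
            omega
          · simp only [Multiset.count_cons_of_ne (Ne.symm hb), ne_eq, hb, not_false_eq_true,
              Multiset.filter_cons_of_pos, Multiset.card_cons] at ih ⊢
            omega
      have e1 := e p.roots
      have e2 := e q.roots
      rw [hf, hcard, ← e2] at e1
      rw [ha]
      exact Nat.add_right_cancel e1
    · exact hne a ha
  rw [(IsAlgClosed.splits p).eq_prod_roots_of_monic hpm, hroots,
    ← (IsAlgClosed.splits q).eq_prod_roots_of_monic hqm]

end Cycle

/-! ### Idempotents near a given one -/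

section NearIdempotent

/-- Elements near `1` have square roots near `1`: up to the factor `1 / 2`, the derivative of the
square at `1` is the identity, so that the inverse function theorem applies. -/
lemma exists_sq_eq {A : Type*} [NormedRing A] [NormedAlgebra ℂ A] [CompleteSpace A] {ε : ℝ}
    (h0 : 0 ≤ ε) (h1 : ε ≤ 1 / 2) {z : A} (hz : ‖z - 1‖ ≤ ε) :
    ∃ s : A, s * s = z ∧ ‖s - 1‖ ≤ ε := by
  lift ε to NNReal using h0
  have hf : ApproximatesLinearOn (fun s : A => (1 / 2 : ℂ) • (s * s))
      (ContinuousLinearMap.id ℂ A) (Metric.closedBall 1 ε) ε := by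
    refine fun x hx y hy => ?_
    rw [Metric.mem_closedBall, dist_eq_norm] at hx hy
    have e : (1 / 2 : ℂ) • (x * x) - (1 / 2 : ℂ) • (y * y) - ContinuousLinearMap.id ℂ A (x - y) =
        (1 / 2 : ℂ) • ((x - 1) * (x - y) + (x - y) * (y - 1)) := by
      have : ContinuousLinearMap.id ℂ A (x - y) = (1 / 2 : ℂ) • ((2 : ℂ) • (x - y)) := by
        rw [smul_smul]; norm_num
      rw [this, ← smul_sub, ← smul_sub]
      congr 1
      rw [two_smul]
      noncomm_ring
    rw [e, norm_smul]
    have h2 := norm_add_le ((x - 1) * (x - y)) ((x - y) * (y - 1))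
    have h3 := norm_mul_le (x - 1) (x - y)
    have h4 := norm_mul_le (x - y) (y - 1)
    have h5 := mul_le_mul_of_nonneg_right hx (norm_nonneg (x - y))
    have h6 := mul_le_mul_of_nonneg_left hy (norm_nonneg (x - y))
    have h7 : ‖(1 / 2 : ℂ)‖ = 1 / 2 := by norm_num
    rw [h7]
    linarith
  have hs := hf.surjOn_closedBall_of_nonlinearRightInverse
    ⟨id, 1, fun y => by simp, fun y => rfl⟩ ε.2 subset_rfl
  obtain ⟨s, hs1, hs2⟩ := hs (show (1 / 2 : ℂ) • z ∈ _ by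
    rw [Metric.mem_closedBall, dist_eq_norm, mul_one, ← smul_sub, norm_smul]
    have h7 : ‖(1 / 2 : ℂ)‖ = 1 / 2 := by norm_num
    rw [h7]
    simp only [NNReal.coe_one, inv_one]
    have h9 := mul_nonneg ε.coe_nonneg (sub_nonneg.2 h1)
    have h10 : (1 - (ε : ℝ)) * ε = (ε : ℝ) * (1 / 2 - ε) + 1 / 2 * ε := by ring
    change 1 / 2 * ‖z - 1‖ ≤ (1 - (ε : ℝ)) * ε
    rw [h10]
    linarith)
  refine ⟨s, ?_, by rwa [Metric.mem_closedBall, dist_eq_norm] at hs1⟩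
  have h8 := congrArg (fun x : A => (2 : ℂ) • x) hs2
  simpa [smul_smul] using h8

/-- An approximate idempotent `x` is near an idempotent `e`, namely the one for which `2 e - 1` is
the quotient of `2 x - 1` by the square root near `1` of its square. -/
lemma exists_idempotent_near {A : Type*} [NormedCommRing A] [NormedAlgebra ℂ A] [CompleteSpace A]
    {ε : ℝ} (h0 : 0 ≤ ε) (h1 : ε ≤ 1 / 2) {x : A} (hx : ‖(2 * x - 1) * (2 * x - 1) - 1‖ ≤ ε) :
    ∃ e : A, e * e = e ∧ ‖e - x‖ ≤ ε * ‖2 * x - 1‖ := by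
  obtain ⟨s, hs, hs1⟩ := exists_sq_eq h0 h1 hx
  have hu : IsUnit s := by
    have h2 : ‖1 - s‖ < 1 := by rw [norm_sub_rev]; linarith
    have := isUnit_one_sub_of_norm_lt_one h2
    rwa [sub_sub_cancel] at this
  obtain ⟨t, ht⟩ := hu.exists_right_inv
  have hu2 : IsUnit (2 : A) := by
    have := (IsUnit.mk0 (2 : ℂ) two_ne_zero).map (algebraMap ℂ A)
    rwa [map_ofNat] at this
  obtain ⟨w, hw⟩ := hu2.exists_right_inv
  set u := (2 * x - 1) * t with hu
  have huu : u * u = 1 := by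
    rw [hu]
    linear_combination (-t * t) * hs + (s * t + 1) * ht
  refine ⟨w * (1 + u), ?_, ?_⟩
  · linear_combination (w * w) * huu + (w * (1 + u)) * hw
  · have hd : (2 : ℂ) • (w * (1 + u) - x) = u * (1 - s) := by
      rw [two_smul, hu]
      linear_combination (1 + (2 * x - 1) * t) * hw + (2 * x - 1) * ht
    have hn : 2 * ‖w * (1 + u) - x‖ ≤ ‖u‖ * ε := by
      have := congrArg norm hd
      rw [norm_smul, Complex.norm_ofNat] at this
      rw [this]
      refine (norm_mul_le _ _).trans ?_
      rw [norm_sub_rev 1 s]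
      exact mul_le_mul_of_nonneg_left hs1 (norm_nonneg _)
    have hus : u = (2 * x - 1) + u * (1 - s) := by
      rw [hu]
      linear_combination (2 * x - 1) * ht
    have hun : ‖u‖ ≤ ‖2 * x - 1‖ + ‖u‖ * ε := by
      calc ‖u‖ = ‖(2 * x - 1) + u * (1 - s)‖ := by rw [← hus]
        _ ≤ ‖2 * x - 1‖ + ‖u * (1 - s)‖ := norm_add_le _ _
        _ ≤ ‖2 * x - 1‖ + ‖u‖ * ε := by
          refine add_le_add le_rfl ((norm_mul_le _ _).trans ?_)
          rw [norm_sub_rev 1 s]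
          exact mul_le_mul_of_nonneg_left hs1 (norm_nonneg _)
    have hu2 : ‖u‖ ≤ 2 * ‖2 * x - 1‖ := by
      have := mul_le_mul_of_nonneg_left h1 (norm_nonneg u)
      linarith
    have := mul_le_mul_of_nonneg_right hu2 h0
    linarith

end NearIdempotent

section FiniteDimensionalNormed

variable {M : Type*} [NormedRing M] [NormedAlgebra ℂ M]

lemma continuous_aeval_left (p : ℂ[X]) : Continuous fun B : M => aeval B p := by
  simp only [aeval_eq_sum_range]
  fun_prop

open scoped IsMulCommutative in
/-- The spectral idempotents of an element of a finite-dimensional algebra deform continuously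
to nearby elements. -/
lemma eventually_exists_idempotent [FiniteDimensional ℂ M] {B₀ e₀ : M} {p : ℂ[X]}
    (hp : aeval B₀ p = e₀) (he : e₀ * e₀ = e₀) {V : Set M} (hV : V ∈ nhds e₀) :
    ∀ᶠ B in nhds B₀, ∃ q : ℂ[X], aeval B q * aeval B q = aeval B q ∧ aeval B q ∈ V := by
  obtain ⟨η, hη, hV⟩ := Metric.mem_nhds_iff.1 hV
  set K := ‖2 * e₀ - 1‖ + 1 with hK
  have hK0 : 0 < K := by positivity
  set ε := min (1 / 2) (η / (2 * K)) with hε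
  have hε0 : 0 < ε := by positivity
  have hc := continuous_aeval_left (M := M) p
  have ev1 : ∀ᶠ B in nhds B₀, ‖(2 * aeval B p - 1) * (2 * aeval B p - 1) - 1‖ < ε := by
    have h1 : Continuous fun B : M =>
        ‖(2 * aeval B p - 1) * (2 * aeval B p - 1) - 1‖ := by fun_prop
    refine h1.continuousAt.eventually_lt_const ?_
    have : (2 * e₀ - 1) * (2 * e₀ - 1) - 1 = 4 * (e₀ * e₀ - e₀) := by noncomm_ring
    beta_reduce
    rw [hp, this, he, sub_self, mul_zero, norm_zero]
    exact hε0
  have ev2 : ∀ᶠ B in nhds B₀, ‖2 * aeval B p - 1‖ < K := by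
    have h1 : Continuous fun B : M => ‖2 * aeval B p - 1‖ := by fun_prop
    refine h1.continuousAt.eventually_lt_const ?_
    beta_reduce
    rw [hp, hK]
    exact lt_add_one _
  have ev3 : ∀ᶠ B in nhds B₀, ‖aeval B p - e₀‖ < η / 2 := by
    have h1 : Continuous fun B : M => ‖aeval B p - e₀‖ := by fun_prop
    refine h1.continuousAt.eventually_lt_const ?_
    beta_reduce
    rw [hp, sub_self, norm_zero]
    positivity
  filter_upwards [ev1, ev2, ev3] with B h1 h2 h3
  -- The commutative algebra of `B`, so that the nearby idempotent is again a polynomial in `B`.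
  let A := Algebra.adjoin ℂ {B}
  let b : A := ⟨B, Algebra.self_mem_adjoin_singleton ℂ B⟩
  have hb : ((aeval b p : A) : M) = aeval B p := (aeval_algHom_apply A.val b p).symm
  have : CompleteSpace A := FiniteDimensional.complete ℂ A
  let _ : NormedCommRing A := { (inferInstance : NormedRing A) with mul_comm := mul_comm }
  obtain ⟨e, hee, hex⟩ := exists_idempotent_near (A := A) hε0.le (min_le_left _ _)
    (x := aeval b p) (by
      change ‖(2 * ((aeval b p : A) : M) - 1) * (2 * ((aeval b p : A) : M) - 1) - 1‖ ≤ ε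
      rw [hb]; exact h1.le)
  have hex' : ‖(e : M) - aeval B p‖ ≤ ε * ‖2 * aeval B p - 1‖ := by
    rw [← hb]; exact hex
  obtain ⟨q, hq⟩ := Algebra.adjoin_mem_exists_aeval ℂ B e.2
  refine ⟨q, ?_, hV ?_⟩
  · rw [hq]
    exact congrArg Subtype.val hee
  · rw [hq, Metric.mem_ball, dist_eq_norm]
    have h4 : ε * ‖2 * aeval B p - 1‖ ≤ η / 2 := by
      calc ε * ‖2 * aeval B p - 1‖ ≤ η / (2 * K) * K :=
            mul_le_mul (min_le_right _ _) h2.le (norm_nonneg _) (by positivity)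
        _ = η / 2 := by field_simp
    have h5 : (e : M) - e₀ = (e - aeval B p) + (aeval B p - e₀) := by abel
    rw [h5]
    linarith [norm_add_le ((e : M) - aeval B p) (aeval B p - e₀)]

end FiniteDimensionalNormed

/-! ### Continuity of the affine coordinate -/

section ChartContinuity

variable {n : ℕ}

lemma rank_eq_trace_of_idem {e : Mat n} (he : e * e = e) : (e.rank : ℂ) = e.trace := by
  have h1 : IsIdempotentElem (Matrix.toLin' e) := by
    change Matrix.toLin' e * Matrix.toLin' e = _
    rw [Module.End.mul_eq_comp, ← Matrix.toLin'_mul, he]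
  have h2 := (LinearMap.IsIdempotentElem.isProj_range _ h1).trace
  rw [Matrix.trace_toLin'_eq] at h2
  rw [h2, Matrix.rank, ← Matrix.toLin'_apply']

/-- A matrix that is invertible on the range of an idempotent `f`, and zero on its kernel, has
characteristic value `0` with multiplicity the dimension of the kernel. -/
lemma rootMultiplicity_zero_charpoly {N f : Mat n} (hf : f * f = f) (hfN : f * N = N)
    (hNf : N * f = N) (hinj : ∀ v, f.mulVec v = v → N.mulVec v = 0 → v = 0) :
    N.charpoly.rootMultiplicity 0 + f.rank = n := by
  have hker : Module.End.maxGenEigenspace (Matrix.toLin' N) 0 =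
      LinearMap.ker (Matrix.toLin' f) := by
    ext v
    rw [mem_maxGenEigenspace_toLin', LinearMap.mem_ker, Matrix.toLin'_apply, map_zero, sub_zero]
    constructor
    · rintro ⟨k, hk⟩
      have h1 : ∀ (k : ℕ) (w : Fin n → ℂ), f.mulVec w = w → (N ^ k).mulVec w = 0 → w = 0 := by
        intro k
        induction k with
        | zero => intro w _ h; simpa using h
        | succ k ih =>
          intro w hw h
          rw [pow_succ, ← Matrix.mulVec_mulVec] at h
          exact hinj w hw (ih _ (by rw [Matrix.mulVec_mulVec, hfN]) h)
      refine h1 (k + 1) _ (by rw [Matrix.mulVec_mulVec, hf]) ?_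
      rw [Matrix.mulVec_mulVec, pow_succ, mul_assoc, hNf, ← pow_succ, pow_succ',
        ← Matrix.mulVec_mulVec, hk, Matrix.mulVec_zero]
    · intro h
      exact ⟨1, by rw [pow_one, ← hNf, ← Matrix.mulVec_mulVec, h, Matrix.mulVec_zero]⟩
  have h2 := LinearMap.finrank_range_add_finrank_ker (Matrix.toLin' f)
  rw [← hker, finrank_maxGenEigenspace_toLin', Module.finrank_fin_fun] at h2
  rw [add_comm, Matrix.rank, ← Matrix.toLin'_apply']
  exact h2

lemma one_mul_aeval_mem_range (ψ : RingSetHom n) {x : Mat n} (hx : x ∈ Set.range ψ) (g : ℂ[X]) :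
    ψ 1 * aeval x g ∈ Set.range ψ := by
  obtain ⟨u, rfl⟩ := hx
  refine ⟨g.comp u, ?_⟩
  have hc : Commute (ψ 1) (aeval (ψ X) u) := by
    have h1 : Commute (ψ 1) (ψ X) := by
      change ψ 1 * ψ X = ψ X * ψ 1
      rw [one_mul_ringSetHom, ringSetHom_mul_one]
    exact (Algebra.commute_of_mem_adjoin_singleton_of_commute
      (aeval_mem_adjoin_singleton ℂ (ψ X)) h1.symm.symm)
  rw [ringSetHom_apply, ringSetHom_apply ψ u, aeval_comp,
    mul_aeval_mul (one_mul_ringSetHom ψ 1) hc]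

/-- The range of a chart with coordinate `A / B`, for coprime `A` and `B`, is the part of the
algebra of `B` on which `B` is invertible. -/
lemma aeval_mem_range_chart {A B D : Mat n} {α β : ℂ} (h1 : α • A + β • B = 1)
    (hc : Commute A B) (hD : IsDrazin B D) {ψ : RingSetHom n}
    (hψ : ∀ f, ψ f = B * D * aeval (A * D) f) (h : ℂ[X]) :
    B * D * aeval B h ∈ Set.range ψ := by
  have hψ1 : ψ 1 = B * D := by rw [hψ, map_one, mul_one]
  have hAD : Commute A D := by
    obtain ⟨p, rfl⟩ := hD.exists_aeval
    exact Algebra.commute_of_mem_adjoin_singleton_of_commute (aeval_mem_adjoin_singleton ℂ B) hc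
  have hBD : D * B = B * D := hD.comm.eq.symm
  have hDD : B * D * D = D := hD.mul_mul
  have hDmem : D ∈ Set.range ψ := by
    refine ⟨α • X + β • 1, ?_⟩
    rw [hψ, map_add, map_smul, map_smul, aeval_X, map_one, mul_add, mul_smul_comm, mul_smul_comm,
      mul_one, hAD.eq, ← mul_assoc, hDD, ← hBD, ← mul_smul_comm, ← mul_smul_comm, ← mul_add, h1,
      mul_one]
  have hDz : IsDrazin D (B * (B * D)) := by
    have e2 : D * (B * (B * D)) = B * D := by
      rw [← mul_assoc, hBD, hD.idem]
    have e3 : B * (B * D) * D = B * D := by rw [mul_assoc, hDD]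
    refine ⟨?_, ?_, 1, ?_⟩
    · change _ = _
      rw [e2, e3]
    · rw [e2, ← mul_assoc (B * D), mul_assoc B D B, hBD, mul_assoc B, hD.idem]
    · rw [pow_succ, pow_one, mul_assoc, e2, ← mul_assoc, hBD, hDD]
  obtain ⟨g, hg⟩ := hDz.exists_aeval
  have hBmem : B * D * B ∈ Set.range ψ := by
    have e : B * D * B = B * D * aeval D g := by
      rw [← hg, ← mul_assoc, mul_assoc B D B, hBD, mul_assoc B, hD.idem]
    rw [e, ← hψ1]
    exact one_mul_aeval_mem_range ψ hDmem g
  have h2 := one_mul_aeval_mem_range ψ hBmem h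
  rwa [hψ1, mul_aeval_mul hD.idem ((Commute.refl B).mul_left hD.comm.symm)] at h2

/-- A chart with coordinate `A / B` is close to `φ` if the algebra of `B` holds an idempotent `e`
close to `φ 1`, such that `B` is invertible on the part `e`, with `A / B` close to `φ X` there, and
`B` has small eigenvalues on the complement of `e`. The matrix `aeval B r * z` is the inverse of `B`
on the part `e`. -/
lemma mem_nhd_of_chart {A B D : Mat n} {α β : ℂ} (h1 : α • A + β • B = 1)
    (hc : Commute A B) (hD : IsDrazin B D) {φ ψ : RingSetHom n}
    (hψ : ∀ f, ψ f = B * D * aeval (A * D) f) {ε : ℝ} {q r : ℂ[X]} {z : Mat n}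
    (he : aeval B q * aeval B q = aeval B q)
    (hz : (aeval B q * (B * aeval B r) + (1 - aeval B q)) * z = 1)
    (htr : ‖(aeval B q).trace - (φ 1).trace‖ < 1)
    (hφe : ∀ i j, ‖aeval B q i j - φ 1 i j‖ < ε)
    (hφm : ∀ i j, ‖(A * aeval B r * z * aeval B q) i j - φ X i j‖ < ε)
    (hsmall : ∀ (c : ℂ) (v : Fin n → ℂ), v ≠ 0 →
      (α * c + β) • ((1 - aeval B q) * B).mulVec v = v → ε⁻¹ < ‖c‖) (hε : 0 < ε) :
    ψ ∈ nhd φ ε := by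
  have hψ1 : ψ 1 = B * D := by rw [hψ, map_one, mul_one]
  have hAD : Commute A D := by
    obtain ⟨p, rfl⟩ := hD.exists_aeval
    exact Algebra.commute_of_mem_adjoin_singleton_of_commute (aeval_mem_adjoin_singleton ℂ B) hc
  have hBe : ∀ p, Commute B (aeval B p) := fun p =>
    Algebra.commute_of_mem_adjoin_singleton_of_commute (aeval_mem_adjoin_singleton ℂ B)
      (Commute.refl B)
  have hAe : ∀ p, Commute A (aeval B p) := fun p =>
    Algebra.commute_of_mem_adjoin_singleton_of_commute (aeval_mem_adjoin_singleton ℂ B) hc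
  have hDe : ∀ p, Commute D (aeval B p) := fun p =>
    Algebra.commute_of_mem_adjoin_singleton_of_commute (aeval_mem_adjoin_singleton ℂ B)
      hD.comm.symm
  have hxe : Commute (aeval B r) (aeval B q) := by
    change _ * _ = _ * _
    rw [← map_mul, ← map_mul, mul_comm]
  have heB := hBe q
  have hxB := hBe r
  have heA := hAe q
  have hxA := hAe r
  have heD := hDe q
  have hxD := hDe r
  clear hBe hAe hDe
  have hψX : ψ X = A * D := by
    rw [hψ, aeval_X, ← mul_assoc, mul_assoc B D A, ← hAD.eq, ← mul_assoc, ← hc.eq, mul_assoc A B,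
      mul_assoc A, hD.mul_mul]
  have hrange := aeval_mem_range_chart h1 hc hD hψ q
  generalize aeval B q = e at *
  generalize aeval B r = x at *
  have hzc : ∀ w : Mat n, Commute w B → Commute w x → Commute w e → Commute w z := by
    intro w hw1 hw2 hw3
    have h2 : Commute w (e * (B * x) + (1 - e)) :=
      (hw3.mul_right (hw1.mul_right hw2)).add_right ((Commute.one_right w).sub_right hw3)
    have h3 := mul_eq_one_comm.1 hz
    change w * z = z * w
    calc w * z = z * (e * (B * x) + (1 - e)) * w * z := by rw [h3, one_mul]
      _ = z * (w * (e * (B * x) + (1 - e))) * z := by rw [h2.eq]; simp only [mul_assoc]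
      _ = z * w * ((e * (B * x) + (1 - e)) * z) := by simp only [mul_assoc]
      _ = z * w := by rw [hz, mul_one]
  have hzB : Commute B z := hzc B (Commute.refl B) hxB heB
  have hzx : Commute x z := hzc x hxB.symm (Commute.refl x) hxe
  have hzD : Commute D z := hzc D hD.comm.symm hxD heD
  have hze : Commute e z := hzc e heB.symm hxe.symm (Commute.refl e)
  -- On the part `e`, both `x z` and the Drazin inverse `D` are inverse to `B`.
  have e1 : B * (x * z) * e = e := by
    have h2 : e * ((e * (B * x) + (1 - e)) * z) = e * (B * x) * z := by
      rw [← mul_assoc, mul_add, ← mul_assoc, he, mul_sub, he, mul_one, sub_self, add_zero]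
    rw [hz, mul_one] at h2
    have h3 : Commute e (B * (x * z)) := heB.symm.mul_right (hxe.symm.mul_right hze)
    rw [← h3.eq, ← mul_assoc B, ← mul_assoc, ← h2]
  have e2 : ∀ k : ℕ, B ^ k * ((x * z) ^ k * e) = e := by
    intro k
    have h2 : Commute B (x * z) := hxB.mul_right hzB
    rw [← mul_assoc, ← h2.mul_pow]
    induction k with
    | zero => simp
    | succ k ih => rw [pow_succ, mul_assoc, e1, ih]
  have e3 : B * D * e = e := by
    obtain ⟨k, hk⟩ := hD.pow
    have h2 : B * D * B ^ k = B ^ k := by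
      rw [← hD.comm.eq.symm, mul_assoc, ← pow_succ', (hD.comm.symm.pow_right (k + 1)).eq, hk]
    rw [← e2 k, ← mul_assoc, h2]
  have hee' : Commute e (B * D) := heB.symm.mul_right heD.symm
  have e4 : e * (B * D) = e := by rw [hee'.eq, e3]
  have e5 : D * e = x * z * e := by
    conv_lhs => rw [← e1]
    rw [← mul_assoc, ← mul_assoc, ← hD.comm.eq, ((hxB.mul_right hzB).mul_left
      (hxD.mul_right hzD)).eq, mul_assoc, e3]
  have e6 : e * ψ X = A * x * z * e := by
    rw [hψX, ← mul_assoc, ← heA.eq, mul_assoc, ← heD.eq, e5]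
    simp only [mul_assoc]
  -- Ranks of idempotents are traces, and integers at distance `< 1` are equal.
  have hrank : e.rank = (φ 1).rank := by
    have hφ1 : φ 1 * φ 1 = φ 1 := by rw [← map_mul, one_mul]
    rw [← rank_eq_trace_of_idem he, ← rank_eq_trace_of_idem hφ1] at htr
    have h2 : ‖(((e.rank : ℤ) - ((φ 1).rank : ℤ) : ℤ) : ℂ)‖ < 1 := by exact_mod_cast htr
    rw [Complex.norm_intCast] at h2
    have h3 : |(e.rank : ℤ) - ((φ 1).rank : ℤ)| < 1 := by exact_mod_cast h2
    rw [Int.abs_lt_one_iff] at h3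
    omega
  have hf : (B * D - e) * (B * D - e) = B * D - e := by
    rw [mul_sub, sub_mul, sub_mul, hD.idem, e3, e4, he, sub_self, sub_zero]
  have hfX : Commute (B * D - e) (A * D) := by
    refine Commute.sub_left ?_ (heA.symm.mul_right heD.symm)
    exact (hc.symm.mul_right hD.comm).mul_left (hAD.symm.mul_right (Commute.refl D))
  have hef : e * (B * D - e) = 0 := by rw [mul_sub, e4, he, sub_self]
  have hfrank : (B * D - e).rank + e.rank = (B * D).rank := by
    have h2 : ((B * D - e).rank : ℂ) + e.rank = (B * D).rank := by
      rw [rank_eq_trace_of_idem hf, rank_eq_trace_of_idem he, rank_eq_trace_of_idem hD.idem,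
        Matrix.trace_sub, sub_add_cancel]
    exact_mod_cast h2
  -- An eigenvector of the complementary part, for the eigenvalue `c = A / B`, is an eigenvector
  -- of `B` for the eigenvalue `(α c + β)⁻¹`.
  have key : ∀ (c : ℂ) (v : Fin n → ℂ), v ≠ 0 → (B * D - e).mulVec v = v →
      (A * D).mulVec v = c • v → ε⁻¹ < ‖c‖ := by
    intro c v hv hfv hcv
    refine hsmall c v hv ?_
    have h2 : e.mulVec v = 0 := by
      rw [← hfv, Matrix.mulVec_mulVec, hef, Matrix.zero_mulVec]
    have h3 : (B * D).mulVec v = v := by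
      rw [Matrix.sub_mulVec, h2, sub_zero] at hfv
      exact hfv
    have h4 : A.mulVec v = c • B.mulVec v := by
      conv_lhs => rw [← h3]
      rw [Matrix.mulVec_mulVec, ← mul_assoc, hc.eq, mul_assoc, ← Matrix.mulVec_mulVec, hcv,
        Matrix.mulVec_smul]
    have h5 : ((1 - e) * B).mulVec v = B.mulVec v := by
      rw [sub_mul, one_mul, Matrix.sub_mulVec, ← heB.eq, ← Matrix.mulVec_mulVec, h2,
        Matrix.mulVec_zero, sub_zero]
    have h6 := congrArg (fun M => Matrix.mulVec M v) h1
    simp only [Matrix.add_mulVec, Matrix.smul_mulVec, Matrix.one_mulVec, h4] at h6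
    rw [h5, add_smul, mul_smul, h6]
  have hN : (ψ 1 - e) * ψ X = (B * D - e) * (A * D) := by rw [hψ1, hψX]
  refine ⟨e, ?_, he, hrank, hφe, ?_, ?_, ?_⟩
  · rwa [e3] at hrange
  · rwa [e6]
  · rw [hN, hψ1, ← hrank, ← hfrank, ← add_assoc, rootMultiplicity_zero_charpoly hf]
    · rw [← mul_assoc, hf]
    · rw [mul_assoc, ← hfX.eq, ← mul_assoc, hf]
    · intro v hfv hNv
      by_contra hv
      have h2 := key 0 v hv hfv (by
        rw [zero_smul, ← hNv, hfX.eq, ← Matrix.mulVec_mulVec v (A * D), hfv])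
      rw [norm_zero] at h2
      exact (inv_pos.2 hε).not_gt h2
  · intro c hroot hc0
    rw [hN] at hroot
    have h2 : c ∈ spectrum ℂ ((B * D - e) * (A * D)) :=
      Matrix.mem_spectrum_iff_isRoot_charpoly.2 hroot
    rw [← Matrix.spectrum_toLin', ← Module.End.hasEigenvalue_iff_mem_spectrum] at h2
    obtain ⟨v, hv⟩ := h2.exists_hasEigenvector
    have h3 : ((B * D - e) * (A * D)).mulVec v = c • v := hv.apply_eq_smul
    have h4 : (B * D - e).mulVec v = v := by
      have h5 : (B * D - e).mulVec (c • v) = c • v := by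
        rw [← h3, Matrix.mulVec_mulVec, ← mul_assoc, hf]
      rw [Matrix.mulVec_smul] at h5
      exact smul_right_injective _ hc0 h5
    refine key c v hv.2 h4 ?_
    rw [← h3, hfX.eq, ← Matrix.mulVec_mulVec v (A * D), h4]

end ChartContinuity

section MatrixTopology

variable {n : ℕ}

section
attribute [local instance] Matrix.linftyOpNormedRing Matrix.linftyOpNormedAlgebra

lemma eventually_exists_idempotent_matrix {B₀ e₀ : Mat n} {p : ℂ[X]} (hp : aeval B₀ p = e₀)
    (he : e₀ * e₀ = e₀) {V : Set (Mat n)} (hV : V ∈ nhds e₀) :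
    ∀ᶠ B : Mat n in nhds B₀, ∃ q : ℂ[X], aeval B q * aeval B q = aeval B q ∧ aeval B q ∈ V :=
  eventually_exists_idempotent hp he hV

/-- The eigenvalues of a matrix close to `0` are small. -/
lemma eventually_eigenvalue_lt {δ : ℝ} (hδ : 0 < δ) : ∀ᶠ N in nhds (0 : Mat n),
    ∀ (c : ℂ) (v : Fin n → ℂ), v ≠ 0 → N.mulVec v = c • v → ‖c‖ < δ := by
  have h : ∀ᶠ N in nhds (0 : Mat n), ‖N‖ < δ :=
    (continuous_norm (E := Mat n)).continuousAt.eventually_lt_const (by simpa using hδ)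
  filter_upwards [h] with N hN c v hv hc
  have h1 := Matrix.linfty_opNorm_mulVec N v
  rw [hc, norm_smul] at h1
  exact (le_of_mul_le_mul_right h1 (norm_pos_iff.2 hv)).trans_lt hN

end

lemma eventually_entries_lt {M₀ : Mat n} {ε : ℝ} (hε : 0 < ε) :
    ∀ᶠ M in nhds M₀, ∀ i j, ‖M i j - M₀ i j‖ < ε := by
  rw [Filter.eventually_all]
  intro i
  rw [Filter.eventually_all]
  intro j
  have h : Continuous fun M : Mat n => ‖M i j - M₀ i j‖ := by fun_prop
  exact h.continuousAt.eventually_lt_const (by simpa)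

lemma continuous_ringSetHom {Y : Type*} [TopologicalSpace Y] {ψ : Y → RingSetHom n}
    (h : ∀ y₀, ∀ ε > 0, ∀ᶠ y in nhds y₀, ψ y ∈ nhd (ψ y₀) ε) : Continuous ψ := by
  rw [continuous_def]
  intro U hU
  rw [isOpen_iff_mem_nhds]
  intro y₀ hy
  obtain ⟨ε, hε, hU⟩ := hU _ hy
  filter_upwards [h y₀ ε hε] with y hy'
  exact hU hy'

/-- A chart with coordinate `A / B` depends continuously on `A` and `B`: where `B` becomes
singular, part of the spectrum of the coordinate comes in from infinity. -/
lemma continuous_chart {Y : Type*} [TopologicalSpace Y] {A B D : Y → Mat n} {α β : ℂ}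
    (hA : Continuous A) (hB : Continuous B) (h1 : ∀ y, α • A y + β • B y = 1)
    (hc : ∀ y, Commute (A y) (B y)) (hD : ∀ y, IsDrazin (B y) (D y)) {ψ : Y → RingSetHom n}
    (hψ : ∀ y f, ψ y f = B y * D y * aeval (A y * D y) f) : Continuous ψ := by
  refine continuous_ringSetHom fun y₀ ε hε => ?_
  obtain ⟨r, hr⟩ := (hD y₀).exists_aeval
  obtain ⟨k, hk⟩ := (hD y₀).pow
  set e₀ := B y₀ * D y₀ with he₀
  have hidem : e₀ * e₀ = e₀ := (hD y₀).idem
  have hψ1 : ψ y₀ 1 = e₀ := by rw [hψ, map_one, mul_one]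
  have hp : aeval (B y₀) (X * r) = e₀ := by rw [map_mul, aeval_X, ← hr]
  have hψX : ψ y₀ X = A y₀ * D y₀ * e₀ := by
    have hAD : Commute (A y₀) (D y₀) := by
      rw [hr]
      exact Algebra.commute_of_mem_adjoin_singleton_of_commute
        (aeval_mem_adjoin_singleton ℂ (B y₀)) (hc y₀)
    have h2 : Commute e₀ (A y₀ * D y₀) :=
      ((hc y₀).symm.mul_right (hD y₀).comm).mul_left (hAD.symm.mul_right (Commute.refl _))
    rw [hψ, aeval_X, h2.eq]
  -- Eigenvalues of `B` below `1 / M` belong to values of `A / B` beyond `1 / ε`.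
  set M : ℝ := ‖α‖ * ε⁻¹ + ‖β‖ with hM
  have hM0 : 0 ≤ M := by positivity
  -- Neighbourhoods of `(y₀, e₀)` on which the data of the chart are close to those at `y₀`.
  have hcB : Continuous fun w : Y × Mat n => B w.1 := hB.comp continuous_fst
  have hcA : Continuous fun w : Y × Mat n => A w.1 := hA.comp continuous_fst
  have hcr : Continuous fun w : Y × Mat n => aeval (B w.1) r :=
    (Polynomial.continuous_aeval r).comp hcB
  let u : Y × Mat n → Mat n := fun w => w.2 * (B w.1 * aeval (B w.1) r) + (1 - w.2)
  have hu : Continuous u := by fun_prop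
  have hu0 : u (y₀, e₀) = 1 := by
    simp only [u]
    rw [← hr, ← he₀, hidem, add_sub_cancel]
  have hdet : ∀ᶠ w in nhds (y₀, e₀), (u w).det ≠ 0 := by
    have h2 : Continuous fun w => (u w).det := hu.matrix_det
    refine h2.continuousAt.eventually_ne ?_
    simp [hu0]
  have hclose : ∀ᶠ w in nhds (y₀, e₀),
      ∀ i j, ‖(A w.1 * aeval (B w.1) r * (u w)⁻¹ * w.2) i j - ψ y₀ X i j‖ < ε := by
    have h2 : ContinuousAt (fun w : Y × Mat n => A w.1 * aeval (B w.1) r * (u w)⁻¹ * w.2)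
        (y₀, e₀) :=
      (((hcA.mul hcr).continuousAt).mul
        (ContinuousAt.comp (f := u) (continuousAt_matrix_inv _ (by
          rw [hu0, Matrix.det_one, Ring.inverse_eq_inv']
          exact continuousAt_inv₀ one_ne_zero)) hu.continuousAt)).mul continuous_snd.continuousAt
    have h3 : A y₀ * aeval (B y₀) r * (u (y₀, e₀))⁻¹ * e₀ = ψ y₀ X := by
      rw [hu0, inv_one, mul_one, ← hr, hψX]
    have h4 := h2.tendsto
    rw [h3] at h4
    exact h4.eventually (eventually_entries_lt hε)
  have hnear : ∀ᶠ w in nhds (y₀, e₀), ∀ i j, ‖w.2 i j - ψ y₀ 1 i j‖ < ε := by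
    rw [hψ1]
    exact (continuous_snd (X := Y)).continuousAt.eventually (eventually_entries_lt hε)
  have htr : ∀ᶠ w in nhds (y₀, e₀), ‖w.2.trace - (ψ y₀ 1).trace‖ < 1 := by
    have h2 : Continuous fun w : Y × Mat n => ‖w.2.trace - (ψ y₀ 1).trace‖ := by
      have : Continuous fun w : Y × Mat n => w.2.trace := continuous_snd.matrix_trace
      fun_prop
    refine h2.continuousAt.eventually_lt_const ?_
    simp [hψ1]
  -- `(1 - e₀) B` is only nilpotent, so the power that vanishes is used.
  have hsmall : ∀ᶠ w in nhds (y₀, e₀), ∀ (c : ℂ) (v : Fin n → ℂ), v ≠ 0 →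
      (((1 - w.2) * B w.1) ^ (k + 1)).mulVec v = c • v → ‖c‖ < (M + 1)⁻¹ ^ (k + 1) := by
    have h2 : Continuous fun w : Y × Mat n => ((1 - w.2) * B w.1) ^ (k + 1) := by fun_prop
    have h3 : ((1 - e₀) * B y₀) ^ (k + 1) = 0 := by
      have h4 : Commute (1 - e₀) (B y₀) :=
        (Commute.one_left _).sub_left ((Commute.refl _).mul_left (hD y₀).comm.symm)
      have h5 : e₀ * B y₀ ^ (k + 1) = B y₀ ^ (k + 1) := by
        rw [he₀, mul_assoc, ((hD y₀).comm.symm.pow_right (k + 1)).eq, hk, ← pow_succ']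
      rw [h4.mul_pow, pow_succ (1 - e₀), mul_assoc, sub_mul, one_mul, h5, sub_self, mul_zero]
    have h4 := h2.tendsto (y₀, e₀)
    simp only [h3] at h4
    exact h4.eventually (eventually_eigenvalue_lt (by positivity))
  have hall := hdet.and (hclose.and (hnear.and (htr.and hsmall)))
  rw [nhds_prod_eq] at hall
  obtain ⟨s, hs, V, hV, hsV⟩ := Filter.eventually_prod_iff.1 hall
  have hex := hB.continuousAt.eventually (eventually_exists_idempotent_matrix hp hidem hV)
  filter_upwards [hs, hex] with y hy hq
  obtain ⟨q, hq, hqV⟩ := hq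
  obtain ⟨w1, w2, w3, w4, w5⟩ := hsV hy hqV
  refine mem_nhd_of_chart (h1 y) (hc y) (hD y) (hψ y) (q := q) (r := r) hq
    (Matrix.mul_nonsing_inv _ (isUnit_iff_ne_zero.2 w1)) w4 w3 w2 ?_ hε
  intro c v hv hcv
  by_contra hcε
  rw [not_lt] at hcε
  dsimp only at w5
  generalize (1 - aeval (B y) q) * B y = N at hcv w5
  have hl : α * c + β ≠ 0 := by
    intro h
    rw [h, zero_smul] at hcv
    exact hv hcv.symm
  have hlM : ‖α * c + β‖ ≤ M := by
    refine (norm_add_le _ _).trans ?_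
    rw [norm_mul, hM]
    exact add_le_add_left (mul_le_mul_of_nonneg_left hcε (norm_nonneg _)) _
  have hNv : N.mulVec v = (α * c + β)⁻¹ • v := by
    rw [eq_inv_smul_iff₀ hl, hcv]
  have hNk : ∀ j : ℕ, (N ^ j).mulVec v = (α * c + β)⁻¹ ^ j • v := by
    intro j
    induction j with
    | zero => simp
    | succ j ih => rw [pow_succ, ← Matrix.mulVec_mulVec, hNv, Matrix.mulVec_smul, ih, smul_smul,
        pow_succ']
  have h2 := w5 _ v hv (hNk (k + 1))
  rw [norm_pow, norm_inv] at h2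
  have h3 := lt_of_pow_lt_pow_left₀ _ (by positivity) h2
  have h4 := (inv_lt_inv₀ (norm_pos_iff.2 hl) (by positivity)).1 h3
  linarith

/-- The morphism with affine coordinate `R` on the complement of the point `c` depends
continuously on `R`. -/
lemma continuous_affineMor (c : ℂ) : Continuous (affineMor c : Mat n → Mor n) := by
  refine continuous_induced_rng.2 (Continuous.prodMk ?_ ?_)
  · refine continuous_chart (A := fun R => 1 + c • R) (B := fun R => R) (D := fun R => drazin R)
      (α := 1) (β := -c) (by fun_prop) continuous_id (fun R => ?_) (fun R => ?_)
      (fun R => isDrazin_drazin R) (fun R f => affineMor_apply₀ (isDrazin_drazin R) f)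
    · rw [one_smul, neg_smul, add_neg_cancel_right]
    · exact (Commute.one_left R).add_left ((Commute.refl R).smul_left c)
  · refine continuous_chart (A := fun R => R) (B := fun R => 1 + c • R)
      (D := fun R => drazin (1 + c • R)) (α := -c) (β := 1) continuous_id (by fun_prop)
      (fun R => ?_) (fun R => ?_) (fun R => isDrazin_drazin _)
      (fun R f => affineMor_applyInf (isDrazin_drazin _) f)
    · rw [one_smul, neg_smul, neg_add_cancel_comm_assoc]
    · exact (Commute.one_right R).add_right ((Commute.refl R).smul_right c)

end MatrixTopology

/-! ### Continuous families of polynomials -/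

/-- The coefficients of a family of polynomials are continuous at a point. -/
def CoeffContinuousAt {Y : Type*} [TopologicalSpace Y] (F : Y → ℂ[X]) (y : Y) : Prop :=
  ∀ k, ContinuousAt (fun z => (F z).coeff k) y

namespace CoeffContinuousAt

variable {Y : Type*} [TopologicalSpace Y] {F G : Y → ℂ[X]} {y : Y}

lemma const (p : ℂ[X]) : CoeffContinuousAt (fun _ : Y => p) y := fun _ => continuousAt_const

lemma C {f : Y → ℂ} (hf : ContinuousAt f y) :
    CoeffContinuousAt (fun z => Polynomial.C (f z)) y := by
  intro k
  by_cases hk : k = 0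
  · simpa [hk] using hf
  · simpa [coeff_C, hk] using continuousAt_const

lemma add (hF : CoeffContinuousAt F y) (hG : CoeffContinuousAt G y) :
    CoeffContinuousAt (fun z => F z + G z) y := fun k => by
  simp only [coeff_add]
  exact (hF k).add (hG k)

lemma sub (hF : CoeffContinuousAt F y) (hG : CoeffContinuousAt G y) :
    CoeffContinuousAt (fun z => F z - G z) y := fun k => by
  simp only [coeff_sub]
  exact (hF k).sub (hG k)

lemma mul (hF : CoeffContinuousAt F y) (hG : CoeffContinuousAt G y) :
    CoeffContinuousAt (fun z => F z * G z) y := fun k => by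
  simp only [coeff_mul]
  exact tendsto_finsetSum _ fun p _ => (hF p.1).mul (hG p.2)

lemma sum {ι : Type*} {s : Finset ι} {F : ι → Y → ℂ[X]}
    (hF : ∀ i ∈ s, CoeffContinuousAt (F i) y) : CoeffContinuousAt (fun z => ∑ i ∈ s, F i z) y := by
  classical
  induction s using Finset.induction_on with
  | empty => simpa using const 0
  | insert a s ha ih =>
    simp only [Finset.sum_insert ha]
    exact (hF a (Finset.mem_insert_self _ _)).add
      (ih fun i hi => hF i (Finset.mem_insert_of_mem hi))

lemma prod {ι : Type*} {s : Finset ι} {F : ι → Y → ℂ[X]}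
    (hF : ∀ i ∈ s, CoeffContinuousAt (F i) y) : CoeffContinuousAt (fun z => ∏ i ∈ s, F i z) y := by
  classical
  induction s using Finset.induction_on with
  | empty => simpa using const 1
  | insert a s ha ih =>
    simp only [Finset.prod_insert ha]
    exact (hF a (Finset.mem_insert_self _ _)).mul
      (ih fun i hi => hF i (Finset.mem_insert_of_mem hi))

lemma charpoly {n : ℕ} {M : Y → Mat n} (hM : ContinuousAt M y) :
    CoeffContinuousAt (fun z => (M z).charpoly) y := by
  simp only [Matrix.charpoly, Matrix.det_apply']
  refine sum fun σ _ => (const _).mul (prod fun i _ => ?_)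
  have h : ContinuousAt (fun z => M z (σ i) i) y := by
    have h1 : Continuous fun N : Mat n => N (σ i) i := by fun_prop
    exact h1.continuousAt.comp hM
  by_cases hi : σ i = i
  · simp only [Matrix.charmatrix_apply, hi, Matrix.diagonal_apply_eq]
    rw [hi] at h
    exact (const _).sub (C h)
  · simp only [Matrix.charmatrix_apply, Matrix.diagonal_apply_ne _ hi]
    exact (const _).sub (C h)

lemma comp {Z : Type*} [TopologicalSpace Z] {f : Z → Y} {z : Z} (hF : CoeffContinuousAt F (f z))
    (hf : ContinuousAt f z) : CoeffContinuousAt (fun w => F (f w)) z := fun k => (hF k).comp hf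

end CoeffContinuousAt

open Classical in
/-- Near each point of `ℙ¹`, the linear form that vanishes at a point can be scaled to depend
continuously on the point. -/
lemma exists_lift_pointPoly (p₀ : P1) : ∃ ℓ : P1 → ℂ[X], CoeffContinuousAt ℓ p₀ ∧
    ∀ p, ∃ s : ℂ, s ≠ 0 ∧ ℓ p = C s * pointPoly p := by
  induction p₀ using OnePoint.rec with
  | coe a =>
    refine ⟨pointPoly, fun k => ?_, fun p => ⟨1, one_ne_zero, by simp⟩⟩
    rw [OnePoint.continuousAt_coe]
    exact ((CoeffContinuousAt.const X).sub (CoeffContinuousAt.C continuousAt_id)) k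
  | infty =>
    let u : P1 → ℂ := fun p => p.elim 0 fun a => a⁻¹
    have hu : ContinuousAt u OnePoint.infty := by
      rw [OnePoint.continuousAt_infty', Filter.coclosedCompact_eq_cocompact,
        ← Metric.cobounded_eq_cocompact]
      exact Filter.tendsto_inv₀_cobounded
    refine ⟨fun p => if p = (0 : ℂ) then X else 1 - C (u p) * X, fun k => ?_, fun p => ?_⟩
    · have h1 : ContinuousAt (fun p => (1 - C (u p) * X).coeff k) OnePoint.infty :=
        ((CoeffContinuousAt.const 1).sub
          ((CoeffContinuousAt.C hu).mul (CoeffContinuousAt.const X))) k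
      refine h1.congr ?_
      filter_upwards [(isOpen_ne (x := ((0 : ℂ) : P1))).mem_nhds (OnePoint.infty_ne_coe 0)]
        with p hp
      rw [if_neg hp]
    · induction p using OnePoint.rec with
      | infty => exact ⟨1, one_ne_zero, by simp [u, pointPoly_infty]⟩
      | coe a =>
        by_cases ha : a = 0
        · exact ⟨1, one_ne_zero, by simp [ha, pointPoly_coe]⟩
        · refine ⟨-a⁻¹, neg_ne_zero.2 (inv_ne_zero ha), ?_⟩
          beta_reduce
          rw [if_neg (by simpa using ha), pointPoly_coe, mul_sub, ← C_mul, neg_mul,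
            inv_mul_cancel₀ ha]
          simp [u]
          ring

/-- Near each point of `(ℙ¹)ⁿ`, the binary form that vanishes at `n` points can be scaled to depend
continuously on the points. -/
lemma exists_lift_cycleForm {n : ℕ} (p₀ : Fin n → P1) : ∃ w : (Fin n → P1) → Fin (n + 1) → ℂ,
    ContinuousAt w p₀ ∧
      ∀ p, ∃ s : ℂ, s ≠ 0 ∧ w p = s • cycleForm (SymP1.ofPoints p) := by
  choose ℓ hℓ s hs hℓs using exists_lift_pointPoly
  refine ⟨fun p i => (∏ j, ℓ (p₀ j) (p j)).coeff i, ?_, fun p => ⟨∏ j, s (p₀ j) (p j),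
    Finset.prod_ne_zero_iff.2 fun j _ => hs _ _, ?_⟩⟩
  · rw [continuousAt_pi]
    exact fun i => CoeffContinuousAt.prod
      (fun j _ => (hℓ (p₀ j)).comp (f := fun p : Fin n → P1 => p j) (continuousAt_apply j p₀)) _
  · funext i
    simp only [hℓs, Finset.prod_mul_distrib, ← map_prod]
    rw [coeff_C_mul, ← cyclePoly_ofPoints]
    rfl

/-! ### The projective space of binary forms -/

/-- The hermitian projector onto the line of a vector, up to scale: the image of the point
`[w]` of a projective space under its embedding into the hermitian matrices. -/
noncomputable def lineProj {m : ℕ} (w : Fin m → ℂ) : Fin m → Fin m → ℂ :=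
  fun i j => ((∑ l, ‖w l‖ ^ 2 : ℝ) : ℂ)⁻¹ * (w i * star (w j))

lemma sum_norm_sq_ne_zero {m : ℕ} {w : Fin m → ℂ} (hw : w ≠ 0) : (∑ l, ‖w l‖ ^ 2 : ℝ) ≠ 0 := by
  intro h
  refine hw (funext fun l => ?_)
  have := (Finset.sum_eq_zero_iff_of_nonneg fun l _ => by positivity).1 h l (Finset.mem_univ l)
  simpa using this

lemma continuousAt_lineProj {m : ℕ} {w : Fin m → ℂ} (hw : w ≠ 0) : ContinuousAt lineProj w := by
  rw [continuousAt_pi]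
  intro i
  rw [continuousAt_pi]
  intro j
  refine ContinuousAt.mul (ContinuousAt.inv₀ ?_ ?_) ?_
  · have h : Continuous fun w : Fin m → ℂ => (∑ l, ‖w l‖ ^ 2 : ℝ) :=
      continuous_finsetSum _ fun l _ => by fun_prop
    exact (Complex.continuous_ofReal.comp h).continuousAt
  · exact_mod_cast sum_norm_sq_ne_zero hw
  · fun_prop

lemma lineProj_smul {m : ℕ} {s : ℂ} (hs : s ≠ 0) (w : Fin m → ℂ) :
    lineProj (s • w) = lineProj w := by
  funext i j
  have h1 : ((∑ l, ‖(s • w) l‖ ^ 2 : ℝ) : ℂ) = (s * star s) * ((∑ l, ‖w l‖ ^ 2 : ℝ) : ℂ) := by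
    have h2 : s * star s = ((‖s‖ ^ 2 : ℝ) : ℂ) := by
      rw [Complex.star_def, Complex.mul_conj, Complex.normSq_eq_norm_sq]
    rw [h2, ← Complex.ofReal_mul, Finset.mul_sum]
    simp [mul_pow]
  have hs' : star s ≠ 0 := by simpa using hs
  simp only [lineProj]
  rw [h1, Pi.smul_apply, Pi.smul_apply, smul_eq_mul, smul_eq_mul, star_mul', mul_inv, mul_inv]
  field_simp

lemma exists_eq_smul_of_lineProj_eq {m : ℕ} {w w' : Fin m → ℂ} (hw : w ≠ 0)
    (h : lineProj w = lineProj w') : ∃ s : ℂ, w = s • w' := by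
  obtain ⟨j, hj⟩ := Function.ne_iff.1 hw
  have hj' : star (w j) ≠ 0 := by simpa using hj
  have h1 : ((∑ l, ‖w l‖ ^ 2 : ℝ) : ℂ) ≠ 0 := by exact_mod_cast sum_norm_sq_ne_zero hw
  refine ⟨((∑ l, ‖w l‖ ^ 2 : ℝ) : ℂ) * (star (w j))⁻¹ *
    (((∑ l, ‖w' l‖ ^ 2 : ℝ) : ℂ)⁻¹ * star (w' j)), funext fun i => ?_⟩
  have h2 := congrFun (congrFun h i) j
  simp only [lineProj] at h2
  rw [Pi.smul_apply, smul_eq_mul]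
  generalize ((∑ l, ‖w l‖ ^ 2 : ℝ) : ℂ) = N at *
  generalize ((∑ l, ‖w' l‖ ^ 2 : ℝ) : ℂ)⁻¹ = N' at *
  field_simp
  field_simp at h2
  rw [h2]
  ring

lemma continuous_lineProj_cycleForm {n : ℕ} :
    Continuous fun s : SymP1 n => lineProj (cycleForm s) := by
  refine continuous_coinduced_dom.2 (continuous_iff_continuousAt.2 fun p₀ => ?_)
  obtain ⟨w, hw, hws⟩ := exists_lift_cycleForm p₀
  have h1 : (fun s : SymP1 n => lineProj (cycleForm s)) ∘ SymP1.ofPoints = lineProj ∘ w := by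
    funext p
    obtain ⟨s, hs, h⟩ := hws p
    simp only [Function.comp_apply]
    rw [h, lineProj_smul hs]
  rw [h1]
  obtain ⟨s, hs, h⟩ := hws p₀
  refine ContinuousAt.comp (continuousAt_lineProj ?_) hw
  rw [h]
  exact smul_ne_zero hs (cycleForm_ne_zero _)

instance {n : ℕ} : CompactSpace (SymP1 n) where
  isCompact_univ := by
    rw [← Set.range_eq_univ.2 ofPoints_surjective]
    exact isCompact_range continuous_coinduced_rng

/-- `Sⁿ(ℙ¹)` is embedded in the projective space of binary forms of degree `n`. -/
lemma isEmbedding_lineProj_cycleForm {n : ℕ} :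
    Topology.IsEmbedding fun s : SymP1 n => lineProj (cycleForm s) := by
  refine (continuous_lineProj_cycleForm.isClosedEmbedding ?_).isEmbedding
  intro s t hst
  obtain ⟨c, hc⟩ := exists_eq_smul_of_lineProj_eq (cycleForm_ne_zero s) hst
  refine cyclePoly_injective ?_
  have h1 : cyclePoly s = C c * cyclePoly t := by
    rw [← form₀_cycleForm, ← form₀_cycleForm, hc]
    simp [form₀, Finset.mul_sum, smul_eq_C_mul, mul_assoc]
  have h2 := congrArg leadingCoeff h1
  rw [leadingCoeff_mul, leadingCoeff_C, monic_cyclePoly s, monic_cyclePoly t, mul_one] at h2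
  rw [h1, ← h2, C_1, one_mul]

/-! ### Continuity of the cycle of a morphism -/

section CycleContinuity

variable {n : ℕ}

/-- The characteristic values of two matrices with product `0` are those of their sum, and `n`
more zeros: `(X - a) (X - b) = X (X - (a + b))`. -/
lemma charpoly_mul_charpoly_of_mul_eq_zero {a b : Mat n} (h : a * b = 0) :
    a.charpoly * b.charpoly = X ^ n * (a + b).charpoly := by
  have h1 : a.charmatrix * b.charmatrix = (X : ℂ[X]) • (a + b).charmatrix := by
    have hX : ∀ M : Matrix (Fin n) (Fin n) ℂ[X], Commute (Matrix.scalar (Fin n) (X : ℂ[X])) M :=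
      fun M => Matrix.scalar_commute _ (fun r => Commute.all _ r) M
    simp only [Matrix.charmatrix]
    have h2 : C.mapMatrix a * C.mapMatrix b = (0 : Matrix (Fin n) (Fin n) ℂ[X]) := by
      rw [← map_mul, h, map_zero]
    have h3 : (X : ℂ[X]) • (Matrix.scalar (Fin n) (X : ℂ[X]) - C.mapMatrix (a + b)) =
        Matrix.scalar (Fin n) (X : ℂ[X]) *
          (Matrix.scalar (Fin n) (X : ℂ[X]) - C.mapMatrix (a + b)) := by
      rw [Matrix.scalar_apply, ← Matrix.smul_eq_diagonal_mul]
    rw [h3, map_add, sub_mul, mul_sub, mul_sub, mul_sub, mul_add, h2, (hX (C.mapMatrix a)).eq]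
    abel
  rw [Matrix.charpoly, Matrix.charpoly, Matrix.charpoly, ← Matrix.det_mul, h1, Matrix.det_smul,
    Fintype.card_fin]

/-- The linear factor of a characteristic value, in terms of the inverse of the value (or `X`, if
the value is `0`). -/
lemma X_sub_C_eq (z : ℂ) : ∃ s : ℂ, s ≠ 0 ∧
    (X - C z : ℂ[X]) = C s * X ^ (if z = 0 then 1 else 0) * (1 - C z⁻¹ * X) := by
  by_cases hz : z = 0
  · exact ⟨1, one_ne_zero, by simp [hz]⟩
  · refine ⟨-z, neg_ne_zero.2 hz, ?_⟩
    rw [if_neg hz, pow_zero, mul_one, mul_sub, ← mul_assoc, ← C_mul, neg_mul, mul_inv_cancel₀ hz]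
    simp
    ring

/-- A characteristic polynomial, in terms of the inverses of the nonzero characteristic values
(the characteristic value `0` has the junk inverse `0`). -/
lemma exists_charpoly_eq (N : Mat n) : ∃ (x : Fin n → ℂ) (s : ℂ), s ≠ 0 ∧
    N.charpoly = C s * X ^ (N.charpoly.rootMultiplicity 0) * ∏ j, (1 - C (x j) * X) ∧
    ∀ j, x j ≠ 0 → N.charpoly.IsRoot (x j)⁻¹ := by
  have hcard : N.charpoly.roots.card = n := by
    rw [← (IsAlgClosed.splits N.charpoly).natDegree_eq_card_roots, Matrix.charpoly_natDegree_eq_dim,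
      Fintype.card_fin]
  obtain ⟨z, hz⟩ := exists_fin_map_eq hcard
  choose s hs hsz using X_sub_C_eq
  refine ⟨fun j => (z j)⁻¹, ∏ j, s (z j), Finset.prod_ne_zero_iff.2 fun j _ => hs _, ?_, ?_⟩
  · have h1 : N.charpoly = ∏ j, (X - C (z j)) := by
      rw [(IsAlgClosed.splits N.charpoly).eq_prod_roots_of_monic N.charpoly_monic, ← hz,
        Multiset.map_map]
      rfl
    have h2 : N.charpoly.rootMultiplicity 0 = ∑ j, if z j = 0 then 1 else 0 := by
      rw [← count_roots, ← hz, Multiset.count_map, ← Finset.card_filter]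
      simp only [eq_comm (a := (0 : ℂ))]
      rfl
    rw [h2]
    conv_lhs => rw [h1]
    simp only [fun j => hsz (z j)]
    rw [Finset.prod_mul_distrib, Finset.prod_mul_distrib, map_prod, Finset.prod_pow_eq_pow_sum]
  · intro j hj
    rw [inv_inv]
    refine isRoot_of_mem_roots ?_
    rw [← hz]
    exact Multiset.mem_map_of_mem z (Finset.mem_univ_val j)

lemma exists_entries_subset {M₀ : Fin n → Fin n → ℂ} {V : Set (Fin n → Fin n → ℂ)}
    (hV : V ∈ nhds M₀) :
    ∃ ε > 0, ∀ M : Fin n → Fin n → ℂ, (∀ i j, ‖M i j - M₀ i j‖ < ε) → M ∈ V := by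
  obtain ⟨ε, hε, h⟩ := Metric.mem_nhds_iff.1 hV
  refine ⟨ε, hε, fun M hM => h ?_⟩
  rw [Metric.mem_ball, dist_pi_lt_iff hε]
  intro i
  rw [dist_pi_lt_iff hε]
  intro j
  rw [dist_eq_norm]
  exact hM i j

/-- The binary form, of degree `n`, of the characteristic values of a ring-set-homomorphism, with
the missing ones at `∞`. -/
noncomputable def chartForm (φ : RingSetHom n) : Fin (n + 1) → ℂ :=
  fun i => (φ X).charpoly.coeff (i + (n - (φ 1).rank))

lemma chartForm_ne_zero (φ : RingSetHom n) : chartForm φ ≠ 0 := by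
  have hr : (φ 1).rank ≤ n := (Matrix.rank_le_card_width _).trans_eq (Fintype.card_fin n)
  intro h
  have h1 := congrFun h ⟨(φ 1).rank, by omega⟩
  have h2 := (φ X).charpoly_monic.coeff_natDegree
  rw [Matrix.charpoly_natDegree_eq_dim, Fintype.card_fin] at h2
  simp only [chartForm, Pi.zero_apply, Nat.add_sub_cancel' hr, h2] at h1
  exact one_ne_zero h1

/-- The characteristic values of a ring-set-homomorphism depend continuously on it, as a point
of the projective space of binary forms: those that run off to infinity move to `∞`. -/
lemma continuous_lineProj_chartForm :
    Continuous fun φ : RingSetHom n => lineProj (chartForm φ) := by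
  rw [continuous_def]
  intro U hU φ hφ
  have hr : (φ 1).rank ≤ n := (Matrix.rank_le_card_width _).trans_eq (Fintype.card_fin n)
  let W : (Fin n → ℂ) × Mat n → Fin (n + 1) → ℂ := fun w i =>
    ((∏ j, (1 - C (w.1 j) * X)) * w.2.charpoly).coeff (i + (n - (φ 1).rank))
  have hW : ContinuousAt W (0, φ X) := by
    rw [continuousAt_pi]
    intro i
    refine CoeffContinuousAt.mul (.prod fun j _ => (CoeffContinuousAt.const _).sub
      ((CoeffContinuousAt.C ?_).mul (.const _))) (.charpoly ?_) _
    · exact ((continuous_apply j).comp continuous_fst).continuousAt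
    · exact continuous_snd.continuousAt
  have hW0 : W (0, φ X) = chartForm φ := by
    funext i
    simp [W, chartForm]
  have hlW : ContinuousAt (fun w => lineProj (W w)) (0, φ X) :=
    ContinuousAt.comp (continuousAt_lineProj (by rw [hW0]; exact chartForm_ne_zero φ)) hW
  have hev : ∀ᶠ w in nhds ((0 : Fin n → ℂ), φ X), lineProj (W w) ∈ U :=
    hlW.eventually (hU.mem_nhds (by beta_reduce; rw [hW0]; exact hφ))
  rw [nhds_prod_eq] at hev
  obtain ⟨s, hs, t, ht, hst⟩ := Filter.eventually_prod_iff.1 hev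
  obtain ⟨δ, hδ, hs⟩ := Metric.eventually_nhds_iff.1 hs
  obtain ⟨ε, hε, ht⟩ := exists_entries_subset (n := n) (M₀ := φ X) (V := {M | t M}) ht
  have hm : 0 < min δ ε := lt_min hδ hε
  refine ⟨min δ ε, hm, ?_⟩
  rintro ψ ⟨e, ⟨f, hf⟩, he, hrank, -, hM, hmult, hroots⟩
  have hr' : (ψ 1).rank ≤ n := (Matrix.rank_le_card_width _).trans_eq (Fintype.card_fin n)
  obtain ⟨x, c, hc, hcx, hx⟩ := exists_charpoly_eq ((ψ 1 - e) * ψ X)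
  have hsx : s x := by
    refine hs ?_
    rw [dist_pi_lt_iff hδ]
    intro j
    rw [Pi.zero_apply, dist_zero_right]
    by_cases hj : x j = 0
    · rwa [hj, norm_zero]
    · have h1 := hroots _ (hx j hj) (inv_ne_zero hj)
      rw [norm_inv] at h1
      exact ((inv_lt_inv₀ hm (norm_pos_iff.2 hj)).1 h1).trans_le (min_le_left _ _)
  have htM : t (e * ψ X) := ht _ fun i j => (hM i j).trans_le (min_le_right _ _)
  have h1 : (e * ψ X) * ((ψ 1 - e) * ψ X) = 0 := by
    have h2 : e * ψ 1 = e := by rw [← hf, ringSetHom_mul_one]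
    have h3 : ψ X * (ψ 1 - e) = (ψ 1 - e) * ψ X := by
      rw [← hf, ← map_sub, ← map_mul, ← map_mul, mul_comm]
    rw [mul_assoc, ← mul_assoc (ψ X), h3, ← mul_assoc, ← mul_assoc, mul_sub, h2, he, sub_self,
      zero_mul, zero_mul]
  have h2 : e * ψ X + (ψ 1 - e) * ψ X = ψ X := by
    rw [← add_mul, add_sub_cancel, one_mul_ringSetHom]
  have h3 := charpoly_mul_charpoly_of_mul_eq_zero h1
  rw [h2, hcx] at h3
  have h4 : chartForm ψ = c • W (x, e * ψ X) := by
    funext i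
    have h5 := congrArg (fun p => p.coeff (i + (n - (ψ 1).rank) + n)) h3
    have e1 : (e * ψ X).charpoly * (C c * X ^ (((ψ 1 - e) * ψ X).charpoly.rootMultiplicity 0) *
        ∏ j, (1 - C (x j) * X)) = C c * (((∏ j, (1 - C (x j) * X)) * (e * ψ X).charpoly) *
          X ^ (((ψ 1 - e) * ψ X).charpoly.rootMultiplicity 0)) := by ring
    have e2 : i + (n - (ψ 1).rank) + n = i + (n - (φ 1).rank) +
        ((ψ 1 - e) * ψ X).charpoly.rootMultiplicity 0 := by omega
    rw [mul_comm (X ^ n), coeff_mul_X_pow, e1, e2, coeff_C_mul, coeff_mul_X_pow] at h5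
    exact h5.symm
  change lineProj (chartForm ψ) ∈ U
  rw [h4, lineProj_smul hc]
  exact hst hsx htM

/-- The chart at `U₀` already determines the cycle: characteristic values missing from `e₀ ℂⁿ` lie
at `∞`. -/
lemma chartForm_eq_cycleForm (φ : Mor n) : chartForm φ.φ₀ = cycleForm (morCycle φ) := by
  funext i
  rw [chartForm, charpoly_eq_X_pow_mul_cyclePoly, mul_comm, coeff_mul_X_pow]
  rfl

/-- Continuity can be tested on binary forms, and the form of a cycle depends on the chart at `U₀`
only. -/
lemma continuous_mapCycle : Continuous (mapCycle (n := n)) := by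
  refine continuous_coinduced_dom.2 (isEmbedding_lineProj_cycleForm.continuous_iff.2 ?_)
  have h1 : (fun s : SymP1 n => lineProj (cycleForm s)) ∘ (mapCycle ∘ Quotient.mk _) =
      (fun φ : RingSetHom n => lineProj (chartForm φ)) ∘ fun φ : Mor n => φ.φ₀ := by
    funext φ
    simp only [Function.comp_apply, chartForm_eq_cycleForm]
    rfl
  have h2 : Continuous fun φ : Mor n => φ.φ₀ :=
    continuous_fst.comp (f := fun φ : Mor n => (φ.φ₀, φ.φInf)) continuous_induced_dom
  exact h1 ▸ continuous_lineProj_chartForm.comp h2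

end CycleContinuity

/-! ### The embedding of the Hilbert scheme -/

section HilbertScheme

variable {n : ℕ}

/-- The subscheme cut out by a nonzero binary form. -/
noncomputable def hilbOfForm (a : {a : Fin (n + 1) → ℂ // a ≠ 0}) : Hilb n :=
  ⟨zeroScheme n a.1, hasLength_zeroScheme a.2⟩

lemma continuous_hilbOfForm : Continuous (hilbOfForm (n := n)) :=
  continuous_induced_rng.2 continuous_coinduced_rng

lemma continuous_of_comp_hilbOfForm {Y : Type*} [TopologicalSpace Y] {f : Hilb n → Y}
    (h : Continuous (f ∘ hilbOfForm)) : Continuous f := by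
  rw [continuous_def]
  intro V hV
  refine ⟨Subtype.val '' (f ⁻¹' V), ?_, Set.preimage_image_eq _ Subtype.val_injective⟩
  refine isOpen_coinduced.2 ?_
  convert h.isOpen_preimage V hV using 1
  ext a
  constructor
  · rintro ⟨Z, hZ, hZa⟩
    have : Z = hilbOfForm a := Subtype.ext hZa
    rw [this] at hZ
    exact hZ
  · intro ha
    exact ⟨hilbOfForm a, ha, rfl⟩

lemma zeroScheme_smul {s : ℂ} (hs : s ≠ 0) (a : Fin (n + 1) → ℂ) :
    zeroScheme n (s • a) = zeroScheme n a := by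
  have h₀ : form₀ (s • a) = C s * form₀ a := by
    simp [form₀, Finset.mul_sum, smul_eq_C_mul, mul_assoc]
  have hInf : formInf (s • a) = C s * formInf a := by
    simp [formInf, Finset.mul_sum, smul_eq_C_mul, mul_assoc]
  have hu : IsUnit (C s : ℂ[X]) := isUnit_C.2 (isUnit_iff_ne_zero.2 hs)
  refine ClosedSubscheme.ext ?_ ?_
  · change Ideal.span _ = Ideal.span _
    rw [h₀, Ideal.span_singleton_mul_left_unit hu]
  · change Ideal.span _ = Ideal.span _
    rw [hInf, Ideal.span_singleton_mul_left_unit hu]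

/-- The subscheme of `ℙ¹` with a given cycle. -/
noncomputable def hilbOfCycle (s : SymP1 n) : Hilb n :=
  hilbOfForm ⟨cycleForm s, cycleForm_ne_zero s⟩

lemma continuous_hilbOfCycle : Continuous (hilbOfCycle (n := n)) := by
  refine continuous_coinduced_dom.2 (continuous_iff_continuousAt.2 fun p₀ => ?_)
  obtain ⟨w, hw, hws⟩ := exists_lift_cycleForm p₀
  have hw0 : ∀ p, w p ≠ 0 := fun p => by
    obtain ⟨s, hs, h⟩ := hws p
    rw [h]
    exact smul_ne_zero hs (cycleForm_ne_zero _)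
  have h1 : hilbOfCycle ∘ SymP1.ofPoints = hilbOfForm ∘ fun p => ⟨w p, hw0 p⟩ := by
    funext p
    obtain ⟨s, hs, h⟩ := hws p
    refine Subtype.ext ?_
    change zeroScheme n _ = zeroScheme n (w p)
    rw [h, zeroScheme_smul hs]
  rw [h1]
  exact continuous_hilbOfForm.continuousAt.comp
    (Topology.IsInducing.subtypeVal.continuousAt_iff.2 hw)

/-- The class of the morphisms with a given image of length `n`. -/
noncomputable def hilbMap (Z : Hilb n) : MapSpace n := ⟦(exists_image_eq Z.2).choose⟧

lemma image_hilbMap (Z : Hilb n) : (hilbMap Z).image = Z.1 := (exists_image_eq Z.2).choose_spec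

lemma hilbMap_eq {Z : Hilb n} {φ : Mor n} (h : φ.image = Z.1) : hilbMap Z = ⟦φ⟧ :=
  mk_eq_of_image_eq ((image_hilbMap Z).trans h.symm)
    ((congrArg (fun W => W.HasLength n) (image_hilbMap Z)).mpr Z.2)

lemma continuous_eval_form₀ (c : ℂ) :
    Continuous fun a : Fin (n + 1) → ℂ => (form₀ a).eval c := by
  simp only [form₀, eval_finsetSum, eval_smul, eval_pow, eval_X]
  fun_prop

lemma coeffContinuousAt_affForm_form₀ (c : ℂ) (a₀ : Fin (n + 1) → ℂ) :
    CoeffContinuousAt (fun a : Fin (n + 1) → ℂ => affForm c n (form₀ a)) a₀ := by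
  intro k
  have h : CoeffContinuousAt (fun a : Fin (n + 1) → ℂ => ∑ i, C (a i) * (X + C c) ^ (i : ℕ)) a₀ :=
    .sum fun i _ => (CoeffContinuousAt.C (continuousAt_apply i a₀)).mul (.const _)
  have h1 : ∀ a : Fin (n + 1) → ℂ, (affForm c n (form₀ a)).coeff k =
      (∑ i, C (a i) * (X + C c) ^ (i : ℕ)).coeff (revAt n k) := by
    intro a
    rw [affForm, coeff_reflect, form₀, Polynomial.comp, eval₂_finsetSum]
    simp [smul_eq_C_mul]
  simp only [h1]
  exact h _

lemma continuousAt_formMatrix {c : ℂ} {a₀ : Fin (n + 1) → ℂ} (hc : (form₀ a₀).eval c ≠ 0) :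
    ContinuousAt (fun a => formMatrix c a) a₀ := by
  refine continuousAt_pi.2 fun i => continuousAt_pi.2 fun j => ?_
  simp only [formMatrix, companion, Matrix.of_apply]
  split_ifs with h h'
  · exact (((continuous_eval_form₀ c).continuousAt.inv₀ hc).mul
      (coeffContinuousAt_affForm_form₀ c a₀ i)).neg
  · exact continuousAt_const
  · exact continuousAt_const

/-- Near a given subscheme, the companion matrix of the equation in a coordinate `1 / (y₀ - c)` with
`c` off the subscheme is a continuous choice of morphism. -/
lemma continuous_hilbMap : Continuous (hilbMap (n := n)) := by
  refine continuous_of_comp_hilbOfForm (continuous_iff_continuousAt.2 fun a₀ => ?_)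
  obtain ⟨c, hc⟩ := exists_eval_form₀_ne_zero a₀.2
  have hev : ∀ᶠ a in nhds a₀, (form₀ a.1).eval c ≠ 0 :=
    ((continuous_eval_form₀ c).comp continuous_subtype_val).continuousAt.eventually_ne hc
  have h1 : (fun a : {a : Fin (n + 1) → ℂ // a ≠ 0} =>
      (⟦affineMor c (formMatrix c a.1)⟧ : MapSpace n))
      =ᶠ[nhds a₀] hilbMap ∘ hilbOfForm := by
    filter_upwards [hev] with a ha
    exact (hilbMap_eq (image_formMatrix ha)).symm
  refine ContinuousAt.congr ?_ h1
  have h2 : ContinuousAt (fun a : {a : Fin (n + 1) → ℂ // a ≠ 0} => formMatrix c a.1) a₀ :=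
    ContinuousAt.comp (f := Subtype.val) (continuousAt_formMatrix hc)
      continuous_subtype_val.continuousAt
  exact (continuous_quotient_mk'.comp (continuous_affineMor c)).continuousAt.comp h2

/-- The subscheme of the cycle of a morphism is a continuous left inverse: a morphism whose image
has length `n` has equal minimal and characteristic polynomials. -/
theorem isEmbedding_hilbMap : Topology.IsEmbedding (hilbMap (n := n)) := by
  refine Function.LeftInverse.isEmbedding (f := hilbOfCycle ∘ mapCycle) ?_
    (continuous_hilbOfCycle.comp continuous_mapCycle) continuous_hilbMap
  intro Z
  obtain ⟨φ, hφ⟩ := exists_image_eq Z.2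
  rw [hilbMap_eq hφ]
  refine Subtype.ext ?_
  have h := image_eq_zeroScheme_cycleForm (φ := φ) (hφ ▸ Z.2)
  exact h.trans hφ

theorem range_hilbMap : Set.range (hilbMap (n := n)) = {x | x.image.HasLength n} := by
  ext x
  constructor
  · rintro ⟨Z, rfl⟩
    change (hilbMap Z).image.HasLength n
    rw [image_hilbMap]
    exact Z.2
  · intro hx
    induction x using Quotient.inductionOn with
    | _ φ => exact ⟨⟨φ.image, hx⟩, hilbMap_eq rfl⟩

end HilbertScheme

/-! ### The embedding of the Chow variety -/

section ChowVariety

variable {n : ℕ}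

lemma tendsto_add_const_cocompact (c : ℂ) :
    Filter.Tendsto (fun a : ℂ => a + c) (Filter.cocompact ℂ) (Filter.cocompact ℂ) :=
  (Homeomorph.addRight c).isClosedEmbedding.tendsto_cocompact

lemma continuousAt_affCoord {c : ℂ} {p : P1} (hp : p ≠ (c : P1)) :
    ContinuousAt (affCoord c) p := by
  induction p using OnePoint.rec with
  | coe a =>
    rw [OnePoint.continuousAt_coe]
    refine ContinuousAt.inv₀ (by fun_prop) (sub_ne_zero.2 fun h => hp (by rw [h]))
  | infty =>
    rw [OnePoint.continuousAt_infty', Filter.coclosedCompact_eq_cocompact]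
    have h1 := tendsto_add_const_cocompact (-c)
    rw [← Metric.cobounded_eq_cocompact] at h1 ⊢
    simp only [← sub_eq_add_neg] at h1
    exact Filter.tendsto_inv₀_cobounded.comp h1

lemma continuous_affPoint (c : ℂ) : Continuous (affPoint c) := by
  rw [continuous_iff_continuousAt]
  intro z
  by_cases hz : z = 0
  · subst hz
    rw [← continuousWithinAt_compl_self, ContinuousWithinAt]
    have h1 : affPoint c 0 = OnePoint.infty := if_pos rfl
    rw [h1]
    have h2 : Filter.Tendsto (fun z : ℂ => z⁻¹) (nhdsWithin 0 {0}ᶜ) (Filter.cocompact ℂ) := by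
      rw [← Metric.cobounded_eq_cocompact]
      exact Filter.tendsto_inv₀_nhdsNE_zero
    have h3 := (tendsto_add_const_cocompact c).comp h2
    rw [← Filter.coclosedCompact_eq_cocompact] at h3
    refine (OnePoint.tendsto_coe_infty.comp h3).congr' ?_
    filter_upwards [self_mem_nhdsWithin] with z hz
    change ((z⁻¹ + c : ℂ) : P1) = affPoint c z
    rw [affPoint, if_neg (by simpa using hz), add_comm]
  · have h1 : ContinuousAt (fun z : ℂ => ((c + z⁻¹ : ℂ) : P1)) z :=
      OnePoint.continuous_coe.continuousAt.comp (f := fun z : ℂ => c + z⁻¹)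
        (continuousAt_const.add (continuousAt_inv₀ hz))
    refine h1.congr ?_
    filter_upwards [isOpen_ne.mem_nhds hz] with w hw
    rw [affPoint, if_neg hw]

lemma exists_coe_not_mem (s : Finset P1) (t : Finset ℂ) : ∃ c : ℂ, c ∉ t ∧ (c : P1) ∉ s := by
  classical
  obtain ⟨c, hc⟩ := Infinite.exists_notMem_finset
    (t ∪ s.preimage ((↑) : ℂ → P1) OnePoint.coe_injective.injOn)
  rw [Finset.mem_union, Finset.mem_preimage, not_or] at hc
  exact ⟨c, hc⟩

lemma exists_coe_ne (p : Fin n → P1) : ∃ c : ℂ, ∀ i, p i ≠ (c : P1) := by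
  classical
  obtain ⟨c, -, hc⟩ := exists_coe_not_mem (Finset.univ.image p) ∅
  exact ⟨c, fun i hi => hc (hi ▸ Finset.mem_image_of_mem p (Finset.mem_univ i))⟩

/-- The diagonal morphism with given entries. -/
noncomputable def diagMor (p : Fin n → P1) : Mor n :=
  affineMor (exists_coe_ne p).choose
    (Matrix.diagonal fun i => affCoord (exists_coe_ne p).choose (p i))

lemma affineMor_diagonal_affCoord₀ {p : Fin n → P1} {c : ℂ} (hc : ∀ i, p i ≠ (c : P1)) (f : ℂ[X]) :
    (affineMor c (Matrix.diagonal fun i => affCoord c (p i))).φ₀ f =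
      Matrix.diagonal fun i => eval₀ f (p i) := by
  simp only [affineMor_diagonal₀, affPoint_affCoord (hc _)]

lemma affineMor_diagonal_affCoordInf {p : Fin n → P1} {c : ℂ} (hc : ∀ i, p i ≠ (c : P1))
    (f : ℂ[X]) :
    (affineMor c (Matrix.diagonal fun i => affCoord c (p i))).φInf f =
      Matrix.diagonal fun i => evalInf f (p i) := by
  simp only [affineMor_diagonalInf, affPoint_affCoord (hc _)]

lemma diagMor₀ (p : Fin n → P1) (f : ℂ[X]) :
    (diagMor p).φ₀ f = Matrix.diagonal fun i => eval₀ f (p i) :=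
  affineMor_diagonal_affCoord₀ (exists_coe_ne p).choose_spec f

lemma diagMorInf (p : Fin n → P1) (f : ℂ[X]) :
    (diagMor p).φInf f = Matrix.diagonal fun i => evalInf f (p i) :=
  affineMor_diagonal_affCoordInf (exists_coe_ne p).choose_spec f

lemma affineMor_diagonal_affCoord {p : Fin n → P1} {c : ℂ} (hc : ∀ i, p i ≠ (c : P1)) :
    affineMor c (Matrix.diagonal fun i => affCoord c (p i)) = diagMor p :=
  mor_ext (fun f => by rw [affineMor_diagonal_affCoord₀ hc, diagMor₀])
    (fun f => by rw [affineMor_diagonal_affCoordInf hc, diagMorInf])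

lemma exists_perm_of_ofPoints_eq {p q : Fin n → P1} (h : SymP1.ofPoints p = SymP1.ofPoints q) :
    ∃ σ : Equiv.Perm (Fin n), ∀ i, q (σ i) = p i := by
  classical
  have h1 : ∀ a, Nonempty ({i // p i = a} ≃ {i // q i = a}) := fun a => by
    rw [← Fintype.card_eq, Fintype.card_subtype, Fintype.card_subtype]
    have h2 := mult_ofPoints p a
    have h3 := mult_ofPoints q a
    rw [h] at h2
    exact h2.symm.trans h3
  let e := fun a => (h1 a).some
  exact ⟨Equiv.ofFiberEquiv e, fun i => Equiv.ofFiberEquiv_map e i⟩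

/-- The permutation matrix of `σ`, as a unit. -/
def permUnit (σ : Equiv.Perm (Fin n)) : (Mat n)ˣ where
  val := σ.permMatrix ℂ
  inv := σ⁻¹.permMatrix ℂ
  val_inv := by rw [← Matrix.permMatrix_mul, inv_mul_cancel, Matrix.permMatrix_one]
  inv_val := by rw [← Matrix.permMatrix_mul, mul_inv_cancel, Matrix.permMatrix_one]

lemma conjHom_permUnit_diagonal (σ : Equiv.Perm (Fin n)) (x : Fin n → ℂ) :
    conjHom (permUnit σ) (Matrix.diagonal x) = Matrix.diagonal fun i => x (σ i) := by
  rw [conjHom_apply, Units.mul_inv_eq_iff_eq_mul]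
  ext i j
  rw [Matrix.mul_diagonal, Matrix.diagonal_mul]
  change σ.permMatrix ℂ i j * x j = x (σ i) * σ.permMatrix ℂ i j
  by_cases hij : σ i = j
  · rw [hij, mul_comm]
  · simp [Equiv.Perm.permMatrix, PEquiv.toMatrix_apply, hij]

lemma mk_diagMor_eq {p q : Fin n → P1} (h : SymP1.ofPoints p = SymP1.ofPoints q) :
    (⟦diagMor p⟧ : MapSpace n) = ⟦diagMor q⟧ := by
  obtain ⟨σ, hσ⟩ := exists_perm_of_ofPoints_eq h
  obtain ⟨c, hc⟩ := exists_coe_ne q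
  rw [← affineMor_diagonal_affCoord hc, ← mk_affineMor_conjHom (permUnit σ),
    conjHom_permUnit_diagonal, ← affineMor_diagonal_affCoord (p := p) (c := c)]
  · simp only [hσ]
  · exact fun i => hσ i ▸ hc (σ i)

/-- The class of the diagonal morphisms with the points of a given cycle as entries. -/
noncomputable def chowMap (s : SymP1 n) : MapSpace n := ⟦diagMor (ofPoints_surjective s).choose⟧

lemma chowMap_ofPoints (p : Fin n → P1) : chowMap (SymP1.ofPoints p) = ⟦diagMor p⟧ :=
  mk_diagMor_eq (ofPoints_surjective (SymP1.ofPoints p)).choose_spec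

lemma continuous_chowMap : Continuous (chowMap (n := n)) := by
  refine continuous_coinduced_dom.2 (continuous_iff_continuousAt.2 fun p₀ => ?_)
  obtain ⟨c, hc⟩ := exists_coe_ne p₀
  have hev : ∀ᶠ p : Fin n → P1 in nhds p₀, ∀ i, p i ≠ (c : P1) := by
    rw [Filter.eventually_all]
    exact fun i => (continuous_apply i).continuousAt.eventually_ne (hc i)
  have h1 : (fun p : Fin n → P1 => (⟦affineMor c (Matrix.diagonal fun i => affCoord c (p i))⟧ :
      MapSpace n)) =ᶠ[nhds p₀] chowMap ∘ SymP1.ofPoints := by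
    filter_upwards [hev] with p hp
    rw [Function.comp_apply, chowMap_ofPoints, affineMor_diagonal_affCoord hp]
  refine ContinuousAt.congr ?_ h1
  have h2 : ContinuousAt (fun p : Fin n → P1 => fun i => affCoord c (p i)) p₀ :=
    continuousAt_pi.2 fun i => ContinuousAt.comp (f := fun p : Fin n → P1 => p i)
      (continuousAt_affCoord (hc i)) (continuousAt_apply i p₀)
  have h3 : Continuous fun x : Fin n → ℂ => (Matrix.diagonal x : Mat n) :=
    continuous_id.matrix_diagonal
  exact (continuous_quotient_mk'.comp ((continuous_affineMor c).comp h3)).continuousAt.comp h2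

lemma morCycle_diagMor (p : Fin n → P1) : morCycle (diagMor p) = SymP1.ofPoints p := by
  classical
  obtain ⟨c, hc⟩ := exists_coe_ne p
  rw [← affineMor_diagonal_affCoord hc, morCycle_affineMor]
  have h1 : (Matrix.diagonal fun i => affCoord c (p i)).charpoly.roots =
      Finset.univ.val.map fun i => affCoord c (p i) := by
    rw [Matrix.charpoly_diagonal, ← roots_multiset_prod_X_sub_C (Finset.univ.val.map fun i =>
      affCoord c (p i)), Multiset.map_map]
    rfl
  refine Subtype.ext ?_
  change Multiset.map _ (Matrix.charpoly _).roots = Finset.univ.val.map p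
  rw [h1, Multiset.map_map]
  refine Multiset.map_congr rfl fun i _ => ?_
  exact affPoint_affCoord (hc i)

lemma leftInverse_mapCycle_chowMap : Function.LeftInverse (mapCycle (n := n)) chowMap := by
  intro s
  obtain ⟨p, rfl⟩ := ofPoints_surjective s
  rw [chowMap_ofPoints, mapCycle_mk, morCycle_diagMor]

/-- The cycle of a morphism is a continuous left inverse. -/
theorem isEmbedding_chowMap : Topology.IsEmbedding (chowMap (n := n)) :=
  leftInverse_mapCycle_chowMap.isEmbedding continuous_mapCycle continuous_chowMap

end ChowVariety

/-! ### Diagonalizable morphisms -/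

section Diagonalizable

variable {n : ℕ}

lemma conjHom_injective (g : (Mat n)ˣ) : Function.Injective (conjHom g) := fun x y hxy => by
  rw [conjHom_apply, conjHom_apply] at hxy
  exact g.isUnit.mul_right_injective (g⁻¹.isUnit.mul_left_injective hxy)

lemma exists_eq_conjHom (g : (Mat n)ˣ) (A : Mat n) : ∃ B, A = conjHom g B :=
  ⟨conjHom g⁻¹ A, by simp [conjHom_apply, mul_assoc]⟩

/-- In the basis of the columns of `g`, the morphism `φ` is the diagonal morphism with entries
`p`. -/
def IsDiagIn (φ : Mor n) (g : (Mat n)ˣ) (p : Fin n → P1) : Prop :=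
  ∀ f, φ.φ₀ f = conjHom g (Matrix.diagonal fun i => eval₀ f (p i)) ∧
    φ.φInf f = conjHom g (Matrix.diagonal fun i => evalInf f (p i))

/-- The `i`-th coordinate of a vector in the basis of the columns of `g`. -/
noncomputable def colCoord (g : (Mat n)ˣ) (v : Fin n → ℂ) (i : Fin n) : ℂ :=
  ((g⁻¹ : (Mat n)ˣ) : Mat n).mulVec v i

lemma mulVec_colCoord (g : (Mat n)ˣ) (v : Fin n → ℂ) : (g : Mat n).mulVec (colCoord g v) = v := by
  change (g : Mat n).mulVec (Matrix.mulVec _ v) = v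
  rw [Matrix.mulVec_mulVec, Units.mul_inv, Matrix.one_mulVec]

lemma colCoord_mulVec (g : (Mat n)ˣ) (w : Fin n → ℂ) : colCoord g ((g : Mat n).mulVec w) = w := by
  change Matrix.mulVec _ (Matrix.mulVec _ w) = w
  rw [Matrix.mulVec_mulVec, Units.inv_mul, Matrix.one_mulVec]

lemma colCoord_add (g : (Mat n)ˣ) (v w : Fin n → ℂ) :
    colCoord g (v + w) = colCoord g v + colCoord g w := Matrix.mulVec_add _ _ _

lemma colCoord_smul (g : (Mat n)ˣ) (s : ℂ) (v : Fin n → ℂ) :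
    colCoord g (s • v) = s • colCoord g v := Matrix.mulVec_smul _ _ _

lemma colCoord_conjHom_mulVec (g : (Mat n)ˣ) (B : Mat n) (v : Fin n → ℂ) :
    colCoord g ((conjHom g B).mulVec v) = B.mulVec (colCoord g v) := by
  change Matrix.mulVec _ (Matrix.mulVec _ v) = B.mulVec (Matrix.mulVec _ v)
  rw [conjHom_apply, Matrix.mulVec_mulVec, Matrix.mulVec_mulVec, ← mul_assoc, ← mul_assoc,
    Units.inv_mul, one_mul]

lemma colCoord_injective (g : (Mat n)ˣ) : Function.Injective (colCoord g) :=
  Function.LeftInverse.injective (mulVec_colCoord g)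

/-- The classes in the Chow locus are those of the morphisms that are diagonal in some basis. -/
lemma mk_eq_iff_isDiagIn {φ : Mor n} {p : Fin n → P1} :
    (⟦φ⟧ : MapSpace n) = ⟦diagMor p⟧ ↔ ∃ g, IsDiagIn φ g p := by
  constructor
  · intro h
    obtain ⟨g, hg⟩ := Quotient.exact h.symm
    exact ⟨g, fun f => ⟨(hg f).1.trans (by rw [diagMor₀]; rfl),
      (hg f).2.trans (by rw [diagMorInf]; rfl)⟩⟩
  · rintro ⟨g, hg⟩
    refine (Quotient.sound (s := Mor.setoid n) ⟨g, fun f => ⟨?_, ?_⟩⟩ :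
      (⟦diagMor p⟧ : MapSpace n) = ⟦φ⟧).symm
    · rw [diagMor₀]; exact (hg f).1
    · rw [diagMorInf]; exact (hg f).2

lemma isDiagIn_affineMor (g : (Mat n)ˣ) (c : ℂ) (x : Fin n → ℂ) :
    IsDiagIn (affineMor c (conjHom g (Matrix.diagonal x))) g fun i => affPoint c (x i) :=
  fun f => ⟨by rw [affineMor_conjHom₀, affineMor_diagonal₀],
    by rw [affineMor_conjHomInf, affineMor_diagonalInf]⟩

namespace IsDiagIn

variable {φ : Mor n} {g : (Mat n)ˣ} {p : Fin n → P1}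

lemma unique {ψ : Mor n} (h : IsDiagIn φ g p) (h' : IsDiagIn ψ g p) : φ = ψ :=
  mor_ext (fun f => (h f).1.trans (h' f).1.symm) (fun f => (h f).2.trans (h' f).2.symm)

lemma mk_eq (h : IsDiagIn φ g p) : (⟦φ⟧ : MapSpace n) = chowMap (SymP1.ofPoints p) := by
  rw [chowMap_ofPoints]
  exact mk_eq_iff_isDiagIn.2 ⟨g, h⟩

lemma eq_affineMor (h : IsDiagIn φ g p) {c : ℂ} (hc : ∀ i, p i ≠ (c : P1)) :
    φ = affineMor c (conjHom g (Matrix.diagonal fun i => affCoord c (p i))) := by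
  refine h.unique ?_
  have := isDiagIn_affineMor g c fun i => affCoord c (p i)
  simpa only [affPoint_affCoord (hc _)] using this

lemma mem_chanPaton (h : IsDiagIn φ g p) {q : P1} {v : Fin n → ℂ} :
    v ∈ φ.chanPaton q ↔ ∀ j, p j ≠ q → colCoord g v j = 0 := by
  classical
  obtain ⟨c, -, hc⟩ := exists_coe_not_mem (insert q (Finset.univ.image p)) ∅
  rw [Finset.mem_insert, not_or] at hc
  have hcp : ∀ i, p i ≠ (c : P1) := fun i hi =>
    hc.2 (hi ▸ Finset.mem_image_of_mem p (Finset.mem_univ i))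
  have hq : affPoint c (affCoord c q) = q := affPoint_affCoord fun hq => hc.1 hq.symm
  have hpq : ∀ j, p j ≠ q ↔ affCoord c (p j) - affCoord c q ≠ 0 := by
    intro j
    rw [Ne, Ne, sub_eq_zero, ← (affPoint_injective c).eq_iff, hq, affPoint_affCoord (hcp j)]
  rw [h.eq_affineMor hcp, ← hq, chanPaton_affineMor, hq, mem_maxGenEigenspace_toLin']
  have e1 : ∀ k : ℕ, (conjHom g (Matrix.diagonal fun i => affCoord c (p i)) -
      algebraMap ℂ (Mat n) (affCoord c q)) ^ k =
        conjHom g (Matrix.diagonal fun i => (affCoord c (p i) - affCoord c q) ^ k) := by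
    intro k
    have e2 : algebraMap ℂ (Mat n) (affCoord c q) = Matrix.diagonal fun _ => affCoord c q := rfl
    rw [← AlgHom.commutes (conjHom g), ← map_sub, ← map_pow, e2, Matrix.diagonal_sub,
      Matrix.diagonal_pow]
    rfl
  have e3 : ∀ k : ℕ, ((conjHom g (Matrix.diagonal fun i => affCoord c (p i)) -
      algebraMap ℂ (Mat n) (affCoord c q)) ^ k).mulVec v = 0 ↔
        ∀ j, (affCoord c (p j) - affCoord c q) ^ k * colCoord g v j = 0 := by
    intro k
    rw [e1, ← (colCoord_injective g).eq_iff, colCoord_conjHom_mulVec, funext_iff]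
    have e4 : colCoord g 0 = 0 := Matrix.mulVec_zero _
    simp only [Matrix.mulVec_diagonal, e4, Pi.zero_apply]
  simp only [e3, hpq]
  constructor
  · rintro ⟨k, hk⟩ j hj
    exact (mul_eq_zero.1 (hk j)).resolve_left (pow_ne_zero k hj)
  · intro hv
    refine ⟨1, fun j => ?_⟩
    by_cases hj : affCoord c (p j) - affCoord c q = 0
    · rw [hj, pow_one, zero_mul]
    · rw [hv j hj, mul_zero]

/-- In the basis of the columns of `g`, the gauge algebra consists of the block matrices. -/
lemma mem_gauge (h : IsDiagIn φ g p) {B : Mat n} :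
    conjHom g B ∈ φ.gauge ↔ ∀ i j, p i ≠ p j → B i j = 0 := by
  have hinj := conjHom_injective g
  have e1 : conjHom g B ∈ φ.gauge ↔ ∀ f,
      (Matrix.diagonal (fun i => eval₀ f (p i)) * B = B * Matrix.diagonal fun i => eval₀ f (p i)) ∧
      (Matrix.diagonal (fun i => evalInf f (p i)) * B =
        B * Matrix.diagonal fun i => evalInf f (p i)) := by
    rw [Mor.gauge, Subalgebra.mem_centralizer_iff]
    constructor
    · intro hB f
      refine ⟨hinj ?_, hinj ?_⟩
      · rw [map_mul, map_mul, ← (h f).1]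
        exact hB _ (Or.inl ⟨f, rfl⟩)
      · rw [map_mul, map_mul, ← (h f).2]
        exact hB _ (Or.inr ⟨f, rfl⟩)
    · rintro hB _ (⟨f, rfl⟩ | ⟨f, rfl⟩)
      · rw [(h f).1, ← map_mul, ← map_mul, (hB f).1]
      · rw [(h f).2, ← map_mul, ← map_mul, (hB f).2]
  have e2 : ∀ x : Fin n → ℂ, (Matrix.diagonal x * B = B * Matrix.diagonal x) ↔
      ∀ i j, x i ≠ x j → B i j = 0 := by
    intro x
    rw [← Matrix.ext_iff]
    simp only [Matrix.diagonal_mul, Matrix.mul_diagonal]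
    refine forall_congr' fun i => forall_congr' fun j => ?_
    rw [mul_comm, mul_eq_mul_left_iff]
    tauto
  rw [e1]
  simp only [e2]
  constructor
  · intro hB i j hij
    revert hij
    have hX := (hB X).1 i j
    have h1 := (hB 1).1 i j
    generalize p i = a at *
    generalize p j = b at *
    intro hab
    induction a using OnePoint.rec with
    | infty =>
      induction b using OnePoint.rec with
      | infty => exact absurd rfl hab
      | coe b =>
        refine h1 ?_
        change (0 : ℂ) ≠ (1 : ℂ[X]).eval b
        simp
    | coe a =>
      induction b using OnePoint.rec with
      | infty =>
        refine h1 ?_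
        change (1 : ℂ[X]).eval a ≠ (0 : ℂ)
        simp
      | coe b =>
        refine hX ?_
        change (X : ℂ[X]).eval a ≠ (X : ℂ[X]).eval b
        rw [eval_X, eval_X]
        exact fun h => hab (by rw [h])
  · exact fun hB f => ⟨fun i j hij => hB i j fun h' => hij (by rw [h']),
      fun i j hij => hB i j fun h' => hij (by rw [h'])⟩

end IsDiagIn

end Diagonalizable

/-! ### Reduced images -/

section ReducedImages

variable {n : ℕ}

lemma map_pow_succ_ringSetHom (ψ : RingSetHom n) (u : ℂ[X]) (k : ℕ) :
    ψ (u ^ (k + 1)) = ψ u ^ (k + 1) := by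
  induction k with
  | zero => rw [zero_add, pow_one, pow_one]
  | succ k ih => rw [pow_succ, map_mul, ih, ← pow_succ]

lemma eq_zero_of_pow_of_reduced {ψ : RingSetHom n} (hψ : IsReduced (ℂ[X] ⧸ kerIdeal ψ)) {N : Mat n}
    (hN : N ∈ Set.range ψ) {k : ℕ} (h : N ^ (k + 1) = 0) : N = 0 := by
  obtain ⟨u, rfl⟩ := hN
  rw [← map_pow_succ_ringSetHom] at h
  exact (Ideal.isRadical_iff_quotient_reduced _).2 hψ ⟨k + 1, h⟩

/-- If the image is reduced, the algebra of an affine coordinate `R` has no nilpotent elements: both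
charts kill them, and the charts cover. The assumption `c ≠ 0` makes `R` a polynomial in
`1 + c R`. -/
lemma aeval_eq_zero_of_reduced {c : ℂ} (hc : c ≠ 0) {R : Mat n}
    (hred : (affineMor c R).image.Reduced) {a : ℂ[X]} {k : ℕ} (h : aeval R a ^ (k + 1) = 0) :
    aeval R a = 0 := by
  have hD := isDrazin_drazin R
  have hD' := isDrazin_drazin (1 + c • R)
  have hcR : Commute R (1 + c • R) :=
    (Commute.one_right R).add_right ((Commute.refl R).smul_right c)
  have hpow : ∀ e : Mat n, Commute e (aeval R a) → (e * aeval R a) ^ (k + 1) = 0 := by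
    intro e he
    rw [he.mul_pow, h, mul_zero]
  have hcomm : ∀ x : Mat n, Commute x R → Commute x (aeval R a) := fun x hx =>
    Algebra.commute_of_mem_adjoin_singleton_of_commute (aeval_mem_adjoin_singleton ℂ R) hx
  have h0 : R * drazin R * aeval R a = 0 := by
    refine eq_zero_of_pow_of_reduced hred.1 (aeval_mem_range_chart (A := 1 + c • R) (α := 1)
      (β := -c) ?_ hcR.symm hD (fun f => affineMor_apply₀ hD f) a) (hpow _ (hcomm _ ?_))
    · rw [one_smul, neg_smul, add_neg_cancel_right]
    · exact (Commute.refl R).mul_left hD.comm.symm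
  have h1 : (1 + c • R) * drazin (1 + c • R) * aeval R a = 0 := by
    have e1 : aeval R a = aeval (1 + c • R) (a.comp (C c⁻¹ * (X - 1))) := by
      rw [aeval_comp]
      congr 1
      rw [map_mul, map_sub, aeval_X, map_one, aeval_C, add_sub_cancel_left,
        Algebra.algebraMap_eq_smul_one, smul_mul_smul_comm, one_mul, inv_mul_cancel₀ hc, one_smul]
    have h2 := aeval_mem_range_chart (A := R) (B := 1 + c • R) (α := -c) (β := 1) (by
      rw [one_smul, neg_smul, neg_add_cancel_comm_assoc]) hcR hD'
      (fun f => affineMor_applyInf hD' f) (a.comp (C c⁻¹ * (X - 1)))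
    rw [← e1] at h2
    refine eq_zero_of_pow_of_reduced hred.2 h2 (hpow _ (hcomm _ ?_))
    obtain ⟨q, hq⟩ := hD'.exists_aeval
    rw [hq]
    exact hcR.symm.mul_left (Algebra.commute_of_mem_adjoin_singleton_of_commute
      (aeval_mem_adjoin_singleton ℂ _) hcR).symm
  have h2 := (affineMor c R).cover
  rw [affineMor_apply₀ hD, affineMor_applyInf hD', map_one, map_one, mul_one, mul_one] at h2
  calc aeval R a = 1 * aeval R a := (one_mul _).symm
    _ = 0 := by rw [h2, sub_mul, add_mul, h0, h1, mul_assoc, h1, mul_zero, add_zero, sub_zero]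

lemma exists_eq_conjHom_diagonal {R : Mat n} (hR : Squarefree (minpoly ℂ R)) :
    ∃ (g : (Mat n)ˣ) (x : Fin n → ℂ), R = conjHom g (Matrix.diagonal x) := by
  have h1 : Module.End.IsSemisimple (Matrix.toLin' R) :=
    Module.End.isSemisimple_of_squarefree_aeval_eq_zero hR (by
      change aeval (Matrix.toLinAlgEquiv' R) (minpoly ℂ R) = 0
      rw [aeval_algHom_apply, minpoly.aeval, map_zero])
  have h2 := h1.iSup_eigenspace_eq_top
  let s : Set (Fin n → ℂ) := {v | ∃ z : ℂ, R.mulVec v = z • v}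
  have hs : ⊤ ≤ Submodule.span ℂ s := by
    rw [← h2, iSup_le_iff]
    intro z v hv
    exact Submodule.subset_span ⟨z, Module.End.mem_eigenspace_iff.1 hv⟩
  let b₀ := Module.Basis.ofSpan hs
  have : Fintype ((linearIndepOn_empty ℂ (id : (Fin n → ℂ) → (Fin n → ℂ))).extend
      (Set.empty_subset s)) := FiniteDimensional.fintypeBasisIndex b₀
  let b := b₀.reindex (Fintype.equivFinOfCardEq (by
    rw [← Module.finrank_eq_card_basis b₀, Module.finrank_fin_fun]))
  have hb : ∀ i, ∃ z : ℂ, R.mulVec (b i) = z • b i := by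
    intro i
    refine Module.Basis.ofSpan_subset hs ?_
    simp [b, b₀]
  choose x hx using hb
  let e := Pi.basisFun ℂ (Fin n)
  refine ⟨⟨e.toMatrix b, b.toMatrix e, Module.Basis.toMatrix_mul_toMatrix_flip _ _,
    Module.Basis.toMatrix_mul_toMatrix_flip _ _⟩, x, ?_⟩
  rw [conjHom_apply, Units.eq_mul_inv_iff_mul_eq]
  ext i j
  rw [Matrix.mul_diagonal]
  have h3 := congrFun (hx j) i
  simp only [Pi.smul_apply, smul_eq_mul] at h3
  rw [mul_comm]
  exact h3

/-- If the image is reduced, the minimal polynomial of an affine coordinate is squarefree, so the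
morphism is diagonalizable. -/
theorem exists_isDiagIn_of_reduced {φ : Mor n} (hred : φ.image.Reduced) :
    ∃ g p, IsDiagIn φ g p := by
  classical
  obtain ⟨S, hS⟩ := exists_eq_affineMor φ
  obtain ⟨c, hc⟩ := Infinite.exists_notMem_finset (insert 0 S)
  rw [Finset.mem_insert, not_or] at hc
  obtain ⟨R, rfl⟩ := hS c hc.2
  have h1 : IsRadical (minpoly ℂ R) := by
    intro k a hk
    rw [minpoly.dvd_iff] at hk ⊢
    refine aeval_eq_zero_of_reduced (Ne.symm hc.1 ∘ Eq.symm) hred (k := k) ?_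
    rw [← map_pow, pow_succ, map_mul, hk, zero_mul]
  obtain ⟨g, x, rfl⟩ := exists_eq_conjHom_diagonal (h1.squarefree
    (minpoly.ne_zero (Algebra.IsIntegral.isIntegral R)))
  exact ⟨g, _, isDiagIn_affineMor g c x⟩

open Classical in
lemma natDegree_minpoly_diagonal (x : Fin n → ℂ) :
    (minpoly ℂ (Matrix.diagonal x : Mat n)).natDegree = (Finset.univ.image x).card := by
  have h0 : ∀ f : ℂ[X], minpoly ℂ (Matrix.diagonal x : Mat n) ∣ f ↔ ∀ i, f.eval (x i) = 0 := by
    intro f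
    rw [minpoly.dvd_iff, aeval_diagonal, Matrix.diagonal_eq_zero, funext_iff]
    rfl
  have h1 : minpoly ℂ (Matrix.diagonal x : Mat n) = ∏ z ∈ Finset.univ.image x, (X - C z) := by
    refine eq_of_monic_of_associated (minpoly.monic (Algebra.IsIntegral.isIntegral _))
      (monic_prod_of_monic _ _ fun z _ => monic_X_sub_C z) (associated_of_dvd_dvd ?_ ?_)
    · rw [h0]
      intro i
      rw [eval_prod]
      exact Finset.prod_eq_zero (Finset.mem_image_of_mem x (Finset.mem_univ i)) (by simp)
    · refine Finset.prod_dvd_of_coprime (fun z _ w _ hzw => ?_) fun z hz => ?_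
      · exact isCoprime_X_sub_C_of_isUnit_sub (sub_ne_zero.2 hzw).isUnit
      · obtain ⟨i, -, rfl⟩ := Finset.mem_image.1 hz
        rw [dvd_iff_isRoot]
        exact (h0 _).1 dvd_rfl i
  rw [h1, natDegree_prod_of_monic _ _ fun z _ => monic_X_sub_C z]
  simp

lemma evalInf_mul (f g : ℂ[X]) (q : P1) : evalInf (f * g) q = evalInf f q * evalInf g q := by
  induction q using OnePoint.rec with
  | infty => exact eval_mul
  | coe a =>
    change (if a = 0 then 0 else _) = (if a = 0 then 0 else _) * (if a = 0 then 0 else _)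
    split_ifs
    · rw [mul_zero]
    · exact eval_mul

lemma eval₀_mul (f g : ℂ[X]) (q : P1) : eval₀ (f * g) q = eval₀ f q * eval₀ g q := by
  induction q using OnePoint.rec with
  | infty => exact (mul_zero _).symm
  | coe a => exact eval_mul

namespace IsDiagIn

variable {φ : Mor n} {g : (Mat n)ˣ} {p : Fin n → P1}

lemma reduced (h : IsDiagIn φ g p) : φ.image.Reduced := by
  have key : ∀ (ψ : RingSetHom n) (ev : ℂ[X] → P1 → ℂ)
      (_ : ∀ f f' q, ev (f * f') q = ev f q * ev f' q)
      (_ : ∀ f, ψ f = conjHom g (Matrix.diagonal fun i => ev f (p i))),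
      IsReduced (ℂ[X] ⧸ kerIdeal ψ) := by
    intro ψ ev hmul hψ
    have hker : ∀ f, f ∈ kerIdeal ψ ↔ ∀ i, ev f (p i) = 0 := by
      intro f
      change ψ f = 0 ↔ _
      rw [hψ, map_eq_zero_iff _ (conjHom_injective g), Matrix.diagonal_eq_zero, funext_iff]
      rfl
    rw [← Ideal.isRadical_iff_quotient_reduced]
    rintro f ⟨k, hk⟩
    rw [hker] at hk ⊢
    intro i
    have h1 : ∀ k : ℕ, ev (f ^ (k + 1)) (p i) = ev f (p i) ^ (k + 1) := by
      intro k
      induction k with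
      | zero => simp
      | succ k ih => rw [pow_succ, hmul, ih, ← pow_succ]
    have h2 : ev (f ^ (k + 1)) (p i) = 0 := by rw [pow_succ, hmul, hk i, zero_mul]
    rw [h1] at h2
    exact pow_eq_zero_iff (Nat.succ_ne_zero k) |>.1 h2
  exact ⟨key _ eval₀ eval₀_mul fun f => (h f).1, key _ evalInf evalInf_mul fun f => (h f).2⟩

lemma supp_eq (h : IsDiagIn φ g p) : φ.supp = Set.range p := by
  ext q
  change φ.chanPaton q ≠ ⊥ ↔ _
  rw [Submodule.ne_bot_iff]
  constructor
  · rintro ⟨v, hv, hv0⟩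
    by_contra hq
    refine hv0 (colCoord_injective g (funext fun j => ?_))
    rw [h.mem_chanPaton.1 hv j fun hj => hq ⟨j, hj⟩]
    exact (congrFun (Matrix.mulVec_zero _) j).symm
  · rintro ⟨j, rfl⟩
    refine ⟨(g : Mat n).mulVec (Pi.single j 1), h.mem_chanPaton.2 fun i hi => ?_, fun h0 => ?_⟩
    · rw [colCoord_mulVec, Pi.single_eq_of_ne fun hij => hi (by rw [hij])]
    · have h1 := congrArg (colCoord g) h0
      rw [colCoord_mulVec] at h1
      have h2 := congrFun h1 j
      rw [Pi.single_eq_same] at h2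
      exact one_ne_zero (h2.trans (congrFun (Matrix.mulVec_zero _) j))

lemma hasLength_image (h : IsDiagIn φ g p) : φ.image.HasLength φ.supp.ncard := by
  classical
  obtain ⟨c, hc⟩ := exists_coe_ne p
  rw [h.supp_eq, h.eq_affineMor hc, hasLength_image_affineMor,
    minpoly.algHom_eq (conjHom g) (conjHom_injective g), natDegree_minpoly_diagonal,
    ← Set.image_univ, ← Finset.coe_univ, ← Finset.coe_image, Set.ncard_coe_finset]
  have h1 : (Finset.univ.image fun i => affCoord c (p i)).image (affPoint c) =
      Finset.univ.image p := by
    rw [Finset.image_image]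
    exact Finset.image_congr fun i _ => affPoint_affCoord (hc i)
  rw [← h1, Finset.card_image_of_injective _ (affPoint_injective c)]

lemma supp_ncard_le (h : IsDiagIn φ g p) : φ.supp.ncard ≤ n := by
  rw [h.supp_eq, ← Set.image_univ]
  refine (Set.ncard_image_le Set.finite_univ).trans ?_
  rw [Set.ncard_univ, Nat.card_eq_fintype_card, Fintype.card_fin]

end IsDiagIn

theorem range_chowMap : Set.range (chowMap (n := n)) = {x | x.image.Reduced} := by
  ext x
  induction x using Quotient.inductionOn with
  | _ φ =>
    constructor
    · rintro ⟨s, hs⟩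
      obtain ⟨p, rfl⟩ := ofPoints_surjective s
      rw [chowMap_ofPoints] at hs
      obtain ⟨g, hg⟩ := mk_eq_iff_isDiagIn.1 hs.symm
      exact hg.reduced
    · intro hx
      obtain ⟨g, p, hg⟩ := exists_isDiagIn_of_reduced hx
      exact ⟨_, hg.mk_eq.symm⟩

lemma exists_isDiagIn_of_mem_range {φ : Mor n} (h : (⟦φ⟧ : MapSpace n) ∈ Set.range chowMap)
    {p : Fin n → P1} (hp : SymP1.ofPoints p = morCycle φ) : ∃ g, IsDiagIn φ g p := by
  refine mk_eq_iff_isDiagIn.1 ?_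
  obtain ⟨s, hs⟩ := h
  rw [← chowMap_ofPoints, hp, ← mapCycle_mk, ← hs, leftInverse_mapCycle_chowMap s]

end ReducedImages

/-! ### Chan-Paton spaces and gauge symmetry of diagonalizable morphisms -/

section GaugeSymmetry

variable {n : ℕ}

namespace IsDiagIn

variable {φ : Mor n} {g : (Mat n)ˣ} {p : Fin n → P1}

lemma mulVec_chanPaton (h : IsDiagIn φ g p) {q : P1} {v : Fin n → ℂ} (hv : v ∈ φ.chanPaton q)
    (f : ℂ[X]) :
    (φ.φ₀ f).mulVec v = eval₀ f q • v ∧ (φ.φInf f).mulVec v = evalInf f q • v := by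
  rw [h.mem_chanPaton] at hv
  rw [(h f).1, (h f).2]
  constructor <;>
  · refine colCoord_injective g (funext fun j => ?_)
    rw [colCoord_conjHom_mulVec, colCoord_smul, Matrix.mulVec_diagonal, Pi.smul_apply, smul_eq_mul]
    by_cases hj : p j = q
    · rw [hj]
    · rw [hv j hj, mul_zero, mul_zero]

lemma iSupIndep_chanPaton (h : IsDiagIn φ g p) : iSupIndep φ.chanPaton := by
  intro q
  rw [Submodule.disjoint_def]
  intro v hv hv'
  let W : Submodule ℂ (Fin n → ℂ) :=
    { carrier := {v | ∀ j, p j = q → colCoord g v j = 0}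
      add_mem' := fun {v w} hv hw j hj => by
        rw [colCoord_add, Pi.add_apply, hv j hj, hw j hj, add_zero]
      zero_mem' := fun j _ => congrFun (Matrix.mulVec_zero _) j
      smul_mem' := fun s v hv j hj => by
        rw [colCoord_smul, Pi.smul_apply, hv j hj, smul_zero] }
  have hW : (⨆ q' ≠ q, φ.chanPaton q') ≤ W := by
    refine iSup₂_le fun q' hq' w hw j hj => ?_
    exact h.mem_chanPaton.1 hw j fun h' => hq' (h'.symm.trans hj)
  refine colCoord_injective g (funext fun j => ?_)
  refine Eq.trans ?_ (congrFun (Matrix.mulVec_zero _) j).symm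
  by_cases hj : p j = q
  · exact hW hv' j hj
  · exact h.mem_chanPaton.1 hv j hj

lemma mulVec_single_mem_chanPaton (h : IsDiagIn φ g p) (j : Fin n) :
    (g : Mat n).mulVec (Pi.single j 1) ∈ φ.chanPaton (p j) :=
  h.mem_chanPaton.2 fun i hi => by
    rw [colCoord_mulVec, Pi.single_eq_of_ne fun hij => hi (by rw [hij])]

lemma eq_sum_colCoord (g : (Mat n)ˣ) (v : Fin n → ℂ) :
    v = ∑ j, colCoord g v j • (g : Mat n).mulVec (Pi.single j 1) := by
  conv_lhs => rw [← mulVec_colCoord g v, Matrix.mulVec_eq_sum]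
  simp
  rfl

lemma iSup_chanPaton (h : IsDiagIn φ g p) : (⨆ q, φ.chanPaton q) = ⊤ := by
  rw [eq_top_iff]
  intro v _
  rw [eq_sum_colCoord g v]
  exact Submodule.sum_mem _ fun j _ => Submodule.smul_mem _ _
    (Submodule.mem_iSup_of_mem (p j) (h.mulVec_single_mem_chanPaton j))

lemma mulVec_mem_chanPaton (h : IsDiagIn φ g p) {A : Mat n} (hA : A ∈ φ.gauge) {q : P1}
    {v : Fin n → ℂ} (hv : v ∈ φ.chanPaton q) : A.mulVec v ∈ φ.chanPaton q := by
  obtain ⟨B, rfl⟩ := exists_eq_conjHom g A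
  rw [h.mem_gauge] at hA
  rw [h.mem_chanPaton] at hv ⊢
  intro i hi
  rw [colCoord_conjHom_mulVec]
  refine (Finset.sum_eq_zero fun j _ => ?_ : ∑ j, B i j * colCoord g v j = 0)
  by_cases hj : p j = q
  · rw [hA i j fun hij => hi (hij.trans hj), zero_mul]
  · rw [hv j hj, mul_zero]

/-- The action of the gauge algebra on the Chan-Paton spaces. -/
noncomputable def gaugeAction (h : IsDiagIn φ g p) :
    φ.gauge →ₐ[ℂ] ((q : φ.supp) → Module.End ℂ (φ.chanPaton q)) where
  toFun A q := (Matrix.toLin' (A : Mat n)).restrict fun _ hv => h.mulVec_mem_chanPaton A.2 hv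
  map_one' := by
    funext q
    refine LinearMap.ext fun v => Subtype.ext ?_
    change (1 : Mat n).mulVec (v : Fin n → ℂ) = v
    exact Matrix.one_mulVec _
  map_mul' A B := by
    funext q
    refine LinearMap.ext fun v => Subtype.ext ?_
    change ((A : Mat n) * (B : Mat n)).mulVec (v : Fin n → ℂ) =
      (A : Mat n).mulVec ((B : Mat n).mulVec (v : Fin n → ℂ))
    exact (Matrix.mulVec_mulVec _ _ _).symm
  map_zero' := by
    funext q
    refine LinearMap.ext fun v => Subtype.ext ?_
    change (0 : Mat n).mulVec (v : Fin n → ℂ) = 0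
    exact Matrix.zero_mulVec _
  map_add' A B := by
    funext q
    refine LinearMap.ext fun v => Subtype.ext ?_
    change ((A : Mat n) + (B : Mat n)).mulVec (v : Fin n → ℂ) =
      (A : Mat n).mulVec (v : Fin n → ℂ) + (B : Mat n).mulVec (v : Fin n → ℂ)
    exact Matrix.add_mulVec _ _ _
  commutes' r := by
    funext q
    refine LinearMap.ext fun v => Subtype.ext ?_
    change (algebraMap ℂ (Mat n) r).mulVec v = r • (v : Fin n → ℂ)
    rw [Algebra.algebraMap_eq_smul_one, Matrix.smul_mulVec, Matrix.one_mulVec]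

lemma gaugeAction_bijective (h : IsDiagIn φ g p) : Function.Bijective h.gaugeAction := by
  have hsupp : ∀ j, p j ∈ φ.supp := fun j => h.supp_eq ▸ Set.mem_range_self j
  constructor
  · intro A B hAB
    refine Subtype.ext (g.isUnit.mul_left_injective ?_)
    refine Matrix.ext_of_mulVec_single fun j => ?_
    have h1 := congrArg Subtype.val (LinearMap.congr_fun (congrFun hAB ⟨p j, hsupp j⟩)
      ⟨_, h.mulVec_single_mem_chanPaton j⟩)
    beta_reduce
    rw [← Matrix.mulVec_mulVec, ← Matrix.mulVec_mulVec]
    exact h1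
  · intro T
    let u : ∀ j, φ.chanPaton (p j) := fun j => ⟨_, h.mulVec_single_mem_chanPaton j⟩
    let M : Mat n := Matrix.of fun i j => (T ⟨p j, hsupp j⟩ (u j) : Fin n → ℂ) i
    have hA : M * (g⁻¹ : (Mat n)ˣ) ∈ φ.gauge := by
      have e : M * (g⁻¹ : (Mat n)ˣ) = conjHom g ((g⁻¹ : (Mat n)ˣ) * M) := by
        rw [conjHom_apply, ← mul_assoc, Units.mul_inv, one_mul]
      rw [e, h.mem_gauge]
      intro i j hij
      exact h.mem_chanPaton.1 (T ⟨p j, hsupp j⟩ (u j)).2 i hij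
    refine ⟨⟨_, hA⟩, funext fun q => LinearMap.ext fun v => Subtype.ext ?_⟩
    change (M * ((g⁻¹ : (Mat n)ˣ) : Mat n)).mulVec (v : Fin n → ℂ) = T q v
    rw [← Matrix.mulVec_mulVec]
    change M.mulVec (colCoord g v) = T q v
    classical
    let u' : Fin n → φ.chanPaton q := fun j =>
      if hj : p j = q then ⟨_, hj ▸ h.mulVec_single_mem_chanPaton j⟩ else 0
    have hv : v = ∑ j, colCoord g v j • u' j := by
      refine Subtype.ext ?_
      rw [Submodule.coe_sum]
      conv_lhs => rw [eq_sum_colCoord g v]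
      refine Finset.sum_congr rfl fun j _ => ?_
      by_cases hj : p j = q
      · simp only [u', dif_pos hj]
        rfl
      · rw [h.mem_chanPaton.1 v.2 j hj, zero_smul, zero_smul]
        rfl
    have hT : ∀ j, p j = q → (T q (u' j) : Fin n → ℂ) = M.col j := by
      obtain ⟨q, hq⟩ := q
      intro j hj
      dsimp only at hj
      subst hj
      simp only [u', dif_pos]
      rfl
    conv_rhs => rw [hv]
    rw [map_sum, Submodule.coe_sum, Matrix.mulVec_eq_sum]
    refine Finset.sum_congr rfl fun j _ => ?_
    rw [map_smul, Submodule.coe_smul]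
    by_cases hj : p j = q
    · rw [hT j hj]
      simp
      rfl
    · rw [h.mem_chanPaton.1 v.2 j hj, zero_smul]
      simp

end IsDiagIn

end GaugeSymmetry

/-! ### Higgsing and un-Higgsing -/

section Families

variable {n k : ℕ}

open Classical in
lemma finsum_fiber_eq (ν : Fin k → ℕ) (P : Fin k → P1) (p : P1) :
    (∑ᶠ (i : Fin k) (_ : P i = p), ν i) = ∑ i, if P i = p then ν i else 0 := by
  rw [finsum_eq_sum_of_fintype]
  exact Finset.sum_congr rfl fun i _ => finsum_eq_if

open Classical in
lemma mult_ofPoints_comp {τ : Fin n → Fin k} {ν : Fin k → ℕ}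
    (hτ : ∀ i, (Finset.univ.filter fun j => τ j = i).card = ν i) (P : Fin k → P1) (p : P1) :
    (SymP1.ofPoints (P ∘ τ)).mult p = ∑ᶠ (i : Fin k) (_ : P i = p), ν i := by
  rw [finsum_fiber_eq, mult_ofPoints, Finset.card_filter, ← Finset.sum_fiberwise Finset.univ τ]
  refine Finset.sum_congr rfl fun i _ => ?_
  have h : ∀ j ∈ Finset.univ.filter (fun j => τ j = i),
      (if (P ∘ τ) j = p then 1 else 0) = if P i = p then 1 else 0 := by
    intro j hj
    rw [Function.comp_apply, (Finset.mem_filter.1 hj).2]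
  rw [Finset.sum_congr rfl h, Finset.sum_const, hτ, smul_eq_mul, mul_ite, mul_one, mul_zero]

open Classical in
/-- A basis of `ℂⁿ` is distributed over the stacks of a diagonalizable morphism. -/
lemma exists_isDiagIn_of_isStacked {φ : Mor n} (h : (⟦φ⟧ : MapSpace n) ∈ Set.range chowMap)
    {ν : Fin k → ℕ} {b : Fin k → P1} (hs : φ.IsStacked ν b) : ∃ τ : Fin n → Fin k,
      (∀ i, (Finset.univ.filter fun j => τ j = i).card = ν i) ∧ ∃ g, IsDiagIn φ g (b ∘ τ) := by
  have hsum : ∑ i, ν i = n := by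
    let M : Multiset P1 := ∑ i, Multiset.replicate (ν i) (b i)
    have hM : M = (show Sym P1 n from morCycle φ).1 := by
      refine Multiset.ext.2 fun p => ?_
      have h1 : (show Sym P1 n from morCycle φ).1.count p = Module.finrank ℂ (φ.chanPaton p) :=
        mult_morCycle φ p
      rw [h1, hs p, finsum_fiber_eq, Multiset.count_sum']
      refine Finset.sum_congr rfl fun i _ => ?_
      rw [Multiset.count_replicate]
    have h2 := congrArg Multiset.card hM
    rw [Multiset.card_sum, (show Sym P1 n from morCycle φ).2] at h2
    simpa using h2
  let e : Fin n ≃ Σ i : Fin k, Fin (ν i) := Fintype.equivOfCardEq (by simp [hsum])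
  have hτ : ∀ i, (Finset.univ.filter fun j => (e j).1 = i).card = ν i := by
    intro i
    rw [← Fintype.card_subtype, Fintype.card_congr ((e.subtypeEquiv fun j => Iff.rfl).trans
      (Equiv.sigmaSubtype i)), Fintype.card_fin]
  refine ⟨fun j => (e j).1, hτ, exists_isDiagIn_of_mem_range h (symP1_ext fun p => ?_)⟩
  rw [mult_ofPoints_comp hτ, mult_morCycle, hs p]

namespace IsDiagIn

variable {φ ψ : Mor n} {g : (Mat n)ˣ} {b P : Fin k → P1} {τ : Fin n → Fin k}

open Classical in
lemma isStacked {ν : Fin k → ℕ} (hτ : ∀ i, (Finset.univ.filter fun j => τ j = i).card = ν i)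
    (h : IsDiagIn φ g (P ∘ τ)) : φ.IsStacked ν P := by
  intro p
  rw [← mult_ofPoints_comp hτ, ← mult_morCycle, ← mapCycle_mk, h.mk_eq,
    leftInverse_mapCycle_chowMap]

/-- For morphisms that are diagonal in the same basis, with the stacks `P` of `ψ` pairwise distinct,
the Chan-Paton spaces of `φ` are sums of those of `ψ`. -/
lemma chanPaton_eq_iSup (hφ : IsDiagIn φ g (b ∘ τ)) (hψ : IsDiagIn ψ g (P ∘ τ))
    (hP : Function.Injective P) (p : P1) :
    φ.chanPaton p = ⨆ (i : Fin k) (_ : b i = p), ψ.chanPaton (P i) := by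
  refine le_antisymm (fun v hv => ?_) (iSup₂_le fun i hi v hv => ?_)
  · rw [hφ.mem_chanPaton] at hv
    rw [eq_sum_colCoord g v]
    refine Submodule.sum_mem _ fun j _ => ?_
    by_cases hj : b (τ j) = p
    · exact Submodule.smul_mem _ _ (Submodule.mem_iSup_of_mem (τ j)
        (Submodule.mem_iSup_of_mem hj (hψ.mulVec_single_mem_chanPaton j)))
    · rw [hv j hj, zero_smul]
      exact Submodule.zero_mem _
  · rw [hψ.mem_chanPaton] at hv
    refine hφ.mem_chanPaton.2 fun j hj => hv j fun h => hj ?_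
    rw [← hi]
    exact congrArg b (hP h)

lemma gauge_le (hφ : IsDiagIn φ g (b ∘ τ)) (hψ : IsDiagIn ψ g (P ∘ τ))
    (hP : Function.Injective P) : ψ.gauge ≤ φ.gauge := by
  intro A hA
  obtain ⟨B, rfl⟩ := exists_eq_conjHom g A
  rw [hψ.mem_gauge] at hA
  exact hφ.mem_gauge.2 fun i j hij => hA i j fun h => hij (congrArg b (hP h))

lemma gauge_lt (hφ : IsDiagIn φ g (b ∘ τ)) (hψ : IsDiagIn ψ g (P ∘ τ))
    (hP : Function.Injective P) (hτ : Function.Surjective τ) (hb : ¬ Function.Injective b) :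
    ψ.gauge < φ.gauge := by
  refine lt_of_le_not_ge (hφ.gauge_le hψ hP) fun hle => ?_
  simp only [Function.Injective, not_forall] at hb
  obtain ⟨i, j, hij, hne⟩ := hb
  obtain ⟨l, rfl⟩ := hτ i
  obtain ⟨m, rfl⟩ := hτ j
  -- An elementary matrix between two stacks that `ψ` separates and `φ` does not.
  have h1 : conjHom g (Matrix.single l m 1) ∈ φ.gauge := by
    refine hφ.mem_gauge.2 fun i' j' h => ?_
    refine Matrix.single_apply_of_ne _ _ _ _ _ ?_
    rintro ⟨rfl, rfl⟩
    exact h hij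
  have h2 := hψ.mem_gauge.1 (hle h1) l m fun h => hne (hP h)
  rw [Matrix.single_apply_same] at h2
  exact one_ne_zero h2

end IsDiagIn

/-- A complex number that is not a real multiple of finitely many others. -/
lemma exists_ne_real_mul (T : Finset ℂ) : ∃ w : ℂ, w ≠ 0 ∧
    ∀ d ∈ T, ∀ r : ℝ, d = r * w → d = 0 := by
  classical
  obtain ⟨s, hs⟩ := Infinite.exists_notMem_finset (T.image fun d => d.im / d.re)
  refine ⟨1 + s * Complex.I, fun h => ?_, fun d hd r hdr => ?_⟩
  · have := congrArg Complex.re h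
    simp at this
  · by_contra hd0
    have hre : d.re = r := by rw [hdr]; simp
    have him : d.im = r * s := by rw [hdr]; simp
    have hr : r ≠ 0 := by
      rintro rfl
      exact hd0 (by rw [hdr, Complex.ofReal_zero, zero_mul])
    refine hs (Finset.mem_image.2 ⟨d, hd, ?_⟩)
    rw [hre, him, mul_div_cancel_left₀ _ hr]

/-- A path of affine coordinates of the stacks moves a diagonalizable morphism. -/
lemma exists_family {φ : Mor n} {g : (Mat n)ˣ} {b : Fin k → P1} {τ : Fin n → Fin k}
    (h : IsDiagIn φ g (b ∘ τ)) {c : ℂ} (hc : ∀ i, b i ≠ (c : P1))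
    {y : unitInterval → Fin k → ℂ} (hy : Continuous y) (hy0 : ∀ i, y 0 i = affCoord c (b i)) :
    ∃ (Φ : unitInterval → Mor n), Continuous Φ ∧ Φ 0 = φ ∧
      (Continuous fun t i => affPoint c (y t i)) ∧ (fun i => affPoint c (y 0 i)) = b ∧
      ∀ t, IsDiagIn (Φ t) g ((fun i => affPoint c (y t i)) ∘ τ) := by
  refine ⟨fun t => affineMor c (conjHom g (Matrix.diagonal fun j => y t (τ j))), ?_, ?_, ?_, ?_,
    fun t => isDiagIn_affineMor g c _⟩
  · refine (continuous_affineMor c).comp ?_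
    have h1 : Continuous fun t => fun j => y t (τ j) :=
      continuous_pi fun j => (continuous_apply (τ j)).comp hy
    have h2 : Continuous fun t => (Matrix.diagonal fun j => y t (τ j) : Mat n) := h1.matrix_diagonal
    simp only [conjHom_apply]
    exact (continuous_const.mul h2).mul continuous_const
  · rw [h.eq_affineMor (c := c) fun j => hc (τ j)]
    simp only [hy0, Function.comp_apply]
  · exact continuous_pi fun i => (continuous_affPoint c).comp ((continuous_apply i).comp hy)
  · funext i
    rw [hy0, affPoint_affCoord (hc i)]

lemma surjective_of_card_fiber {τ : Fin n → Fin k} {ν : Fin k → ℕ} (hν : ∀ i, 0 < ν i)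
    (hτ : ∀ i, (Finset.univ.filter fun j => τ j = i).card = ν i) : Function.Surjective τ := by
  intro i
  have h := hν i
  rw [← hτ, Finset.card_pos] at h
  obtain ⟨j, hj⟩ := h
  exact ⟨j, (Finset.mem_filter.1 hj).2⟩

/-- Higgsing: in an affine coordinate, the stack `i` moves with speed `i` in a direction that is not
a real multiple of any difference of two distinct stacks. -/
theorem exists_higgsing {φ : Mor n} (h : (⟦φ⟧ : MapSpace n) ∈ Set.range chowMap)
    {ν : Fin k → ℕ} {b : Fin k → P1} (hν : ∀ i, 0 < ν i) (hs : φ.IsStacked ν b) :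
    ∃ (Φ : unitInterval → Mor n) (P : unitInterval → Fin k → P1),
      Continuous Φ ∧ Continuous P ∧ Φ 0 = φ ∧ P 0 = b ∧
      (∀ t, ⟦Φ t⟧ ∈ Set.range chowMap ∧ (Φ t).IsStacked ν (P t)) ∧
      ∀ t, t ≠ 0 → Function.Injective (P t) ∧
        (∀ p, φ.chanPaton p = (⨆ (i : Fin k) (_ : b i = p), (Φ t).chanPaton (P t i))) ∧
        (Φ t).gauge ≤ φ.gauge ∧ (¬ Function.Injective b → (Φ t).gauge < φ.gauge) := by
  classical
  obtain ⟨τ, hτ, g, hg⟩ := exists_isDiagIn_of_isStacked h hs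
  obtain ⟨c, hc⟩ := exists_coe_ne b
  obtain ⟨w, hw0, hw⟩ := exists_ne_real_mul
    (Finset.univ.image fun i : Fin k × Fin k => affCoord c (b i.1) - affCoord c (b i.2))
  let y : unitInterval → Fin k → ℂ := fun t i =>
    affCoord c (b i) + ((t : ℝ) : ℂ) * ((i : ℕ) : ℂ) * w
  have hy : Continuous y := by
    have h1 : Continuous fun t : unitInterval => ((t : ℝ) : ℂ) :=
      Complex.continuous_ofReal.comp continuous_subtype_val
    exact continuous_pi fun i => by fun_prop
  obtain ⟨Φ, hΦ, hΦ0, hP, hP0, hdiag⟩ := exists_family hg hc hy fun i => by simp [y]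
  refine ⟨Φ, _, hΦ, hP, hΦ0, hP0, fun t => ⟨⟨_, (hdiag t).mk_eq.symm⟩, (hdiag t).isStacked hτ⟩,
    fun t ht => ?_⟩
  have hinj : Function.Injective fun i => affPoint c (y t i) := by
    intro i j hij
    have h1 : y t i = y t j := affPoint_injective c hij
    have h2 : affCoord c (b i) - affCoord c (b j) =
        (((t : ℝ) * ((j : ℕ) - (i : ℕ)) : ℝ) : ℂ) * w := by
      simp only [y] at h1
      push_cast
      linear_combination h1
    have h3 := hw _ (Finset.mem_image_of_mem _ (Finset.mem_univ (i, j))) _ h2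
    dsimp only at h3
    rw [h3, eq_comm, mul_eq_zero, or_iff_left hw0, Complex.ofReal_eq_zero, mul_eq_zero] at h2
    have ht' : (t : ℝ) ≠ 0 := fun h => ht (Subtype.ext h)
    have h4 := sub_eq_zero.1 (h2.resolve_left ht')
    exact Fin.ext (by exact_mod_cast h4.symm)
  exact ⟨hinj, hg.chanPaton_eq_iSup (hdiag t) hinj, hg.gauge_le (hdiag t) hinj,
    hg.gauge_lt (hdiag t) hinj (surjective_of_card_fiber hν hτ)⟩

/-- Un-Higgsing: in an affine coordinate, the stack `i` moves on a segment to the position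
`s i * w`, where `w` is not a real multiple of any difference of two stacks. -/
theorem exists_unHiggsing {φ : Mor n} (h : (⟦φ⟧ : MapSpace n) ∈ Set.range chowMap)
    {ν : Fin k → ℕ} {b : Fin k → P1} (hν : ∀ i, 0 < ν i) (hs : φ.IsStacked ν b)
    (hb : Function.Injective b) (s : Fin k → ℕ) :
    ∃ (Φ : unitInterval → Mor n) (P : unitInterval → Fin k → P1),
      Continuous Φ ∧ Continuous P ∧ Φ 0 = φ ∧ P 0 = b ∧
      (∀ t, ⟦Φ t⟧ ∈ Set.range chowMap ∧ (Φ t).IsStacked ν (P t)) ∧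
      (∀ t, t ≠ 1 → Function.Injective (P t)) ∧
      (∀ i j, P 1 i = P 1 j ↔ s i = s j) ∧
      (∀ p, (Φ 1).chanPaton p = (⨆ (i : Fin k) (_ : P 1 i = p), φ.chanPaton (b i))) ∧
      φ.gauge ≤ (Φ 1).gauge ∧ (¬ Function.Injective s → φ.gauge < (Φ 1).gauge) := by
  classical
  obtain ⟨τ, hτ, g, hg⟩ := exists_isDiagIn_of_isStacked h hs
  obtain ⟨c, hc⟩ := exists_coe_ne b
  obtain ⟨w, hw0, hw⟩ := exists_ne_real_mul
    (Finset.univ.image fun i : Fin k × Fin k => affCoord c (b i.1) - affCoord c (b i.2))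
  let y : unitInterval → Fin k → ℂ := fun t i =>
    (1 - ((t : ℝ) : ℂ)) * affCoord c (b i) + ((t : ℝ) : ℂ) * (s i : ℂ) * w
  have hy : Continuous y := by
    have h1 : Continuous fun t : unitInterval => ((t : ℝ) : ℂ) :=
      Complex.continuous_ofReal.comp continuous_subtype_val
    exact continuous_pi fun i => by fun_prop
  obtain ⟨Φ, hΦ, hΦ0, hP, hP0, hdiag⟩ := exists_family hg hc hy fun i => by simp [y]
  have hone : ∀ i j, affPoint c (y 1 i) = affPoint c (y 1 j) ↔ s i = s j := by
    intro i j
    rw [(affPoint_injective c).eq_iff]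
    simp [y, hw0]
  refine ⟨Φ, _, hΦ, hP, hΦ0, hP0, fun t => ⟨⟨_, (hdiag t).mk_eq.symm⟩, (hdiag t).isStacked hτ⟩,
    fun t ht i j hij => ?_, hone, (hdiag 1).chanPaton_eq_iSup hg hb, (hdiag 1).gauge_le hg hb,
    fun hs' => (hdiag 1).gauge_lt hg hb (surjective_of_card_fiber hν hτ) fun hinj => hs' ?_⟩
  · have h1 : y t i = y t j := affPoint_injective c hij
    have ht' : 1 - (t : ℝ) ≠ 0 := fun h => ht (Subtype.ext (sub_eq_zero.1 h).symm)
    have h2 : affCoord c (b i) - affCoord c (b j) =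
        (((1 - (t : ℝ))⁻¹ * ((t : ℝ) * ((s j : ℝ) - s i)) : ℝ) : ℂ) * w := by
      have ht'' : (1 : ℂ) - ((t : ℝ) : ℂ) ≠ 0 := by exact_mod_cast ht'
      simp only [y] at h1
      push_cast
      rw [mul_assoc, eq_inv_mul_iff_mul_eq₀ ht'']
      linear_combination h1
    have h3 := hw _ (Finset.mem_image_of_mem _ (Finset.mem_univ (i, j))) _ h2
    have h4 : affCoord c (b i) = affCoord c (b j) := sub_eq_zero.1 h3
    refine hb ?_
    rw [← affPoint_affCoord (hc i), h4, affPoint_affCoord (hc j)]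
  · exact fun i j hij => hinj ((hone i j).2 hij)

end Families

theorem proposition4p2p2 (n : ℕ) :
    ∃ (ΦHilb : Hilb n → MapSpace n) (ΦChow : SymP1 n → MapSpace n)
      (π : MapSpace n → SymP1 n),
      -- the embedding of the Hilbert scheme
      (Topology.IsEmbedding ΦHilb ∧
        (∀ Z, (ΦHilb Z).image = Z.1) ∧
        Set.range ΦHilb = {x | x.image.HasLength n}) ∧
      -- the embedding of the Chow variety
      (Topology.IsEmbedding ΦChow ∧
        (∀ p : Fin n → P1, ∃ φ : Mor n, ΦChow (SymP1.ofPoints p) = ⟦φ⟧ ∧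
          ∀ f, φ.φ₀ f = Matrix.diagonal (fun i => eval₀ f (p i)) ∧
            φ.φInf f = Matrix.diagonal (fun i => evalInf f (p i))) ∧
        Set.range ΦChow = {x | x.image.Reduced} ∧
        ∀ x ∈ Set.range ΦChow, ∃ d ≤ n, x.image.HasLength d) ∧
      -- the map to the Chow variety, with `ΦChow` as a section
      (Continuous π ∧
        (∀ (φ : Mor n) (p : P1), (π ⟦φ⟧).mult p = Module.finrank ℂ (φ.chanPaton p)) ∧
        Function.LeftInverse π ΦChow) ∧
      -- D0-branes, Chan-Paton spaces and gauge symmetry in the Chow locus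
      (∀ φ : Mor n, ⟦φ⟧ ∈ Set.range ΦChow →
        φ.image.HasLength φ.supp.ncard ∧
        (∀ p, ∀ v ∈ φ.chanPaton p, ∀ f,
          (φ.φ₀ f).mulVec v = eval₀ f p • v ∧ (φ.φInf f).mulVec v = evalInf f p • v) ∧
        iSupIndep φ.chanPaton ∧ (⨆ p, φ.chanPaton p) = ⊤ ∧
        ∃ Θ : φ.gauge ≃ₐ[ℂ] ((p : φ.supp) → Module.End ℂ (φ.chanPaton p)),
          ∀ (A : φ.gauge) (p : φ.supp) (v : φ.chanPaton p),
            (Θ A p v : Fin n → ℂ) = (A : Mat n).mulVec v) ∧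
      -- Higgsing: the stacks at the points `b i` are separated
      (∀ φ : Mor n, ⟦φ⟧ ∈ Set.range ΦChow →
        ∀ (k : ℕ) (ν : Fin k → ℕ) (b : Fin k → P1), (∀ i, 0 < ν i) → φ.IsStacked ν b →
        ∃ (Φ : unitInterval → Mor n) (P : unitInterval → Fin k → P1),
          Continuous Φ ∧ Continuous P ∧ Φ 0 = φ ∧ P 0 = b ∧
          (∀ t, ⟦Φ t⟧ ∈ Set.range ΦChow ∧ (Φ t).IsStacked ν (P t)) ∧
          ∀ t, t ≠ 0 → Function.Injective (P t) ∧
            (∀ p, φ.chanPaton p = (⨆ (i : Fin k) (_ : b i = p), (Φ t).chanPaton (P t i))) ∧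
            (Φ t).gauge ≤ φ.gauge ∧
            (¬ Function.Injective b → (Φ t).gauge < φ.gauge)) ∧
      -- un-Higgsing: the stacks at the points `b i` with the same label `s i` collide
      (∀ φ : Mor n, ⟦φ⟧ ∈ Set.range ΦChow →
        ∀ (k : ℕ) (ν : Fin k → ℕ) (b : Fin k → P1), (∀ i, 0 < ν i) → φ.IsStacked ν b →
        Function.Injective b → ∀ s : Fin k → ℕ,
        ∃ (Φ : unitInterval → Mor n) (P : unitInterval → Fin k → P1),
          Continuous Φ ∧ Continuous P ∧ Φ 0 = φ ∧ P 0 = b ∧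
          (∀ t, ⟦Φ t⟧ ∈ Set.range ΦChow ∧ (Φ t).IsStacked ν (P t)) ∧
          (∀ t, t ≠ 1 → Function.Injective (P t)) ∧
          (∀ i j, P 1 i = P 1 j ↔ s i = s j) ∧
          (∀ p, (Φ 1).chanPaton p = (⨆ (i : Fin k) (_ : P 1 i = p), φ.chanPaton (b i))) ∧
          φ.gauge ≤ (Φ 1).gauge ∧
          (¬ Function.Injective s → φ.gauge < (Φ 1).gauge)) := by
  refine ⟨hilbMap, chowMap, mapCycle, ⟨isEmbedding_hilbMap, image_hilbMap, range_hilbMap⟩,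
    ⟨isEmbedding_chowMap, fun p => ⟨diagMor p, chowMap_ofPoints p, fun f => ⟨diagMor₀ p f,
      diagMorInf p f⟩⟩, range_chowMap, ?_⟩,
    ⟨continuous_mapCycle, mult_morCycle, leftInverse_mapCycle_chowMap⟩, ?_,
    fun φ h k ν b hν hs => exists_higgsing h hν hs,
    fun φ h k ν b hν hs hb s => exists_unHiggsing h hν hs hb s⟩
  · intro x hx
    induction x using Quotient.inductionOn with
    | _ φ =>
      obtain ⟨p, hp⟩ := ofPoints_surjective (morCycle φ)
      obtain ⟨g, hg⟩ := exists_isDiagIn_of_mem_range hx hp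
      exact ⟨_, hg.supp_ncard_le, hg.hasLength_image⟩
  · intro φ h
    obtain ⟨p, hp⟩ := ofPoints_surjective (morCycle φ)
    obtain ⟨g, hg⟩ := exists_isDiagIn_of_mem_range h hp
    exact ⟨hg.hasLength_image, fun q v hv f => hg.mulVec_chanPaton hv f, hg.iSupIndep_chanPaton,
      hg.iSup_chanPaton, AlgEquiv.ofBijective hg.gaugeAction hg.gaugeAction_bijective,
      fun A q v => rfl⟩
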